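/- Let $M$ be a (Hausdorff, second countable) smooth real manifold of dimension $n$, let $\pi$ be a Poisson structure on $M$ with bracket $\{f,g\}=\pi(df,dg)$ on $C=C^\infty(M)$, and let $\mu$ be a volume form on $M$. For $f\in C$ let $X_f$ be the Hamiltonian vector field, $X_f(g)=\{g,f\}$. There is exactly one vector field $\phi$ on $M$, the modular vector field of $M$ with respect to $\mu$, such that $\mathscr{L}_{X_f}\mu=\phi(f)\mu$ for all $f\in C$; it is a Poisson vector field, i.e. $\phi(\{f,g\})=\{\phi(f),g\}+\{f,\phi(g)\}$. Let $W$ be a Poisson geometric module: a $C$-module with $\bigcap_{p\in M}\mathfrak{m}_pW=0$, where $\mathfrak{m}_p$ is the ideal of the functions vanishing at $p$, together with an $\mathbb{R}$-bilinear map $\{-,-\}_W:W\times C\to W$ such that $\{w,\{f,g\}\}_W=\{\{w,f\}_W,g\}_W-\{\{w,g\}_W,f\}_W$, $\{fw,g\}_W=f\{w,g\}_W+\{f,g\}w$ and $\{w,fg\}_W=g\{w,f\}_W+f\{w,g\}_W$. For a Poisson vector field $\psi$, let $W_\psi$ be the module $W$ with the twisted bracket $\{w,f\}_{W_\psi}=\{w,f\}_W+\psi(f)w$.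 The Poisson homology $\mathrm{HP}_r(M,W)$ is the homology of $\cdots\to W\otimes_C\Omega^{r}(M)\xrightarrow{\partial_r}W\otimes_C\Omega^{r-1}(M)\to\cdots\to W\otimes_C\Omega^0(M)\to 0$, where for each $r\ge 1$ the map $\partial_r$ is the (existing and unique) $\mathbb{R}$-linear map with $$\partial_r(w\otimes f_0\,df_1\wedge\cdots\wedge df_r)=\sum_{i=1}^r(-1)^{i-1}\{f_0w,f_i\}_W\otimes df_1\wedge\cdots\widehat{df_i}\cdots\wedge df_r+\sum_{1\le i<j\le r}(-1)^{i+j}w\otimes f_0\,d\{f_i,f_j\}\wedge df_1\wedge\cdots\widehat{df_i}\cdots\widehat{df_j}\cdots\wedge df_r .$$ The Poisson cohomology $\mathrm{HP}^r(M,W)$ is the cohomology of $0\to W\xrightarrow{\delta^0}\mathfrak{X}^1(W)\xrightarrow{\delta^1}\mathfrak{X}^2(W)\to\cdots$, where $\mathfrak{X}^r(W)$ is the space of skew-symmetric $\mathbb{R}$-multilinear maps $C^r\to W$ that are derivations in each argument and $$\delta^r(X)(f_1,\dots,f_{r+1})=\sum_{i=1}^{r+1}(-1)^i\{X(f_1,\dots,\widehat{f_i},\dots,f_{r+1}),f_i\}_W+\sum_{1\le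 i<j\le r+1}(-1)^{i+j}X(\{f_i,f_j\},f_1,\dots,\widehat{f_i},\dots,\widehat{f_j},\dots,f_{r+1}).$$ Then for all $0\le k\le n$ there are isomorphisms of real vector spaces $$\mathrm{HP}_{n-k}(M,W_{-\phi})\cong\mathrm{HP}^k(M,W)\qquad\text{and}\qquad \mathrm{HP}_{n-k}(M,W)\cong\mathrm{HP}^k(M,W_\phi).$$ -/

import Mathlib

open scoped Manifold ContDiff TensorProduct Bundle

noncomputable section

namespace PoissonDuality

/-! ### Smooth functions, vector fields and differential forms

Throughout, `M` is a manifold of dimension `n` modelled on `EuclideanSpace ℝ (Fin n)`. -/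

section Calculus

variable (n : ℕ) (M : Type*) [TopologicalSpace M] [ChartedSpace (EuclideanSpace ℝ (Fin n)) M]

/-- The algebra `C^∞(M)` of real smooth functions on `M`. -/
abbrev SmoothFun : Type _ := C^∞⟮𝓡 n, M; 𝓘(ℝ, ℝ), ℝ⟯

variable {n M}

/-- The differential `df_x : T_x M → ℝ` of a smooth function at a point. -/
def diffAt (f : SmoothFun n M) (x : M) : Module.Dual ℝ (TangentSpace (𝓡 n) x) :=
  (mvfderiv (𝓡 n) (f : M → ℝ) x).toLinearMap

theorem diffAt_add (f g : SmoothFun n M) (x : M) : diffAt (f + g) x = diffAt f x + diffAt g x := by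
  ext v
  have hf := (f.contMDiff x).mdifferentiableAt (by simp)
  have hg := (g.contMDiff x).mdifferentiableAt (by simp)
  have := congrArg (fun L => L v) (mvfderiv_add hf hg)
  simpa [diffAt] using this

theorem diffAt_smul (c : ℝ) (f : SmoothFun n M) (x : M) : diffAt (c • f) x = c • diffAt f x := by
  ext v
  have hf := (f.contMDiff x).mdifferentiableAt (by simp)
  have := congrArg (fun L => L v)
    (mvfderiv_smul (a := fun _ : M => c) (g := (f : M → ℝ)) mdifferentiableAt_const hf)
  have h2 : (fun _ : M => c) • (f : M → ℝ) = c • (f : M → ℝ) := rfl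
  rw [h2] at this
  simpa [diffAt, mvfderiv_const] using this

theorem diffAt_mul (f g : SmoothFun n M) (x : M) :
    diffAt (f * g) x = f x • diffAt g x + g x • diffAt f x := by
  ext v
  have hf := (f.contMDiff x).mdifferentiableAt (by simp)
  have hg := (g.contMDiff x).mdifferentiableAt (by simp)
  have := congrArg (fun L => L v) (mvfderiv_mul hf hg)
  simpa [diffAt] using this

variable [IsManifold (𝓡 n) ∞ M]

variable (n M) in
/-- The space `𝔛¹(M)` of smooth vector fields: the smooth sections of the tangent bundle. -/
abbrev VField : Type _ :=
  Cₛ^∞⟮𝓡 n; EuclideanSpace ℝ (Fin n), (TangentSpace (𝓡 n) : M → Type _)⟯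

theorem contMDiff_diffAt_apply (f : SmoothFun n M) (X : VField n M) :
    ContMDiff (𝓡 n) 𝓘(ℝ, ℝ) ∞ (fun x => diffAt f x (X x)) := by
  have h1 := f.contMDiff.contMDiff_tangentMap (m := ∞) (by simp)
  have h2 := h1.comp X.contMDiff
  exact (contMDiff_snd_tangentBundle_modelSpace ℝ 𝓘(ℝ, ℝ)).comp h2

/-- The function `X(f) = df(X)`. -/
def VField.apply (X : VField n M) (f : SmoothFun n M) : SmoothFun n M :=
  ⟨fun x => diffAt f x (X x), contMDiff_diffAt_apply f X⟩

variable (n M) in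
/-- The space `Ω^k(M)` of smooth `k`-forms: families `η_x` of alternating `k`-linear forms on the
tangent spaces such that `x ↦ η_x(Y₁(x), …, Y_k(x))` is smooth for all smooth vector fields
`Y₁, …, Y_k`. -/
@[ext]
structure Form (k : ℕ) where
  /-- the value `η_x ∈ Λ^k T_x^* M` -/
  val : ∀ x : M, (TangentSpace (𝓡 n) x) [⋀^Fin k]→ₗ[ℝ] ℝ
  smooth : ∀ Y : Fin k → VField n M,
    ContMDiff (𝓡 n) 𝓘(ℝ, ℝ) ∞ (fun x => val x (fun i => Y i x))

namespace Form

variable {k : ℕ}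

instance : Zero (Form n M k) := ⟨⟨fun _ => 0, fun _ => contMDiff_const⟩⟩
instance : Add (Form n M k) :=
  ⟨fun η θ => ⟨fun x => η.val x + θ.val x, fun Y => (η.smooth Y).add (θ.smooth Y)⟩⟩
instance : Neg (Form n M k) := ⟨fun η => ⟨fun x => -η.val x, fun Y => (η.smooth Y).neg⟩⟩
instance : SMul (SmoothFun n M) (Form n M k) :=
  ⟨fun f η => ⟨fun x => f x • η.val x, fun Y => f.contMDiff.mul (η.smooth Y)⟩⟩

@[simp] theorem zero_val (x : M) : (0 : Form n M k).val x = 0 := rfl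
@[simp] theorem add_val (η θ : Form n M k) (x : M) : (η + θ).val x = η.val x + θ.val x := rfl
@[simp] theorem neg_val (η : Form n M k) (x : M) : (-η).val x = -η.val x := rfl
@[simp] theorem smul_val (f : SmoothFun n M) (η : Form n M k) (x : M) :
    (f • η).val x = f x • η.val x := rfl

instance : AddCommGroup (Form n M k) where
  add_assoc a b c := by ext x : 2; simp [add_assoc]
  zero_add a := by ext x : 2; simp
  add_zero a := by ext x : 2; simp
  add_comm a b := by ext x : 2; simp [add_comm]
  neg_add_cancel a := by ext x : 2; simp
  nsmul := nsmulRec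
  zsmul := zsmulRec

instance : Module (SmoothFun n M) (Form n M k) where
  one_smul η := by ext x : 2; simp
  mul_smul f g η := by ext x : 2; simp [mul_smul]
  smul_zero f := by ext x : 2; simp
  smul_add f η θ := by ext x : 2; simp
  add_smul f g η := by ext x : 2; simp [add_smul]
  zero_smul η := by ext x : 2; simp

end Form

/-- The `k`-form `df₁ ∧ ⋯ ∧ df_k`, whose value on `(v₁, …, v_k)` is `det (df_i(v_j))`. -/
def wedgeDiff {k : ℕ} (f : Fin k → SmoothFun n M) : Form n M k where
  val x := Matrix.detRowAlternating.compLinearMap (LinearMap.pi fun i => diffAt (f i) x)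
  smooth Y := by
    have h : (fun x : M => (Matrix.detRowAlternating.compLinearMap
        (LinearMap.pi fun i => diffAt (f i) x) : _ [⋀^Fin k]→ₗ[ℝ] ℝ) (fun i => Y i x)) =
        fun x => ∑ σ : Equiv.Perm (Fin k), ((Equiv.Perm.sign σ : ℤ) : ℝ) *
          ∏ i, diffAt (f i) x (Y (σ i) x) := by
      funext x
      exact Matrix.det_apply' _
    rw [h]
    refine contMDiff_finsetSum fun σ _ => contMDiff_const.mul (contMDiff_finsetProd fun i _ => contMDiff_diffAt_apply (f i) (Y (σ i)))

/-- A volume form: a nowhere vanishing form of top degree. -/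
def IsVolumeForm (μ : Form n M n) : Prop := ∀ x, μ.val x ≠ 0

/-- The Lie derivative `L_X η` of a `k`-form along a vector field `X`, evaluated at `x` on smooth
vector fields `Y₁, …, Y_k`:
`(L_X η)(Y₁, …, Y_k) = X(η(Y₁, …, Y_k)) - ∑ᵢ η(Y₁, …, [X, Yᵢ], …, Y_k)`. -/
def lieDerivEval {k : ℕ} (X : ∀ x : M, TangentSpace (𝓡 n) x) (η : Form n M k)
    (Y : Fin k → VField n M) (x : M) : ℝ :=
  diffAt (⟨fun y => η.val y (fun i => Y i y), η.smooth Y⟩ : SmoothFun n M) x (X x) -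
    ∑ i, η.val x (Function.update (fun j => Y j x) i (VectorField.mlieBracket (𝓡 n) X (Y i) x))

end Calculus

/-! ### Poisson structures and the modular vector field -/

section Poisson

variable (n : ℕ) (M : Type*) [TopologicalSpace M] [ChartedSpace (EuclideanSpace ℝ (Fin n)) M]

instance (x : M) : Module.Finite ℝ (TangentSpace (𝓡 n) x) :=
  inferInstanceAs (Module.Finite ℝ (EuclideanSpace ℝ (Fin n)))

instance (x : M) : Module.Free ℝ (TangentSpace (𝓡 n) x) :=
  inferInstanceAs (Module.Free ℝ (EuclideanSpace ℝ (Fin n)))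

/-- A smooth bivector field `π`: a family of alternating bilinear forms `π_x` on the cotangent
spaces (that is, elements of `Λ² T_x M`) such that `π(df, dg)` is smooth for all smooth `f, g`. -/
structure Bivector where
  /-- the value `π_x` -/
  val : ∀ x : M, (Module.Dual ℝ (TangentSpace (𝓡 n) x)) [⋀^Fin 2]→ₗ[ℝ] ℝ
  smooth : ∀ f g : SmoothFun n M,
    ContMDiff (𝓡 n) 𝓘(ℝ, ℝ) ∞ (fun x => val x ![diffAt f x, diffAt g x])

variable {n M}

/-- The bracket `{f, g} = π(df, dg)` of functions. -/
def Bivector.bracket (P : Bivector n M) (f g : SmoothFun n M) : SmoothFun n M :=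
  ⟨fun x => P.val x ![diffAt f x, diffAt g x], P.smooth f g⟩

/-- The bundle map `π^♯ : T^*M → TM`, `π^♯(α) = ι_α π`; that is, `β(π^♯(α)) = π(α, β)` for every
covector `β`. -/
def Bivector.sharp (P : Bivector n M) (x : M) (α : Module.Dual ℝ (TangentSpace (𝓡 n) x)) :
    TangentSpace (𝓡 n) x :=
  (Module.evalEquiv ℝ (TangentSpace (𝓡 n) x)).symm
    { toFun := fun β => P.val x ![α, β]
      map_add' := fun β γ => by
        have h (δ) : Function.update ![α, 0] 1 δ = ![α, δ] := by
          funext i; fin_cases i <;> rfl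
        simpa only [h] using (P.val x).map_update_add ![α, 0] 1 β γ
      map_smul' := fun c β => by
        have h (δ) : Function.update ![α, 0] 1 δ = ![α, δ] := by
          funext i; fin_cases i <;> rfl
        simpa only [h] using! (P.val x).map_update_smul ![α, 0] 1 c β }

theorem Bivector.apply_sharp (P : Bivector n M) (x : M)
    (α β : Module.Dual ℝ (TangentSpace (𝓡 n) x)) : β (P.sharp x α) = P.val x ![α, β] := by
  simp [Bivector.sharp]

theorem Bivector.bracket_swap (P : Bivector n M) (f g : SmoothFun n M) :
    P.bracket f g = -P.bracket g f := by
  ext x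
  have h := (P.val x).map_swap ![diffAt g x, diffAt f x] (i := 0) (j := 1) (by decide)
  have h2 : (![diffAt g x, diffAt f x] ∘ Equiv.swap (0 : Fin 2) 1) = ![diffAt f x, diffAt g x] := by
    funext i; fin_cases i <;> simp
  rw [h2] at h
  exact h

theorem Bivector.bracket_neg_left (P : Bivector n M) (f g : SmoothFun n M) :
    P.bracket (-f) g = -P.bracket f g := by
  ext x
  have h := (P.val x).map_update_neg ![0, diffAt g x] 0 (diffAt f x)
  have h1 : diffAt (-f) x = -diffAt f x := by
    have h := diffAt_smul (-1) f x
    rwa [neg_one_smul ℝ f, neg_one_smul ℝ (diffAt f x)] at h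
  have h2 (δ) : Function.update ![0, diffAt g x] 0 δ = ![δ, diffAt g x] := by
    funext i; fin_cases i <;> rfl
  rw [h2, h2, ← h1] at h
  exact h

variable (n M) in
/-- A Poisson structure on `M`: a bivector field whose bracket is a Lie bracket on `C^∞(M)`.
Bilinearity and skew-symmetry of the bracket are automatic. -/
structure PoissonStructure extends Bivector n M where
  jacobi : ∀ f g h : SmoothFun n M,
    toBivector.bracket f (toBivector.bracket g h) + toBivector.bracket g (toBivector.bracket h f) +
      toBivector.bracket h (toBivector.bracket f g) = 0

/-- The Hamiltonian vector field `X_f = -π^♯(df)`, so that `X_f(g) = {g, f}`. -/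
def PoissonStructure.hamiltonian (P : PoissonStructure n M) (f : SmoothFun n M) (x : M) :
    TangentSpace (𝓡 n) x :=
  -P.sharp x (diffAt f x)

variable [IsManifold (𝓡 n) ∞ M]

/-- `φ` is a Poisson vector field: `φ({f, g}) = {φ(f), g} + {f, φ(g)}`. -/
def PoissonStructure.IsPoissonField (P : PoissonStructure n M) (φ : VField n M) : Prop :=
  ∀ f g : SmoothFun n M,
    φ.apply (P.bracket f g) = P.bracket (φ.apply f) g + P.bracket f (φ.apply g)

/-- `φ` is the modular vector field with respect to the volume form `μ`: for every `f`, the Lie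
derivative of `μ` along the Hamiltonian vector field of `f` is `φ(f) μ`. -/
def PoissonStructure.IsModularField (P : PoissonStructure n M) (μ : Form n M n)
    (φ : VField n M) : Prop :=
  ∀ (f : SmoothFun n M) (Y : Fin n → VField n M) (x : M),
    lieDerivEval (P.hamiltonian f) μ Y x = φ.apply f x * μ.val x (fun i => Y i x)

theorem VField.neg_apply (φ : VField n M) (f : SmoothFun n M) : (-φ).apply f = -φ.apply f := by
  ext x
  exact map_neg (diffAt f x) (φ x)

theorem VField.apply_add (φ : VField n M) (f g : SmoothFun n M) :
    φ.apply (f + g) = φ.apply f + φ.apply g := by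
  ext x
  exact congrArg (fun L => L (φ x)) (diffAt_add f g x)

theorem VField.apply_smul (φ : VField n M) (c : ℝ) (f : SmoothFun n M) :
    φ.apply (c • f) = c • φ.apply f := by
  ext x
  exact congrArg (fun L => L (φ x)) (diffAt_smul c f x)

theorem VField.apply_mul (φ : VField n M) (f g : SmoothFun n M) :
    φ.apply (f * g) = f * φ.apply g + g * φ.apply f := by
  ext x
  exact congrArg (fun L => L (φ x)) (diffAt_mul f g x)

theorem PoissonStructure.IsPoissonField.neg {P : PoissonStructure n M} {φ : VField n M}
    (h : P.IsPoissonField φ) : P.IsPoissonField (-φ) := by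
  intro f g
  rw [VField.neg_apply, VField.neg_apply, VField.neg_apply, h f g, P.bracket_neg_left,
    P.bracket_swap f (-_), P.bracket_neg_left, P.bracket_swap (φ.apply g) f]
  abel

end Poisson

/-! ### Poisson modules, their homology and cohomology -/

section Modules

variable {n : ℕ} {M : Type*} [TopologicalSpace M] [ChartedSpace (EuclideanSpace ℝ (Fin n)) M]

variable (n M) in
/-- A `C^∞(M)`-module `W` is geometric if `⋂_p 𝔪_p W = 0`, where `𝔪_p` is the ideal of the functions
that vanish at `p`. -/
def IsGeometric (W : Type*) [AddCommGroup W] [Module (SmoothFun n M) W] : Prop :=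
  (⨅ p : M, RingHom.ker (ContMDiffMap.evalRingHom p : SmoothFun n M →+* ℝ) •
    (⊤ : Submodule (SmoothFun n M) W)) = ⊥

/-- A right Poisson module structure on a `C^∞(M)`-module `W`: a bilinear map
`{-,-}_W : W × C^∞(M) → W` which makes `W` a right Lie module and is compatible with products in
both arguments. -/
structure PoissonModule (P : PoissonStructure n M) (W : Type*) [AddCommGroup W]
    [Module (SmoothFun n M) W] [Module ℝ W] where
  /-- the bracket `{w, f}_W` -/
  act : W →ₗ[ℝ] SmoothFun n M →ₗ[ℝ] W
  act_bracket : ∀ (w : W) (f g : SmoothFun n M),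
    act w (P.bracket f g) = act (act w f) g - act (act w g) f
  act_smul : ∀ (w : W) (f g : SmoothFun n M),
    act (f • w) g = f • act w g + P.bracket f g • w
  act_mul : ∀ (w : W) (f g : SmoothFun n M),
    act w (f * g) = g • act w f + f • act w g

variable {P : PoissonStructure n M} {W : Type*} [AddCommGroup W] [Module (SmoothFun n M) W]
  [Module ℝ W] [IsScalarTower ℝ (SmoothFun n M) W]

/-- The twisted Poisson module `W_φ`: the module `W` with the bracket
`{w, f}_{W_φ} = {w, f}_W + φ(f) w`, for a Poisson vector field `φ`. -/
def PoissonModule.twist [IsManifold (𝓡 n) ∞ M] (V : PoissonModule P W) (φ : VField n M)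
    (hφ : P.IsPoissonField φ) : PoissonModule P W where
  act := LinearMap.mk₂ ℝ (fun w f => V.act w f + φ.apply f • w)
    (fun w w' f => by simp; abel)
    (fun c w f => by simp only [map_smul, LinearMap.smul_apply, smul_add, smul_comm c])
    (fun w f g => by simp [VField.apply_add, add_smul]; abel)
    (fun c w f => by simp [VField.apply_smul])
  act_bracket w f g := by
    have h := hφ f g
    rw [P.bracket_swap f (φ.apply g)] at h
    simp only [LinearMap.mk₂_apply, map_add, LinearMap.add_apply, V.act_smul, V.act_bracket, h,
      add_smul, neg_smul, smul_smul, mul_comm (φ.apply f)]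
    abel
  act_smul w f g := by
    simp only [LinearMap.mk₂_apply, V.act_smul, smul_add, smul_smul, mul_comm f]
    abel
  act_mul w f g := by
    simp only [LinearMap.mk₂_apply, V.act_mul, VField.apply_mul, smul_add, smul_smul, add_smul]
    abel

/-- For a function `Φ` of `r` variables in `C^∞(M)`, the sum
`∑_{i < j} (-1)^{i+j} Φ({f_i, f_j}, f_1, …, f̂_i, …, f̂_j, …, f_{r+1})`, which is empty for `r = 0`.
(The entry of index `i < j` of `f` has index `i` also after the entry of index `j` is removed; the
sign does not depend on whether indices start at `0` or at `1`.) -/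
def pairSum (P : PoissonStructure n M) {A : Type*} [AddCommGroup A] :
    (r : ℕ) → ((Fin r → SmoothFun n M) → A) → (Fin (r + 1) → SmoothFun n M) → A
  | 0, _, _ => 0
  | r + 1, Φ, f => ∑ j : Fin (r + 2), ∑ i : Fin (r + 1), if i.castSucc < j then
      (-1 : ℤ) ^ ((i : ℕ) + (j : ℕ)) • Φ (Fin.cons (P.bracket (f i.castSucc) (f j))
        (Fin.removeNth i (Fin.removeNth j f))) else 0

theorem pairSum_add (P : PoissonStructure n M) {A : Type*} [AddCommGroup A] (r : ℕ)
    (Φ Ψ : (Fin r → SmoothFun n M) → A) (f : Fin (r + 1) → SmoothFun n M) :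
    pairSum P r (fun g => Φ g + Ψ g) f = pairSum P r Φ f + pairSum P r Ψ f := by
  cases r with
  | zero => simp only [pairSum, add_zero]
  | succ r => simp only [pairSum, smul_add, ite_add_zero, Finset.sum_add_distrib]

theorem pairSum_smul (P : PoissonStructure n M) {A : Type*} [AddCommGroup A] [Module ℝ A] (r : ℕ)
    (c : ℝ) (Φ : (Fin r → SmoothFun n M) → A) (f : Fin (r + 1) → SmoothFun n M) :
    pairSum P r (fun g => c • Φ g) f = c • pairSum P r Φ f := by
  cases r with
  | zero => simp only [pairSum, smul_zero]
  | succ r => simp only [pairSum, smul_comm _ c, Finset.smul_sum, smul_ite, smul_zero]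

variable (n M W) in
/-- The space of skew-symmetric `k`-derivations of `C^∞(M)` with values in `W`, as a subspace of the
space of alternating `ℝ`-multilinear maps. -/
def multiDerSubmodule (k : ℕ) : Submodule ℝ ((SmoothFun n M) [⋀^Fin k]→ₗ[ℝ] W) where
  carrier := {X | ∀ (f : Fin k → SmoothFun n M) (i : Fin k) (a b : SmoothFun n M),
    X (Function.update f i (a * b)) =
      a • X (Function.update f i b) + b • X (Function.update f i a)}
  zero_mem' f i a b := by simp
  add_mem' {X Y} hX hY f i a b := by
    simp only [AlternatingMap.add_apply, hX f i a b, hY f i a b, smul_add]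
    abel
  smul_mem' c X hX f i a b := by
    simp only [AlternatingMap.smul_apply, hX f i a b, smul_add, smul_comm c]

variable (n M W) in
/-- The space `𝔛^k(W)` of skew-symmetric `k`-derivations of `C^∞(M)` with values in `W`. -/
def MultiDer (k : ℕ) : Type _ := multiDerSubmodule n M W k

instance (k : ℕ) : AddCommGroup (MultiDer n M W k) :=
  inferInstanceAs (AddCommGroup (multiDerSubmodule n M W k))

instance (k : ℕ) : Module ℝ (MultiDer n M W k) :=
  inferInstanceAs (Module ℝ (multiDerSubmodule n M W k))

variable (n M W) in
/-- The map that regards a skew-symmetric `k`-derivation as a function of `k` variables. -/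
def MultiDer.toFun (k : ℕ) : MultiDer n M W k →ₗ[ℝ] ((Fin k → SmoothFun n M) → W) where
  toFun X f := X.1 f
  map_add' _ _ := rfl
  map_smul' _ _ := rfl

instance (k : ℕ) : CoeFun (MultiDer n M W k) (fun _ => (Fin k → SmoothFun n M) → W) :=
  ⟨fun X => MultiDer.toFun n M W k X⟩

namespace PoissonModule

/-- The Poisson cochain differential `δ^r` on `X ∈ 𝔛^r(W)`:
`δ^r(X)(f_1, …, f_{r+1}) = ∑_i (-1)^i {X(f_1, …, f̂_i, …, f_{r+1}), f_i}_W
  + ∑_{i < j} (-1)^{i+j} X({f_i, f_j}, f_1, …, f̂_i, …, f̂_j, …, f_{r+1})`,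
with indices from `1` to `r + 1`, written as a function of `(f_1, …, f_{r+1})`. -/
def coboundary (V : PoissonModule P W) (r : ℕ) :
    MultiDer n M W r →ₗ[ℝ] ((Fin (r + 1) → SmoothFun n M) → W) where
  toFun X f :=
    (∑ i : Fin (r + 1), (-1 : ℤ) ^ ((i : ℕ) + 1) • V.act (X (Fin.removeNth i f)) (f i)) +
      pairSum P r X f
  map_add' X Y := by
    funext f
    simp only [map_add, Pi.add_apply, LinearMap.add_apply, smul_add, Finset.sum_add_distrib,
      pairSum_add P r, Pi.add_def]
    abel
  map_smul' c X := by
    funext f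
    simp only [map_smul, Pi.smul_apply, LinearMap.smul_apply, smul_comm _ c, Pi.smul_def,
      pairSum_smul P r, RingHom.id_apply, smul_add, Finset.smul_sum]

/-- The cocycles in degree `k`: the kernel of `δ^k`. -/
def cocycles (V : PoissonModule P W) (k : ℕ) : Submodule ℝ (MultiDer n M W k) :=
  LinearMap.ker (V.coboundary k)

/-- The coboundaries in degree `k`: the image of `δ^{k-1}` (zero if `k = 0`). -/
def coboundaries (V : PoissonModule P W) : (k : ℕ) → Submodule ℝ (MultiDer n M W k)
  | 0 => ⊥
  | k + 1 => (LinearMap.range (V.coboundary k)).comap (MultiDer.toFun n M W (k + 1))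

/-- The `k`-th Poisson cohomology `HP^k(M, W)`. -/
abbrev Cohomology (V : PoissonModule P W) (k : ℕ) : Type _ :=
  V.cocycles k ⧸ (V.coboundaries k).submoduleOf (V.cocycles k)

variable [IsManifold (𝓡 n) ∞ M]

/-- `D` is the Poisson chain differential `∂_{r+1} : W ⊗ Ω^{r+1}(M) → W ⊗ Ω^r(M)`, that is,
`D(w ⊗ f₀ df₁ ∧ ⋯ ∧ df_{r+1}) =
  ∑_i (-1)^{i-1} {f₀ w, f_i}_W ⊗ df₁ ∧ ⋯ d̂f_i ⋯ ∧ df_{r+1}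
  + ∑_{i < j} (-1)^{i+j} w ⊗ f₀ d{f_i, f_j} ∧ df₁ ∧ ⋯ d̂f_i ⋯ d̂f_j ⋯ ∧ df_{r+1}`,
with indices from `1` to `r + 1`. -/
def IsBoundary (V : PoissonModule P W) (r : ℕ)
    (D : (W ⊗[SmoothFun n M] Form n M (r + 1)) →ₗ[ℝ] (W ⊗[SmoothFun n M] Form n M r)) : Prop :=
  ∀ (w : W) (f₀ : SmoothFun n M) (f : Fin (r + 1) → SmoothFun n M),
    D (w ⊗ₜ (f₀ • wedgeDiff f)) =
      (∑ i : Fin (r + 1), (-1 : ℤ) ^ (i : ℕ) •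
        (V.act (f₀ • w) (f i) ⊗ₜ[SmoothFun n M] wedgeDiff (Fin.removeNth i f))) +
      pairSum P r (fun g => w ⊗ₜ[SmoothFun n M] (f₀ • wedgeDiff g)) f

open Classical in
/-- The Poisson chain differential `∂_{r+1}`: the linear map determined by the formula above (and
`0` should no such map exist). -/
def boundary (V : PoissonModule P W) (r : ℕ) :
    (W ⊗[SmoothFun n M] Form n M (r + 1)) →ₗ[ℝ] (W ⊗[SmoothFun n M] Form n M r) :=
  if h : ∃ D, V.IsBoundary r D then h.choose else 0

/-- The cycles in degree `k`: the kernel of `∂_k` (everything if `k = 0`). -/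
def cycles (V : PoissonModule P W) : (k : ℕ) → Submodule ℝ (W ⊗[SmoothFun n M] Form n M k)
  | 0 => ⊤
  | k + 1 => LinearMap.ker (V.boundary k)

/-- The `k`-th Poisson homology `HP_k(M, W)`: the cycles modulo the image of `∂_{k+1}`. -/
abbrev Homology (V : PoissonModule P W) (k : ℕ) : Type _ :=
  V.cycles k ⧸ (LinearMap.range (V.boundary k)).submoduleOf (V.cycles k)

end PoissonModule

end Modules

end PoissonDuality

end

open PoissonDuality

/-! Let `J` be the multivector field of top degree with `⟨J, μ⟩ = 1`. Contracting `J` with forms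
gives a map `⋆ : W ⊗ Ω^m → 𝔛^{n-m}(W)`, `w ⊗ η ↦ (ι_η J) w`. It is bijective because `W` is
geometric: a derivation into such a module is determined by differentials, so skew-symmetric
multiderivations behave like `W`-valued multivector fields. The theorem follows from `δ ∘ ⋆ = - ⋆ ∘
∂`, where `∂` is taken for `W` and `δ` for `W_φ`. The twist is forced: `J` is not invariant under
Hamiltonian flows, and `φ` measures the failure, `φ(f) J(a) = ∑_j J(…, {a_j, f}, …) - {J(a), f}`.

Three ingredients carry the argument. (a) A finite global frame (`nonempty_coordFrame`): functions
`x_i` and vector fields `Y_i` with `∑ dx_i(v) Y_i = v` for all tangent vectors. It replaces local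
coordinates throughout; sums over frame indices give `J`, `φ`, `⋆` and its inverse, with factorials
in the place of ordered bases. Hadamard's lemma makes the frame compute derivations into geometric
modules (`CoordFrame.map_eq_sum`). (b) The modular field in terms of `J`
(`IsDualVolume.mul_lieDerivEval`, `exists_modularField`), obtained by differentiating `J(a) μ(Y) =
det (Y_i a_j)` along a Hamiltonian field. (c) The intertwining relation (`cob_altSmul_contract`). A
Cartan formula allows one function at a time to pass from the form to the arguments of the cochain,
and the induction ends at `δ(J w) = 0` (`cob_altSmul_dualVolume`). The latter holds because the
relevant expressions are skew in `n + 1` arguments on a manifold of dimension `n`.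

The existence of `∂` is a by-product: on generators, `-δ ∘ ⋆` takes values in the image of `⋆`, and
`⋆` is injective. The other isomorphism is the same statement for `W_{-φ}`, since `(W_{-φ})_φ = W`.
-/

noncomputable section

namespace PoissonDuality

/-! ### Smooth dependence of integrals on parameters, and Hadamard's lemma -/

section Hadamard

universe u

theorem contDiff_nat_parametric_intervalIntegral {E : Type u} [NormedAddCommGroup E]
    [NormedSpace ℝ E] [FiniteDimensional ℝ E] (k : ℕ) :
    -- The target varies in the induction, which passes from `F` to `E →L[ℝ] F`; the common universe
    -- keeps that space admissible.
    ∀ {F : Type u} [NormedAddCommGroup F] [NormedSpace ℝ F] (f : E → ℝ → F),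
      ContDiff ℝ k (Function.uncurry f) → ContDiff ℝ k (fun x => ∫ t in (0 : ℝ)..1, f x t) := by
  induction k with
  | zero =>
    intro F _ _ f hf
    exact contDiff_zero.2 (intervalIntegral.continuous_parametric_intervalIntegral_of_continuous'
      (contDiff_zero.1 hf) 0 1)
  | succ k ih =>
    intro F _ _ f hf
    have hd : ∀ z, HasFDerivAt (Function.uncurry f) (fderiv ℝ (Function.uncurry f) z) z := fun z =>
      (hf.differentiable (by simp) z).hasFDerivAt
    set F' : E → ℝ → E →L[ℝ] F := fun x t =>
      (fderiv ℝ (Function.uncurry f) (x, t)).comp (ContinuousLinearMap.inl ℝ E ℝ) with hF'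
    have hF'c : ContDiff ℝ k (Function.uncurry F') := by
      have : ContDiff ℝ k (fderiv ℝ (Function.uncurry f)) :=
        hf.fderiv_right (m := k) (by push_cast; exact le_rfl)
      exact this.clm_comp contDiff_const
    have hcf : Continuous (Function.uncurry f) := hf.continuous
    have hcF' : Continuous (Function.uncurry F') := hF'c.continuous
    push_cast
    refine contDiff_succ_iff_hasFDerivAt.2 ⟨_, ih F' hF'c, fun x₀ => ?_⟩
    -- Compactness bounds the derivative near `x₀`, uniformly in `t`, so a constant serves as
    -- dominating function.
    obtain ⟨C, hC⟩ := ((isCompact_closedBall x₀ 1).prod (isCompact_Icc (a := (0 : ℝ))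
      (b := 1))).exists_bound_of_continuousOn hcF'.continuousOn
    refine intervalIntegral.hasFDerivAt_integral_of_dominated_of_fderiv_le (bound := fun _ => C)
      (Metric.closedBall_mem_nhds x₀ one_pos) ?_ ?_ ?_ ?_ ?_ ?_
    · exact Filter.Eventually.of_forall fun x =>
        (hcf.comp (Continuous.prodMk_right x)).aestronglyMeasurable
    · exact (hcf.comp (Continuous.prodMk_right x₀)).intervalIntegrable _ _
    · exact (hcF'.comp (Continuous.prodMk_right x₀)).aestronglyMeasurable
    · refine Filter.Eventually.of_forall fun t ht x hx => hC (x, t) ⟨hx, ?_⟩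
      rw [Set.uIoc_of_le zero_le_one] at ht
      exact ⟨ht.1.le, ht.2⟩
    · exact intervalIntegrable_const
    · refine Filter.Eventually.of_forall fun t _ x _ => ?_
      exact HasFDerivAt.comp (f := fun e : E => (e, t)) x (hd (x, t)) (hasFDerivAt_prodMk_left x t)

theorem contDiff_parametric_intervalIntegral {E F : Type u} [NormedAddCommGroup E]
    [NormedSpace ℝ E] [FiniteDimensional ℝ E] [NormedAddCommGroup F] [NormedSpace ℝ F]
    {f : E → ℝ → F} (hf : ContDiff ℝ ∞ (Function.uncurry f)) :
    ContDiff ℝ ∞ (fun x => ∫ t in (0 : ℝ)..1, f x t) :=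
  contDiff_infty.2 fun k => contDiff_nat_parametric_intervalIntegral k f (contDiff_infty.1 hf k)

/-- Hadamard's lemma. -/
theorem exists_contDiff_eq_clm_apply_sub {E : Type} [NormedAddCommGroup E] [NormedSpace ℝ E]
    [FiniteDimensional ℝ E] {F : E → ℝ} (hF : ContDiff ℝ ∞ F) (y₀ : E) (h0 : F y₀ = 0) :
    ∃ H : E → E →L[ℝ] ℝ, ContDiff ℝ ∞ H ∧ H y₀ = fderiv ℝ F y₀ ∧ ∀ y, F y = H y (y - y₀) := by
  have hF' : ContDiff ℝ ∞ (fderiv ℝ F) := hF.fderiv_right (m := ∞) (by simp)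
  -- `H y` is the mean of the derivative along the segment from `y₀` to `y`.
  refine ⟨fun y => ∫ t in (0 : ℝ)..1, fderiv ℝ F (y₀ + t • (y - y₀)), ?_, ?_, fun y => ?_⟩
  · apply contDiff_parametric_intervalIntegral
    refine hF'.comp (contDiff_const.add (contDiff_snd.smul (contDiff_fst.sub contDiff_const)))
  · simp
  · have hc : Continuous fun t : ℝ => fderiv ℝ F (y₀ + t • (y - y₀)) :=
      hF'.continuous.comp (by fun_prop)
    dsimp only
    rw [ContinuousLinearMap.intervalIntegral_apply (hc.intervalIntegrable _ _)]
    have hd : ∀ t ∈ Set.uIcc (0 : ℝ) 1, HasDerivAt (fun t : ℝ => F (y₀ + t • (y - y₀)))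
        (fderiv ℝ F (y₀ + t • (y - y₀)) (y - y₀)) t := by
      intro t _
      have h1 : HasDerivAt (fun t : ℝ => y₀ + t • (y - y₀)) (y - y₀) t := by
        simpa using ((hasDerivAt_id t).smul_const (y - y₀)).const_add y₀
      exact ((hF.differentiable (by simp) _).hasFDerivAt).comp_hasDerivAt t h1
    rw [intervalIntegral.integral_eq_sub_of_hasDerivAt hd
      ((hc.clm_apply continuous_const).intervalIntegrable _ _)]
    simp [h0]

end Hadamard

/-! ### Local representatives of smooth functions, and squares of vanishing ideals -/

section Charts

variable {n : ℕ} {M : Type*} [TopologicalSpace M] [ChartedSpace (EuclideanSpace ℝ (Fin n)) M]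

theorem diffAt_congr {f g : SmoothFun n M} {x : M} (h : (f : M → ℝ) =ᶠ[nhds x] g) :
    diffAt f x = diffAt g x := by
  unfold diffAt mvfderiv
  rw [h.mfderiv_eq]
  rw [h.eq_of_nhds]

/-- The ideal of the functions that vanish at `p`. -/
abbrev vanishingIdeal (n : ℕ) {M : Type*} [TopologicalSpace M]
    [ChartedSpace (EuclideanSpace ℝ (Fin n)) M] (p : M) : Ideal (SmoothFun n M) :=
  RingHom.ker (ContMDiffMap.evalRingHom p : SmoothFun n M →+* ℝ)

variable [IsManifold (𝓡 n) ∞ M]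

/-- Near a point, a smooth function is the pullback along the chart of a smooth function on the
model space. -/
theorem exists_contDiff_comp_extChartAt (f : SmoothFun n M) (p : M) :
    ∃ F : EuclideanSpace ℝ (Fin n) → ℝ, ContDiff ℝ ∞ F ∧
      (f : M → ℝ) =ᶠ[nhds p] F ∘ extChartAt (𝓡 n) p := by
  set e := extChartAt (𝓡 n) p
  have ho : IsOpen e.target := isOpen_extChartAt_target p
  obtain ⟨ε, hε, hball⟩ := Metric.isOpen_iff.1 ho (e p) (mem_extChartAt_target p)
  -- The outer radius is below `ε`, so the closed support stays inside the chart target, outside of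
  -- which `e.symm` carries no information.
  let b : ContDiffBump (e p) := ⟨ε / 4, ε / 2, by positivity, by linarith⟩
  refine ⟨fun y => b y * f (e.symm y), ?_, ?_⟩
  · have hs : ContDiffOn ℝ ∞ (fun y => f (e.symm y)) e.target :=
      contMDiffOn_iff_contDiffOn.1 (f.contMDiff.comp_contMDiffOn (contMDiffOn_extChartAt_symm p))
    refine contDiff_iff_contDiffAt.2 fun y => ?_
    by_cases hy : y ∈ e.target
    · exact b.contDiffAt.mul (hs.contDiffAt (ho.mem_nhds hy))
    · have hy' : y ∉ tsupport b := by
        rw [b.tsupport_eq]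
        exact fun h => hy (hball (Metric.closedBall_subset_ball (by simp [b]; linarith) h))
      have : (fun y => b y * f (e.symm y)) =ᶠ[nhds y] fun _ => 0 := by
        filter_upwards [(isClosed_tsupport b).isOpen_compl.mem_nhds hy'] with z hz
        rw [image_eq_zero_of_notMem_tsupport hz, zero_mul]
      exact contDiffAt_const.congr_of_eventuallyEq this
  · have h1 : ∀ᶠ x in nhds p, b (e x) = 1 :=
      (continuousAt_extChartAt p).eventually b.eventuallyEq_one
    filter_upwards [h1, extChartAt_source_mem_nhds (I := 𝓡 n) p] with x hx hxs
    rw [Function.comp_apply, hx, one_mul, (extChartAt (𝓡 n) p).left_inv hxs]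

theorem diffAt_eq_fderiv_comp {f : SmoothFun n M} {p x : M}
    (hx : x ∈ (chartAt (EuclideanSpace ℝ (Fin n)) p).source) {F : EuclideanSpace ℝ (Fin n) → ℝ}
    (hF : DifferentiableAt ℝ F (extChartAt (𝓡 n) p x))
    (h : (f : M → ℝ) =ᶠ[nhds x] F ∘ extChartAt (𝓡 n) p) (v : TangentSpace (𝓡 n) x) :
    diffAt f x v = fderiv ℝ F (extChartAt (𝓡 n) p x)
      (mfderiv (𝓡 n) 𝓘(ℝ, EuclideanSpace ℝ (Fin n)) (extChartAt (𝓡 n) p) x v) := by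
  have h1 : diffAt f x v = mfderiv (𝓡 n) 𝓘(ℝ, ℝ) f x v := rfl
  rw [h1, h.mfderiv_eq, mfderiv_comp x hF.mdifferentiableAt
    (mdifferentiableAt_extChartAt hx), mfderiv_eq_fderiv]
  rfl

/-- Hadamard's lemma gives `f = ∑ (y - y₀)_j H_j` near `p`, and each `H_j` vanishes at `p` because
the differential does. A bump function makes the decomposition global. This turns pointwise
information about differentials into an algebraic statement that the Leibniz rule can use. -/
theorem mem_vanishingIdeal_mul_self [T2Space M] {p : M} {f : SmoothFun n M} (h0 : f p = 0)
    (h1 : diffAt f p = 0) : f ∈ vanishingIdeal n p * vanishingIdeal n p := by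
  obtain ⟨F, hF, hfF⟩ := exists_contDiff_comp_extChartAt f p
  set e := extChartAt (𝓡 n) p with he
  have hF0 : F (e p) = 0 := by rw [← h0]; exact hfF.eq_of_nhds.symm
  obtain ⟨H, hH, hH0, hHF⟩ := exists_contDiff_eq_clm_apply_sub hF (e p) hF0
  have hF1 : fderiv ℝ F (e p) = 0 := by
    ext v
    obtain ⟨A, hA⟩ := isInvertible_mfderiv_extChartAt (I := 𝓡 n) (mem_extChartAt_source p)
    have := diffAt_eq_fderiv_comp (mem_chart_source _ p) (hF.differentiable (by simp) _) hfF (A.symm v)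
    rw [h1, ← hA] at this
    rw [← A.apply_symm_apply v]
    exact this.symm
  obtain ⟨ψ, hψ⟩ : ∃ ψ : SmoothBumpFunction (𝓡 n) p,
      tsupport ψ ⊆ {x | f x = F (e x)} := by
    obtain ⟨ψ, -, hψ⟩ := (SmoothBumpFunction.nhds_basis_tsupport (I := 𝓡 n) p).mem_iff.1 hfF
    exact ⟨ψ, hψ⟩
  let Ψ : SmoothFun n M := ⟨ψ, ψ.contMDiff⟩
  have hes : ContMDiffOn (𝓡 n) 𝓘(ℝ, EuclideanSpace ℝ (Fin n)) ∞ e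
      (chartAt (EuclideanSpace ℝ (Fin n)) p).source := contMDiffOn_extChartAt
  let a : Fin n → SmoothFun n M := fun j => ⟨fun x => ψ x • (e x - e p) j, ψ.contMDiff_smul (by
    have h : ContDiff ℝ ∞ fun y : EuclideanSpace ℝ (Fin n) => (y - e p) j := by fun_prop
    exact h.contMDiff.comp_contMDiffOn hes)⟩
  let b : Fin n → SmoothFun n M := fun j => ⟨fun x =>
    ψ x • H (e x) (EuclideanSpace.single j 1), ψ.contMDiff_smul (by
    have h : ContDiff ℝ ∞ fun y => H y (EuclideanSpace.single j 1) := hH.clm_apply contDiff_const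
    exact h.contMDiff.comp_contMDiffOn hes)⟩
  -- The cutoff appears squared because each of `a j` and `b j` must be globally smooth. Both
  -- factors of every product vanish at `p`.
  have hsplit : f = (1 - Ψ * Ψ) * f + ∑ j, a j * b j := by
    ext x
    have hsum : (∑ j, a j * b j : SmoothFun n M) x =
        ψ x * ψ x * ∑ j, (e x - e p) j * H (e x) (EuclideanSpace.single j 1) := by
      have : (∑ j, a j * b j : SmoothFun n M) x = ∑ j, (a j * b j) x :=
        map_sum (ContMDiffMap.evalRingHom x : SmoothFun n M →+* ℝ) _ _
      rw [this, Finset.mul_sum]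
      refine Finset.sum_congr rfl fun j _ => ?_
      simp only [ContMDiffMap.coe_mul, Pi.mul_apply]
      change (ψ x • (e x - e p) j) * (ψ x • H (e x) (EuclideanSpace.single j 1)) = _
      simp only [smul_eq_mul]
      ring
    have hexp : H (e x) (e x - e p) = ∑ j, (e x - e p) j * H (e x) (EuclideanSpace.single j 1) := by
      conv_lhs => rw [← (EuclideanSpace.basisFun (Fin n) ℝ).sum_repr (e x - e p)]
      simp
    have hx : ψ x * f x = ψ x * F (e x) := by
      by_cases hxs : x ∈ tsupport ψ
      · rw [hψ hxs]
      · rw [image_eq_zero_of_notMem_tsupport hxs, zero_mul, zero_mul]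
    have : ((1 - Ψ * Ψ) * f + ∑ j, a j * b j : SmoothFun n M) x =
        (1 - ψ x * ψ x) * f x + (∑ j, a j * b j : SmoothFun n M) x := rfl
    rw [this, hsum, ← hexp, ← hHF, mul_assoc (ψ x), ← hx]
    ring
  rw [hsplit]
  have hψp : ψ p = 1 := ψ.eq_one
  refine Ideal.add_mem _ (Ideal.mul_mem_mul ?_ h0) (Ideal.sum_mem _ fun j _ =>
    Ideal.mul_mem_mul ?_ ?_)
  · change 1 - ψ p * ψ p = 0
    rw [hψp]; ring
  · change ψ p • (e p - e p) j = 0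
    simp
  · change ψ p • H (e p) (EuclideanSpace.single j 1) = 0
    simp [hH0, hF1]

end Charts

/-! ### A finite global frame of functions and dual vector fields -/

section Spanning

variable {n : ℕ} {M : Type*} [TopologicalSpace M] [ChartedSpace (EuclideanSpace ℝ (Fin n)) M]

/-- The differentials of the functions `g i` span the cotangent space at every point of `K`. -/
def SpansOn {ι : Type*} (g : ι → SmoothFun n M) (K : Set M) : Prop :=
  ∀ x ∈ K, ∀ v : TangentSpace (𝓡 n) x, (∀ i, diffAt (g i) x v = 0) → v = 0

theorem contMDiffAt_det {κ : Type*} [Fintype κ] [DecidableEq κ] {A : M → Matrix κ κ ℝ} {p : M}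
    (hA : ∀ i j, ContMDiffAt (𝓡 n) 𝓘(ℝ, ℝ) ∞ (fun x => A x i j) p) :
    ContMDiffAt (𝓡 n) 𝓘(ℝ, ℝ) ∞ (fun x => (A x).det) p := by
  simp only [Matrix.det_apply']
  exact contMDiffAt_finsetSum fun σ _ => contMDiffAt_const.mul (contMDiffAt_finsetProd fun i _ => hA _ _)

/-- The metric induced by the differentials of finitely many functions. -/
def gram {ι : Type*} [Fintype ι] (g : ι → SmoothFun n M) (x : M) :
    TangentSpace (𝓡 n) x →ₗ[ℝ] Module.Dual ℝ (TangentSpace (𝓡 n) x) :=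
  ∑ i, (diffAt (g i) x).smulRight (diffAt (g i) x)

theorem gram_apply {ι : Type*} [Fintype ι] (g : ι → SmoothFun n M) (x : M)
    (u v : TangentSpace (𝓡 n) x) : gram g x u v = ∑ i, diffAt (g i) x u * diffAt (g i) x v := by
  simp [gram]

theorem SpansOn.gram_injective {ι : Type*} [Fintype ι] {g : ι → SmoothFun n M}
    (hg : SpansOn g Set.univ) (x : M) : Function.Injective (gram g x) := by
  refine (injective_iff_map_eq_zero _).2 fun v hv => hg x trivial v fun i => ?_
  have h : gram g x v v = 0 := by rw [hv]; rfl
  rw [gram_apply, Finset.sum_eq_zero_iff_of_nonneg fun i _ => mul_self_nonneg _] at h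
  exact mul_self_eq_zero.1 (h i (Finset.mem_univ i))

variable [IsManifold (𝓡 n) ∞ M]

theorem exists_spansOn_nhds [T2Space M] (p : M) :
    ∃ (g : Fin n → SmoothFun n M) (U : Set M), U ∈ nhds p ∧ SpansOn g U := by
  obtain ⟨ψ⟩ : Nonempty (SmoothBumpFunction (𝓡 n) p) := inferInstance
  set e := extChartAt (𝓡 n) p with he
  have hes : ContMDiffOn (𝓡 n) 𝓘(ℝ, EuclideanSpace ℝ (Fin n)) ∞ e
      (chartAt (EuclideanSpace ℝ (Fin n)) p).source := contMDiffOn_extChartAt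
  have hc (j : Fin n) : ContDiff ℝ ∞ fun y : EuclideanSpace ℝ (Fin n) => y j := by fun_prop
  let a (j : Fin n) : SmoothFun n M := ⟨fun x => ψ x • (e x) j, ψ.contMDiff_smul
    ((hc j).contMDiff.comp_contMDiffOn hes)⟩
  refine ⟨a, _, Filter.inter_mem
    -- The bump must equal `1` on a neighbourhood of each point of the set, since a differential
    -- depends on the germ.
    (eventually_eventually_nhds.2 ψ.eventuallyEq_one) (chart_source_mem_nhds (EuclideanSpace ℝ (Fin n)) p), ?_⟩
  rintro x ⟨hx1, hxs⟩ v hv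
  obtain ⟨A, hA⟩ := isInvertible_mfderiv_extChartAt (I := 𝓡 n)
    (x := p) (y := x) (by rwa [extChartAt_source])
  let w : EuclideanSpace ℝ (Fin n) := A v
  have key (j : Fin n) : w j = 0 := by
    rw [← hv j, diffAt_eq_fderiv_comp (F := fun y => y j) hxs
      ((hc j).differentiable (by simp) _)]
    · rw [← hA]
      have : fderiv ℝ (fun y : EuclideanSpace ℝ (Fin n) => y j) (e x) =
          (EuclideanSpace.proj j : EuclideanSpace ℝ (Fin n) →L[ℝ] ℝ) :=
        (EuclideanSpace.proj j : EuclideanSpace ℝ (Fin n) →L[ℝ] ℝ).fderiv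
      rw [← he, this]
      rfl
    · filter_upwards [hx1] with y hy
      change ψ y • (e y) j = (e y) j
      rw [hy]; simp
  have : A v = 0 := by
    exact PiLp.ext (x := w) (y := 0) key
  exact A.map_eq_zero_iff.1 this

theorem exists_spansOn_of_isCompact [T2Space M] {K : Set M} (hK : IsCompact K) :
    ∃ (N : ℕ) (g : Fin N → SmoothFun n M), SpansOn g K := by
  refine hK.induction_on (p := fun K => ∃ (N : ℕ) (g : Fin N → SmoothFun n M), SpansOn g K)
    ⟨0, Fin.elim0, fun x hx => hx.elim⟩ ?_ ?_ ?_
  · rintro s t hst ⟨N, g, hg⟩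
    exact ⟨N, g, fun x hx => hg x (hst hx)⟩
  · rintro s t ⟨N, g, hg⟩ ⟨N', g', hg'⟩
    refine ⟨N + N', Fin.append g g', fun x hx v hv => ?_⟩
    rcases hx with hx | hx
    · exact hg x hx v fun i => by simpa using hv (Fin.castAdd N' i)
    · exact hg' x hx v fun i => by simpa using hv (Fin.natAdd N i)
  · intro x _
    obtain ⟨g, U, hU, hg⟩ := exists_spansOn_nhds (n := n) x
    exact ⟨U, nhdsWithin_le_nhds hU, n, g, hg⟩

/-- The values of the differentials of finitely many functions form a set of dimension at most
`2 n`. -/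
theorem dimH_range_diffAt_le [SecondCountableTopology M] {p : ℕ} (g : Fin p → SmoothFun n M) :
    dimH (Set.range fun z : (Σ x : M, TangentSpace (𝓡 n) x) => fun i => diffAt (g i) z.1 z.2) ≤
      ((2 * n : ℕ) : ENNReal) := by
  let E := EuclideanSpace ℝ (Fin n)
  obtain ⟨s, hs, hcov⟩ := TopologicalSpace.countable_cover_nhds
    (fun x : M => chart_source_mem_nhds E x)
  let G (c : M) (z : E × E) : Fin p → ℝ := fun i =>
    fderiv ℝ (g i ∘ (extChartAt (𝓡 n) c).symm) z.1 z.2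
  have hsub : (Set.range fun z : (Σ x : M, TangentSpace (𝓡 n) x) => fun i => diffAt (g i) z.1 z.2) ⊆
      ⋃ c ∈ s, G c '' ((extChartAt (𝓡 n) c).target ×ˢ Set.univ) := by
    rintro _ ⟨⟨x, v⟩, rfl⟩
    have hx : x ∈ ⋃ c ∈ s, (chartAt E c).source := hcov ▸ Set.mem_univ x
    simp only [Set.mem_iUnion] at hx ⊢
    obtain ⟨c, hc, hxc⟩ := hx
    have hxc' : x ∈ (extChartAt (𝓡 n) c).source := by rwa [extChartAt_source]
    refine ⟨c, hc, ⟨(extChartAt (𝓡 n) c x, mfderiv (𝓡 n) 𝓘(ℝ, E) (extChartAt (𝓡 n) c) x v),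
      ⟨(extChartAt (𝓡 n) c).map_source hxc', trivial⟩, ?_⟩⟩
    funext i
    have hsm : ContDiffOn ℝ ∞ (g i ∘ (extChartAt (𝓡 n) c).symm) (extChartAt (𝓡 n) c).target :=
      contMDiffOn_iff_contDiffOn.1
        ((g i).contMDiff.comp_contMDiffOn (contMDiffOn_extChartAt_symm c))
    refine (diffAt_eq_fderiv_comp hxc ?_ ?_ v).symm
    · exact (hsm.contDiffAt ((isOpen_extChartAt_target c).mem_nhds
        ((extChartAt (𝓡 n) c).map_source hxc'))).differentiableAt (by simp)
    · filter_upwards [(chartAt E c).open_source.mem_nhds hxc] with y hy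
      simp only [Function.comp_apply]
      rw [(extChartAt (𝓡 n) c).left_inv (by rwa [extChartAt_source])]
  refine (dimH_mono hsub).trans ?_
  rw [dimH_bUnion hs]
  refine iSup₂_le fun c _ => ?_
  have ho := isOpen_extChartAt_target (I := 𝓡 n) c
  -- In a chart the map is `C¹` on an open part of `E × E`, hence locally Lipschitz, and cannot
  -- raise the Hausdorff dimension above `2n`.
  refine (dimH_image_le_of_locally_lipschitzOn fun z hz => ?_).trans ?_
  · have hG : ContDiffAt ℝ 1 (G c) z := by
      refine contDiffAt_pi.2 fun i => ?_
      have hsm : ContDiffOn ℝ ∞ (g i ∘ (extChartAt (𝓡 n) c).symm) (extChartAt (𝓡 n) c).target :=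
        contMDiffOn_iff_contDiffOn.1
          ((g i).contMDiff.comp_contMDiffOn (contMDiffOn_extChartAt_symm c))
      have h1 : ContDiffAt ℝ 1 (fderiv ℝ (g i ∘ (extChartAt (𝓡 n) c).symm)) z.1 :=
        (hsm.contDiffAt (ho.mem_nhds hz.1)).fderiv_right (m := 1) (by norm_cast)
      exact (h1.comp z contDiffAt_fst).clm_apply contDiffAt_snd
    obtain ⟨C, t, ht, hC⟩ := hG.exists_lipschitzOnWith
    exact ⟨C, t, mem_nhdsWithin_of_mem_nhds ht, hC⟩
  · refine (dimH_mono (Set.subset_univ _)).trans ?_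
    rw [Real.dimH_univ_eq_finrank]
    simp [two_mul, E]

/-- Whitney's projection argument. The vectors `(dg_i(v))_{i < p}` form a set of dimension at most
`2n < p`, so some `a` avoids it, and `g_p` can be eliminated by passing to `g_i - a_i g_p`. A vector
`v` killed by all the new differentials satisfies `dg_i(v) = a_i dg_p(v)`; if `dg_p(v) ≠ 0`,
rescaling `v` would exhibit `a` in the set. -/
theorem SpansOn.exists_pred [SecondCountableTopology M] {K : Set M} {p : ℕ} (hp : 2 * n < p)
    {g : Fin (p + 1) → SmoothFun n M} (hg : SpansOn g K) :
    ∃ g' : Fin p → SmoothFun n M, SpansOn g' K := by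
  have hd := dimH_range_diffAt_le (fun i : Fin p => g i.castSucc)
  have hlt : dimH (Set.range fun z : (Σ x : M, TangentSpace (𝓡 n) x) =>
      fun i : Fin p => diffAt (g i.castSucc) z.1 z.2) < Module.finrank ℝ (Fin p → ℝ) := by
    refine hd.trans_lt ?_
    rw [Module.finrank_fin_fun]
    exact_mod_cast hp
  obtain ⟨a, ha⟩ := (dense_compl_of_dimH_lt_finrank hlt).nonempty
  refine ⟨fun i => g i.castSucc + (-a i) • g (Fin.last p), fun x hx v hv => ?_⟩
  have hv' (i : Fin p) : diffAt (g i.castSucc) x v = a i * diffAt (g (Fin.last p)) x v := by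
    have := hv i
    rw [diffAt_add, diffAt_smul] at this
    simp only [LinearMap.add_apply, LinearMap.smul_apply, smul_eq_mul] at this
    linarith
  have h0 : diffAt (g (Fin.last p)) x v = 0 := by
    by_contra h
    refine ha ⟨⟨x, (diffAt (g (Fin.last p)) x v)⁻¹ • v⟩, ?_⟩
    funext i
    simp only [map_smul, smul_eq_mul, hv' i]
    field_simp
  refine hg x hx v fun i => ?_
  induction i using Fin.lastCases with
  | last => exact h0
  | cast i => rw [hv' i, h0, mul_zero]

/-- What matters is that the number of functions does not depend on `K`: this permits gluing over
infinitely many compact sets. -/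
theorem SpansOn.exists_fin [SecondCountableTopology M] {K : Set M} {N : ℕ}
    {g : Fin N → SmoothFun n M} (hg : SpansOn g K) :
    ∃ g' : Fin (2 * n + 1) → SmoothFun n M, SpansOn g' K := by
  induction N with
  | zero => exact ⟨fun _ => 0, fun x hx v _ => hg x hx v fun i => i.elim0⟩
  | succ N ih =>
    rcases lt_or_ge (2 * n) N with h | h
    · obtain ⟨g', hg'⟩ := hg.exists_pred h
      exact ih hg'
    · refine ⟨fun i => if h : (i : ℕ) < N + 1 then g ⟨i, h⟩ else 0, fun x hx v hv => ?_⟩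
      refine hg x hx v fun i => ?_
      have := hv ⟨i, by omega⟩
      dsimp only at this
      rwa [dif_pos i.is_lt] at this

/-- The compact annuli of an exhaustion have neighbourhoods `U m` that meet only if their indices
differ by at most `2`. Hence the cut-off functions of all annuli in one residue class modulo `3` can
be added without interference, and three batches of `2n + 1` functions suffice. -/
theorem exists_spansOn_univ [T2Space M] [SecondCountableTopology M] :
    ∃ g : Fin 3 × Fin (2 * n + 1) → SmoothFun n M, SpansOn g Set.univ := by
  have : LocallyCompactSpace M := Manifold.locallyCompact_of_finiteDimensional (𝓡 n)
  -- The shift makes `K 0` empty, so that the truncated `m - 1` in `U 0` removes nothing.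
  let K : CompactExhaustion M := (default : CompactExhaustion M).shiftr
  have hK0 : K 0 = ∅ := rfl
  have hmono {i j : ℕ} (h : i ≤ j) : K i ⊆ K j := K.subset h
  let A (m : ℕ) : Set M := K (m + 1) \ interior (K m)
  let U (m : ℕ) : Set M := interior (K (m + 2)) \ K (m - 1)
  have hA (m : ℕ) : IsCompact (A m) := (K.isCompact _).diff isOpen_interior
  have hU (m : ℕ) : IsOpen (U m) := isOpen_interior.sdiff (K.isCompact _).isClosed
  have hAU (m : ℕ) : A m ⊆ U m := by
    rintro x ⟨hx, hx'⟩
    refine ⟨K.subset_interior_succ _ hx, fun h => ?_⟩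
    rcases m with _ | m
    · simp [hK0] at h
    · exact hx' (K.subset_interior_succ _ h)
  have hdisj {m m' : ℕ} (h : m + 3 ≤ m') : Disjoint (U m) (U m') := by
    refine Set.disjoint_left.2 fun x hx hx' => hx'.2 (hmono ?_ (interior_subset hx.1))
    omega
  choose χ hχ1 hχ0 _ using fun m => exists_contMDiffMap_one_nhds_of_subset_interior (𝓡 n) (n := ⊤)
    (hA m).isClosed ((hAU m).trans (hU m).interior_eq.ge)
  choose N g₀ hg₀ using fun m => exists_spansOn_of_isCompact (n := n) (hA m)
  choose g hg using fun m => (hg₀ m).exists_fin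
  let F (c : Fin 3 × Fin (2 * n + 1)) (m : ℕ) (x : M) : ℝ :=
    if m % 3 = c.1 then χ m x * g m c.2 x else 0
  have hF0 {c : Fin 3 × Fin (2 * n + 1)} {m : ℕ} {x : M} (hx : x ∉ U m) : F c m x = 0 := by
    simp only [F, hχ0 m x hx, zero_mul, ite_self]
  have hF (c : Fin 3 × Fin (2 * n + 1)) (m : ℕ) : ContMDiff (𝓡 n) 𝓘(ℝ, ℝ) ∞ (F c m) := by
    by_cases h : m % 3 = c.1
    · simp only [F, h, if_true]
      exact (χ m).contMDiff.mul (g m c.2).contMDiff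
    · simp only [F, h, if_false]
      exact contMDiff_const
  have hfin (c : Fin 3 × Fin (2 * n + 1)) : LocallyFinite fun m => Function.support (F c m) := by
    intro x
    obtain ⟨j, hj⟩ := K.exists_mem_nhds x
    refine ⟨K j, hj, (Set.finite_le_nat j).subset ?_⟩
    rintro m ⟨y, hy, hyK⟩
    by_contra hm
    refine hy (hF0 fun h => h.2 (hmono ?_ hyK))
    simp only [Set.mem_ofPred_eq] at hm
    omega
  refine ⟨fun c => ⟨fun x => ∑ᶠ m, F c m x, contMDiff_finsum (hF c) (hfin c)⟩,
    fun x _ v hv => ?_⟩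
  obtain ⟨m, hm⟩ : ∃ m, x ∈ A m := by
    classical
    have hex : ∃ m, x ∈ K (m + 1) := by
      obtain ⟨m, hm⟩ := K.exists_mem x
      exact ⟨m, hmono (Nat.le_succ m) hm⟩
    refine ⟨Nat.find hex, Nat.find_spec hex, fun h => ?_⟩
    rcases hq : Nat.find hex with _ | q
    · rw [hq] at h
      simp [hK0] at h
    · rw [hq] at h
      exact Nat.find_min hex (hq ▸ Nat.lt_succ_self q) (interior_subset h)
  refine hg m x hm v fun i => ?_
  rw [← hv (⟨m % 3, Nat.mod_lt _ (by norm_num)⟩, i)]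
  refine congrArg (fun L => L v) (diffAt_congr ?_)
  filter_upwards [(hU m).mem_nhds (hAU m hm), (hχ1 m).filter_mono (nhds_le_nhdsSet hm)] with y hy hy1
  refine Eq.symm ((finsum_eq_single _ m fun m' hm' => ?_).trans ?_)
  · by_cases h : m' % 3 = m % 3
    · refine hF0 fun hy' => ?_
      rcases lt_or_gt_of_ne hm' with h1 | h1
      · exact Set.disjoint_left.1 (hdisj (by omega)) hy' hy
      · exact Set.disjoint_left.1 (hdisj (by omega)) hy hy'
    · simp [F, h]
  · simp [F, hy1]

/-- Finitely many functions and vector fields that are dual to each other: they exhibit the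
module of vector fields as a finitely generated projective module. -/
structure CoordFrame (n : ℕ) (M : Type*) [TopologicalSpace M]
    [ChartedSpace (EuclideanSpace ℝ (Fin n)) M] [IsManifold (𝓡 n) ∞ M] where
  /-- the index type -/
  ι : Type
  [fintype : Fintype ι]
  /-- the functions -/
  fn : ι → SmoothFun n M
  /-- the vector fields -/
  vf : ι → VField n M
  sum_diffAt_smul : ∀ (x : M) (v : TangentSpace (𝓡 n) x), ∑ i, diffAt (fn i) x v • vf i x = v

attribute [instance] CoordFrame.fintype

theorem contMDiffAt_diffAt_apply (f : SmoothFun n M) {X : ∀ x : M, TangentSpace (𝓡 n) x} {p : M}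
    (hX : ContMDiffAt (𝓡 n) (𝓡 n).tangent ∞
      (fun x => (⟨x, X x⟩ : TangentBundle (𝓡 n) M)) p) :
    ContMDiffAt (𝓡 n) 𝓘(ℝ, ℝ) ∞ (fun x => diffAt f x (X x)) p := by
  have h1 := f.contMDiff.contMDiff_tangentMap (m := ∞) (by simp)
  have h2 := h1.contMDiffAt.comp p hX
  exact ((contMDiff_snd_tangentBundle_modelSpace ℝ 𝓘(ℝ, ℝ)).contMDiffAt).comp p h2

/-- `Y` is the gradient of `f` for the Riemannian metric `∑ dg_i ⊗ dg_i`. It exists pointwise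
because the metric is nondegenerate, and it is smooth because Cramer's rule expresses its
coefficients in a local frame. -/
theorem SpansOn.exists_dual_vField {ι : Type*} [Fintype ι] {g : ι → SmoothFun n M}
    (hg : SpansOn g Set.univ) (f : SmoothFun n M) :
    ∃ Y : VField n M, ∀ x, gram g x (Y x) = diffAt f x := by
  let E := EuclideanSpace ℝ (Fin n)
  have hsurj (x : M) : Function.Surjective (gram g x) :=
    (LinearMap.injective_iff_surjective_of_finrank_eq_finrank
      (Subspace.dual_finrank_eq (K := ℝ) (V := TangentSpace (𝓡 n) x)).symm).1 (hg.gram_injective x)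
  choose Y hY using fun x => hsurj x (diffAt f x)
  refine ⟨⟨Y, fun p => ?_⟩, hY⟩
  let T := trivializationAt E (TangentSpace (𝓡 n) : M → Type _) p
  let b := (EuclideanSpace.basisFun (Fin n) ℝ).toBasis
  let X := T.localFrame b
  have hp : p ∈ T.baseSet := FiberBundle.mem_baseSet_trivializationAt' p
  have hframe : IsLocalFrameOn (𝓡 n) E ∞ X T.baseSet := T.isLocalFrameOn_localFrame_baseSet (𝓡 n) ∞ b
  have hX (j : Fin n) := hframe.contMDiffAt T.open_baseSet hp j
  let Γ (x : M) : Matrix (Fin n) (Fin n) ℝ := fun j l => gram g x (X j x) (X l x)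
  let β (x : M) : Fin n → ℝ := fun l => diffAt f x (X l x)
  have hΓ (j l : Fin n) : ContMDiffAt (𝓡 n) 𝓘(ℝ, ℝ) ∞ (fun x => Γ x j l) p := by
    simp only [Γ, gram_apply]
    exact contMDiffAt_finsetSum fun i _ => (contMDiffAt_diffAt_apply (g i) (hX j)).mul
      (contMDiffAt_diffAt_apply (g i) (hX l))
  have hβ (l : Fin n) : ContMDiffAt (𝓡 n) 𝓘(ℝ, ℝ) ∞ (fun x => β x l) p :=
    contMDiffAt_diffAt_apply f (hX l)
  have hsum (c : Fin n → ℝ) (x : M) (l : Fin n) :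
      gram g x (∑ j, c j • X j x) (X l x) = (Γ x).transpose.mulVec c l := by
    simp [Matrix.mulVec, dotProduct, Γ, mul_comm]
    rfl
  have hspan {x : M} (hx : x ∈ T.baseSet) {L L' : Module.Dual ℝ (TangentSpace (𝓡 n) x)}
      (h : ∀ l, L (X l x) = L' (X l x)) : L = L' :=
    (hframe.toBasisAt hx).ext fun l => by simpa using h l
  have hdet {x : M} (hx : x ∈ T.baseSet) : (Γ x).transpose.det ≠ 0 := by
    intro h0
    obtain ⟨c, hc, hc0⟩ := Matrix.exists_mulVec_eq_zero_iff.2 h0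
    have h1 : gram g x (∑ j, c j • X j x) = 0 := hspan hx fun l => by
      rw [hsum, hc0]; rfl
    have h2 := (injective_iff_map_eq_zero _).1 (hg.gram_injective x) _ h1
    exact hc (funext fun j => Fintype.linearIndependent_iff.1 (hframe.linearIndependent hx) c h2 j)
  let c (x : M) (j : Fin n) : ℝ := ((Γ x).transpose.det)⁻¹ * (Γ x).transpose.cramer (β x) j
  have hc (j : Fin n) : ContMDiffAt (𝓡 n) 𝓘(ℝ, ℝ) ∞ (fun x => c x j) p := by
    refine ((contMDiffAt_det fun i l => hΓ l i).inv₀ (hdet hp)).mul ?_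
    simp only [Matrix.cramer_apply]
    refine contMDiffAt_det fun i l => ?_
    by_cases h : l = j
    · subst h; simpa using hβ i
    · simpa [Matrix.updateCol_apply, h] using hΓ l i
  have hYc : ∀ x ∈ T.baseSet, Y x = ∑ j, c x j • X j x := by
    intro x hx
    refine hg.gram_injective x (hspan hx fun l => ?_)
    rw [hsum, hY]
    have h1 : c x = ((Γ x).transpose.det)⁻¹ • (Γ x).transpose.cramer (β x) := rfl
    rw [h1, Matrix.mulVec_smul, Matrix.mulVec_cramer, smul_smul, inv_mul_cancel₀ (hdet hx), one_smul]
  have hsm : ContMDiffAt (𝓡 n) (𝓡 n).tangent ∞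
      (fun x => (⟨x, ∑ j, c x j • X j x⟩ : TangentBundle (𝓡 n) M)) p :=
    ContMDiffAt.sum_section fun j _ => (hc j).smul_section (hX j)
  refine hsm.congr_of_eventuallyEq ?_
  filter_upwards [T.open_baseSet.mem_nhds hp] with x hx
  rw [hYc x hx]

/-- With `Y_i` the gradient of `g_i`, the metric pairs `∑ dg_i(v) Y_i` with `w` to `∑ dg_i(v)
dg_i(w)`, which is the metric of `v` and `w`; nondegeneracy concludes. -/
theorem nonempty_coordFrame (n : ℕ) (M : Type*) [TopologicalSpace M]
    [ChartedSpace (EuclideanSpace ℝ (Fin n)) M] [IsManifold (𝓡 n) ∞ M] [T2Space M]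
    [SecondCountableTopology M] : Nonempty (CoordFrame n M) := by
  obtain ⟨g, hg⟩ := exists_spansOn_univ (n := n) (M := M)
  choose Y hY using fun i => hg.exists_dual_vField (g i)
  refine ⟨⟨_, g, Y, fun x v => hg.gram_injective x ?_⟩⟩
  ext w
  simp only [map_sum, map_smul, hY, gram_apply, LinearMap.sum_apply, LinearMap.smul_apply,
    smul_eq_mul]

end Spanning

/-! ### The Lie bracket of vector fields as a commutator of derivations -/

section LieBracket

theorem clm_inverse_apply_eq {E F : Type*} [AddCommGroup E] [TopologicalSpace E] [Module ℝ E]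
    [AddCommGroup F] [TopologicalSpace F] [Module ℝ F] {B : E →L[ℝ] F} {C : F →L[ℝ] E}
    (hB : B.IsInvertible) (h : B ∘L C = ContinuousLinearMap.id ℝ F) (w : F) :
    B.inverse w = C w := by
  obtain ⟨A, rfl⟩ := hB
  rw [ContinuousLinearMap.inverse_equiv]
  exact (A.symm_apply_eq).2 (congrArg (fun L => L w) h).symm

theorem clm_apply_inverse {E F : Type*} [AddCommGroup E] [TopologicalSpace E] [Module ℝ E]
    [AddCommGroup F] [TopologicalSpace F] [Module ℝ F] {B : E →L[ℝ] F}
    (hB : B.IsInvertible) (w : F) : B (B.inverse w) = w := by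
  obtain ⟨A, rfl⟩ := hB
  rw [ContinuousLinearMap.inverse_equiv]
  exact A.apply_symm_apply w

/-- The two second-order terms cancel by the symmetry of the second derivative. -/
theorem fderiv_apply_lieBracket {E : Type*} [NormedAddCommGroup E] [NormedSpace ℝ E]
    {F : E → ℝ} {V W : E → E} {y : E} (hF : ContDiffAt ℝ ∞ F y) (hV : DifferentiableAt ℝ V y)
    (hW : DifferentiableAt ℝ W y) :
    fderiv ℝ F y (VectorField.lieBracket ℝ V W y) =
      fderiv ℝ (fun z => fderiv ℝ F z (W z)) y (V y) -
        fderiv ℝ (fun z => fderiv ℝ F z (V z)) y (W y) := by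
  have hF' : DifferentiableAt ℝ (fderiv ℝ F) y :=
    (hF.fderiv_right (m := 1) (by norm_cast)).differentiableAt (by simp)
  have hsymm := hF.isSymmSndFDerivAt (by simp only [minSmoothness_of_isRCLikeNormedField]; norm_cast)
  rw [fderiv_clm_apply hF' hW, fderiv_clm_apply hF' hV]
  simp only [VectorField.lieBracket, map_sub, add_apply, ContinuousLinearMap.comp_apply,
    ContinuousLinearMap.flip_apply]
  rw [hsymm.eq (V y) (W y)]
  ring

variable {n : ℕ} {M : Type*} [TopologicalSpace M] [ChartedSpace (EuclideanSpace ℝ (Fin n)) M]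

theorem eventuallyEq_comp_symm_comp_extChartAt (f : SmoothFun n M) {p x : M}
    (hx : x ∈ (chartAt (EuclideanSpace ℝ (Fin n)) p).source) :
    (f : M → ℝ) =ᶠ[nhds x] (f ∘ (extChartAt (𝓡 n) p).symm) ∘ extChartAt (𝓡 n) p := by
  filter_upwards [(chartAt (EuclideanSpace ℝ (Fin n)) p).open_source.mem_nhds hx] with y hy
  simp only [Function.comp_apply]
  rw [(extChartAt (𝓡 n) p).left_inv (by rwa [extChartAt_source])]

variable [IsManifold (𝓡 n) ∞ M]

theorem contDiffAt_comp_extChartAt_symm (f : SmoothFun n M) {p : M} {y : EuclideanSpace ℝ (Fin n)}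
    (hy : y ∈ (extChartAt (𝓡 n) p).target) :
    ContDiffAt ℝ ∞ (f ∘ (extChartAt (𝓡 n) p).symm) y :=
  (contMDiffOn_iff_contDiffOn.1 (f.contMDiff.comp_contMDiffOn
    (contMDiffOn_extChartAt_symm p))).contDiffAt ((isOpen_extChartAt_target p).mem_nhds hy)

/-- The Lie bracket of vector fields is the commutator of derivations. -/
theorem diffAt_mlieBracket (f : SmoothFun n M) (X Y : VField n M) (x : M) :
    diffAt f x (VectorField.mlieBracket (𝓡 n) X Y x) =
      diffAt (Y.apply f) x (X x) - diffAt (X.apply f) x (Y x) := by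
  let E := EuclideanSpace ℝ (Fin n)
  set e := extChartAt (𝓡 n) x with he
  let F : E → ℝ := f ∘ e.symm
  let D : ∀ y : M, TangentSpace (𝓡 n) y → E := fun y => mfderiv (𝓡 n) 𝓘(ℝ, E) e y
  have hxs := mem_chart_source E x
  have hxt : e x ∈ e.target := mem_extChartAt_target x
  have hdf (g : SmoothFun n M) {y : M} (hy : y ∈ (chartAt E x).source)
      (v : TangentSpace (𝓡 n) y) : diffAt g y v = fderiv ℝ (g ∘ e.symm) (e y) (D y v) :=
    diffAt_eq_fderiv_comp hy ((contDiffAt_comp_extChartAt_symm g ((extChartAt (𝓡 n) x).map_source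
      (by rwa [extChartAt_source]))).differentiableAt (by simp))
      (eventuallyEq_comp_symm_comp_extChartAt g hy) v
  -- `L Z` is the coordinate expression of `Z` in the chart at `x`; on the chart target it is the
  -- image of `Z` under the derivative of the chart.
  let L (Z : VField n M) : E → E :=
    VectorField.mpullbackWithin 𝓘(ℝ, E) (𝓡 n) e.symm Z (Set.range (𝓡 n))
  have hL (Z : VField n M) {y : E} (hy : y ∈ e.target) : L Z y = D (e.symm y) (Z (e.symm y)) := by
    exact clm_inverse_apply_eq (isInvertible_mfderivWithin_extChartAt_symm (I := 𝓡 n) hy)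
      (mfderivWithin_extChartAt_symm_comp_mfderiv_extChartAt (I := 𝓡 n) hy) (Z (e.symm y))
  have hLd (Z : VField n M) : DifferentiableAt ℝ (L Z) (e x) := by
    have : IsManifold (𝓡 n) 2 M := IsManifold.of_le (n := ∞) (by norm_cast)
    have h := MDifferentiableWithinAt.differentiableWithinAt_mpullbackWithin_vectorField
      (I := 𝓡 n) (V := Z) (s := Set.univ) (x := x)
      ((Z.contMDiff x).mdifferentiableAt (by simp)).mdifferentiableWithinAt
    have hr : (extChartAt (𝓡 n) x).symm ⁻¹' Set.univ ∩ Set.range (𝓡 n) = Set.univ := by simp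
    rw [hr] at h
    exact differentiableWithinAt_univ.1 h
  have happ (Z : VField n M) : (fun z => fderiv ℝ F z (L Z z)) =ᶠ[nhds (e x)]
      (Z.apply f) ∘ e.symm := by
    filter_upwards [(isOpen_extChartAt_target x).mem_nhds hxt] with z hz
    have hzs : e.symm z ∈ (chartAt E x).source := by
      have := e.map_target hz
      rwa [he, extChartAt_source] at this
    have := hdf f hzs (Z (e.symm z))
    rw [e.right_inv hz, ← hL Z hz] at this
    exact this.symm
  have hLx (Z : VField n M) : L Z (e x) = D x (Z x) := by
    have h := hL Z hxt
    rwa [show e.symm (e x) = x from extChartAt_to_inv x] at h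
  have hbr : D x (VectorField.mlieBracket (𝓡 n) X Y x) =
      VectorField.lieBracket ℝ (L X) (L Y) (e x) := by
    have hr : (extChartAt (𝓡 n) x).symm ⁻¹' Set.univ ∩ Set.range (𝓡 n) = Set.univ := by simp
    have h1 := VectorField.mlieBracketWithin_apply (I := 𝓡 n) (V := X) (W := Y) (s := Set.univ)
      (x₀ := x)
    rw [hr, VectorField.mlieBracketWithin_univ] at h1
    have h2 := VectorField.lieBracketWithin_univ (𝕜 := ℝ) (V := L X) (W := L Y)
    rw [← h2, h1]
    exact clm_apply_inverse (isInvertible_mfderiv_extChartAt (mem_extChartAt_source x)) _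
  rw [hdf f hxs, hdf (Y.apply f) hxs, hdf (X.apply f) hxs, hbr, ← (happ X).fderiv_eq,
    ← (happ Y).fderiv_eq, ← hLx X, ← hLx Y]
  exact fderiv_apply_lieBracket (contDiffAt_comp_extChartAt_symm f hxt) (hLd X) (hLd Y)

end LieBracket

/-! ### Contractions of alternating maps and determinant sums over a frame -/

section LinearAlgebra

/-- The equivalence that moves the first element of the right summand to the front of the left
summand. -/
def shiftEquiv (m k : ℕ) : Fin m ⊕ Fin (k + 1) ≃ Fin (m + 1) ⊕ Fin k where
  toFun := Sum.elim (fun i => Sum.inl i.succ) (Fin.cases (Sum.inl 0) Sum.inr)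
  invFun := Sum.elim (Fin.cases (Sum.inr 0) Sum.inl) (fun j => Sum.inr j.succ)
  left_inv := by
    rintro (i | j)
    · simp
    · induction j using Fin.cases <;> simp
  right_inv := by
    rintro (i | j)
    · induction i using Fin.cases <;> simp
    · simp

theorem sumElim_comp_shiftEquiv {V : Type*} {m k : ℕ} (x : V) (g : Fin m → V) (f : Fin k → V) :
    Sum.elim (Fin.cons x g) f ∘ shiftEquiv m k = Sum.elim g (Fin.cons x f) := by
  funext s
  rcases s with i | j
  · simp [shiftEquiv]
  · induction j using Fin.cases <;> simp [shiftEquiv]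

/-- The splitting of `n = m + k` indices that underlies `contract`. -/
def splitEquiv (n : ℕ) : (m k : ℕ) → m + k = n → Fin n ≃ Fin m ⊕ Fin k
  | 0, k, h => (finCongr (by omega : n = k)).trans (Equiv.emptySum (Fin 0) (Fin k)).symm
  | m + 1, k, h => (splitEquiv n m (k + 1) (by omega)).trans (shiftEquiv m k)

/-- The sign of the permutation that exchanges the two blocks of a splitting. -/
def splitSign (n m k : ℕ) (h : m + k = n) : ℤ :=
  Equiv.Perm.sign ((splitEquiv n k m (by omega)).trans ((Equiv.sumComm _ _).trans
    (splitEquiv n m k h).symm))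

theorem splitSign_mul_self (n m k : ℕ) (h : m + k = n) :
    splitSign n m k h * splitSign n m k h = 1 := by
  unfold splitSign
  rw [← Units.val_mul, Int.units_mul_self, Units.val_one]

variable {V W : Type*} [AddCommGroup V] [Module ℝ V] [AddCommGroup W] [Module ℝ W]

/-- Insertion of `m` vectors into an alternating map: the last vector ends up first. -/
def contract {n : ℕ} (A : V [⋀^Fin n]→ₗ[ℝ] W) :
    (m k : ℕ) → m + k = n → (Fin m → V) → V [⋀^Fin k]→ₗ[ℝ] W
  | 0, k, h, _ => A.domDomCongr (finCongr (by omega : n = k))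
  | m + 1, k, h, g => (contract A m (k + 1) (by omega) (Fin.tail g)).curryLeft (g 0)

theorem contract_cons {n : ℕ} (A : V [⋀^Fin n]→ₗ[ℝ] W) {m k : ℕ} (h : m + 1 + k = n) (x : V)
    (g : Fin m → V) (f : Fin k → V) :
    contract A (m + 1) k h (Fin.cons x g) f =
      contract A m (k + 1) (by omega) g (Fin.cons x f) := rfl

theorem contract_apply {n : ℕ} (A : V [⋀^Fin n]→ₗ[ℝ] W) {m k : ℕ} (h : m + k = n) (g : Fin m → V)
    (f : Fin k → V) : contract A m k h g f = A (Sum.elim g f ∘ splitEquiv n m k h) := by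
  induction m generalizing k with
  | zero =>
    refine congrArg A (funext fun i => ?_)
    rfl
  | succ m ih =>
    rw [← Fin.cons_self_tail g, contract_cons, ih]
    congr 1
    rw [← sumElim_comp_shiftEquiv]
    rfl

/-- Its use is to make a contraction, for fixed `f`, an alternating map of the inserted vectors `g`,
which the recursive definition hides. The value of the sign is irrelevant later, only that its
square is `1`. -/
theorem contract_swap {n : ℕ} (A : V [⋀^Fin n]→ₗ[ℝ] W) {m k : ℕ} (h : m + k = n) (g : Fin m → V)
    (f : Fin k → V) :
    contract A m k h g f = splitSign n m k h • contract A k m (by omega) f g := by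
  rw [contract_apply, contract_apply]
  set σ : Equiv.Perm (Fin n) := (splitEquiv n k m (by omega)).trans ((Equiv.sumComm _ _).trans
    (splitEquiv n m k h).symm) with hσ
  have h1 : Sum.elim f g ∘ splitEquiv n k m (by omega) =
      (Sum.elim g f ∘ splitEquiv n m k h) ∘ σ := by
    funext i
    simp only [hσ, Function.comp_apply, Equiv.trans_apply, Equiv.apply_symm_apply]
    rcases splitEquiv n k m _ i with j | j <;> rfl
  rw [h1, A.map_perm]
  have h2 : splitSign n m k h = Equiv.Perm.sign σ := rfl
  rw [h2, Units.smul_def, smul_smul, ← Units.val_mul, Int.units_mul_self, Units.val_one, one_smul]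

/-- In the Leibniz expansion, the sign of `σ` is absorbed by permuting the arguments of `X`. After
reindexing `I` by `σ`, all `m!` permutations contribute the same sum. -/
theorem sum_det_smul_map {R ι : Type*} [CommRing R] [Module R W] [Fintype ι] {m : ℕ}
    (X : V [⋀^Fin m]→ₗ[ℝ] W) (g : ι → V) (c : ι → Fin m → R) :
    ∑ I : Fin m → ι, (Matrix.of fun a b => c (I a) b).det • X (g ∘ I) =
      m.factorial • ∑ I : Fin m → ι, (∏ b, c (I b) b) • X (g ∘ I) := by
  have h1 (I : Fin m → ι) : (Matrix.of fun a b => c (I a) b).det • X (g ∘ I) =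
      ∑ σ : Equiv.Perm (Fin m), (∏ b, c ((I ∘ σ) b) b) • X (g ∘ (I ∘ σ)) := by
    rw [Matrix.det_apply', Finset.sum_smul]
    refine Finset.sum_congr rfl fun σ _ => ?_
    rw [← Function.comp_assoc, X.map_perm, mul_comm, mul_smul, Units.smul_def, Int.cast_smul_eq_zsmul]
    rfl
  simp only [h1]
  rw [Finset.sum_comm]
  have h2 (σ : Equiv.Perm (Fin m)) :
      ∑ I : Fin m → ι, (∏ b, c ((I ∘ σ) b) b) • X (g ∘ (I ∘ σ)) =
        ∑ I : Fin m → ι, (∏ b, c (I b) b) • X (g ∘ I) :=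
    Fintype.sum_equiv (Equiv.arrowCongr σ.symm (Equiv.refl ι)) _ _ fun I => by
      rfl
  simp only [h2, Finset.sum_const, Finset.card_univ, Fintype.card_perm, Fintype.card_fin]

theorem AlternatingMap.expand {ι : Type*} [Fintype ι] {m : ℕ} (X : V [⋀^Fin m]→ₗ[ℝ] W)
    {Y : ι → V} {c : ι → V → ℝ} (hY : ∀ v, ∑ i, c i v • Y i = v) (v : Fin m → V) :
    X v = ∑ I : Fin m → ι, (∏ b, c (I b) (v b)) • X (Y ∘ I) := by
  have h : v = fun b => ∑ i, c i (v b) • Y i := funext fun b => (hY (v b)).symm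
  conv_lhs => rw [h]
  refine (X.toMultilinearMap.map_sum (fun b i => c i (v b) • Y i)).trans ?_
  exact Finset.sum_congr rfl fun I _ => X.toMultilinearMap.map_smul_univ _ _

section Contraction

variable {ι : Type*} [Fintype ι]

/-- Laplace expansion along the new row: the corner entries sum to the trace of the identity, that
is `dim V`, and each of the other `q` columns reproduces the small determinant with a minus sign,
because `∑ g_i(v_j) Y_i = v_j`. -/
theorem sum_det_cons [FiniteDimensional ℝ V] {g : ι → Module.Dual ℝ V} {Y : ι → V}
    (hY : ∀ v, ∑ i, g i v • Y i = v) {q : ℕ} (α : Fin q → Module.Dual ℝ V) (v : Fin q → V) :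
    ∑ i, (Matrix.of fun a b : Fin (q + 1) =>
      (Fin.cons (g i) α : Fin (q + 1) → Module.Dual ℝ V) a
        ((Fin.cons (Y i) v : Fin (q + 1) → V) b)).det =
      ((Module.finrank ℝ V : ℝ) - q) * (Matrix.of fun a b : Fin q => α a (v b)).det := by
  -- the alternating form `w ↦ det (α a (w b))`
  let D : V [⋀^Fin q]→ₗ[ℝ] ℝ := Matrix.detRowAlternating.compLinearMap (LinearMap.pi α)
  have hD (w : Fin q → V) : D w = (Matrix.of fun a b : Fin q => α a (w b)).det := by
    rw [← Matrix.det_transpose]; rfl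
  have htr : ∑ i, g i (Y i) = Module.finrank ℝ V := by
    have h : (∑ i, (g i).smulRight (Y i)) = LinearMap.id := by
      ext w; simpa using hY w
    have h2 := congrArg (LinearMap.trace ℝ V) h
    rw [map_sum, LinearMap.trace_id] at h2
    rw [← h2]
    exact Finset.sum_congr rfl fun i _ => (LinearMap.trace_smulRight _ _).symm
  have hlap (i : ι) : (Matrix.of fun a b : Fin (q + 1) =>
      (Fin.cons (g i) α : Fin (q + 1) → Module.Dual ℝ V) a
        ((Fin.cons (Y i) v : Fin (q + 1) → V) b)).det =
      g i (Y i) * D v - ∑ j : Fin q, g i (v j) * D (Function.update v j (Y i)) := by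
    rw [Matrix.det_succ_row_zero, Fin.sum_univ_succ, sub_eq_add_neg, ← Finset.sum_neg_distrib]
    congr 1
    · rw [hD]
      simp only [Fin.val_zero, pow_zero, one_mul, Matrix.of_apply, Fin.cons_zero]
      congr 2
    · refine Finset.sum_congr rfl fun j _ => ?_
      obtain ⟨q, rfl⟩ : ∃ q', q = q' + 1 := ⟨q - 1, by have := j.pos; omega⟩
      have hu : Function.update v j (Y i) = j.insertNth (Y i) (j.removeNth v) := by
        rw [Fin.insertNth_removeNth]
      rw [hu, AlternatingMap.map_insertNth, hD]
      have hm : ((Matrix.of fun a b : Fin (q + 1 + 1) =>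
          (Fin.cons (g i) α : Fin (q + 1 + 1) → Module.Dual ℝ V) a
            ((Fin.cons (Y i) v : Fin (q + 1 + 1) → V) b)).submatrix Fin.succ j.succ.succAbove) =
          Matrix.of fun a b : Fin (q + 1) => α a (Matrix.vecCons (Y i) (j.removeNth v) b) := by
        ext a b
        induction b using Fin.cases with
        | zero => simp
        | succ b => simp [Fin.removeNth]
      rw [hm]
      simp only [Matrix.of_apply, Fin.cons_zero, Fin.cons_succ, Fin.val_succ, pow_succ]
      ring
  have h3 (j : Fin q) : ∑ i, g i (v j) * D (Function.update v j (Y i)) = D v := by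
    have : D (Function.update v j (∑ i, g i (v j) • Y i)) =
        ∑ i, g i (v j) * D (Function.update v j (Y i)) := by
      refine (D.map_update_sum Finset.univ j (fun i => g i (v j) • Y i) v).trans ?_
      exact Finset.sum_congr rfl fun i _ => D.map_update_smul v j _ _
    rw [← this, hY, Function.update_eq_self]
  rw [Finset.sum_congr rfl fun i _ => hlap i, Finset.sum_sub_distrib, ← Finset.sum_mul, htr,
    Finset.sum_comm, Finset.sum_congr rfl fun j _ => h3 j, Finset.sum_const, Finset.card_univ,
    Fintype.card_fin, ← hD, nsmul_eq_mul]
  ring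

/-- Summing out one frame index at a time gives the factors `dim V - q` for growing `q`, with
product `k!`. This is the linear algebra behind the invertibility of the star map. -/
theorem sum_det_sumElim [FiniteDimensional ℝ V] {g : ι → Module.Dual ℝ V} {Y : ι → V}
    (hY : ∀ v, ∑ i, g i v • Y i = v) {q k : ℕ} (hq : q + k = Module.finrank ℝ V)
    (α : Fin q → Module.Dual ℝ V) (v : Fin q → V) :
    ∑ I : Fin k → ι, (Matrix.of fun a b : Fin q ⊕ Fin k =>
      Sum.elim α (g ∘ I) a (Sum.elim v (Y ∘ I) b)).det =
      k.factorial * (Matrix.of fun a b : Fin q => α a (v b)).det := by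
  induction k generalizing q with
  | zero =>
    rw [Fintype.sum_unique, Nat.factorial_zero, Nat.cast_one, one_mul,
      ← Matrix.det_submatrix_equiv_self (Equiv.sumEmpty (Fin q) (Fin 0)).symm]
    rfl
  | succ k ih =>
    rw [← (Fin.consEquiv fun _ => ι).sum_comp, Fintype.sum_prod_type]
    have h1 (i : ι) (I : Fin k → ι) : (Matrix.of fun a b : Fin q ⊕ Fin (k + 1) =>
        Sum.elim α (g ∘ (Fin.consEquiv fun _ => ι) (i, I)) a
          (Sum.elim v (Y ∘ (Fin.consEquiv fun _ => ι) (i, I)) b)).det =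
        (Matrix.of fun a b : Fin (q + 1) ⊕ Fin k =>
          Sum.elim (Fin.cons (g i) α) (g ∘ I) a (Sum.elim (Fin.cons (Y i) v) (Y ∘ I) b)).det := by
      rw [← Matrix.det_submatrix_equiv_self (shiftEquiv q k)]
      congr 1
      ext a b
      have e1 : g ∘ (Fin.consEquiv fun _ => ι) (i, I) = Fin.cons (g i) (g ∘ I) :=
        Fin.comp_cons g i I
      have e2 : Y ∘ (Fin.consEquiv fun _ => ι) (i, I) = Fin.cons (Y i) (Y ∘ I) :=
        Fin.comp_cons Y i I
      rw [Matrix.of_apply, e1, e2, ← sumElim_comp_shiftEquiv, ← sumElim_comp_shiftEquiv]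
      rfl
    simp only [h1]
    have h2 (i : ι) := ih (q := q + 1) (by omega) (Fin.cons (g i) α) (Fin.cons (Y i) v)
    simp only [h2]
    rw [← Finset.mul_sum, sum_det_cons hY, ← hq, Nat.factorial_succ]
    push_cast
    ring

end Contraction

theorem AlternatingMap.apply_mul_apply_comm [FiniteDimensional ℝ V] {n : ℕ}
    (hn : Module.finrank ℝ V = n) (A B : V [⋀^Fin n]→ₗ[ℝ] ℝ) (v w : Fin n → V) :
    A v * B w = A w * B v := by
  let b := Module.finBasisOfFinrankEq ℝ V hn
  rw [A.eq_smul_basis_det b, B.eq_smul_basis_det b]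
  simp only [AlternatingMap.smul_apply, smul_eq_mul]
  ring

/-- The determinant of linear maps with values in a commutative algebra, as an alternating map. -/
def detAlternating {R : Type*} [CommRing R] [Algebra ℝ R] {k : ℕ} (L : Fin k → V →ₗ[ℝ] R) :
    V [⋀^Fin k]→ₗ[ℝ] R where
  toMultilinearMap := ((Matrix.detRowAlternating (R := R) (n := Fin k)).toMultilinearMap.restrictScalars
    ℝ).compLinearMap fun _ => LinearMap.pi L
  map_eq_zero_of_eq' _ _ _ h hij := Matrix.det_zero_of_row_eq hij
    (funext fun l => congrArg (L l) h)

end LinearAlgebra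

/-! ### Multiderivations into geometric modules, computed in a frame -/

section Derivations

variable {n : ℕ} {M : Type*} [TopologicalSpace M] [ChartedSpace (EuclideanSpace ℝ (Fin n)) M]

theorem sum_apply {ι : Type*} (s : Finset ι) (f : ι → SmoothFun n M) (x : M) :
    (∑ i ∈ s, f i) x = ∑ i ∈ s, f i x :=
  map_sum (ContMDiffMap.evalRingHom x : SmoothFun n M →+* ℝ) f s

theorem det_apply {κ : Type*} [Fintype κ] [DecidableEq κ] (A : Matrix κ κ (SmoothFun n M)) (x : M) :
    A.det x = (Matrix.of fun i j => A i j x).det :=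
  RingHom.map_det (ContMDiffMap.evalRingHom x : SmoothFun n M →+* ℝ) A

/-- The differential at a point, as a linear map. -/
def diffAtLinear (x : M) : SmoothFun n M →ₗ[ℝ] Module.Dual ℝ (TangentSpace (𝓡 n) x) where
  toFun f := diffAt f x
  map_add' f g := diffAt_add f g x
  map_smul' c f := diffAt_smul c f x

theorem diffAt_one (x : M) : diffAt (1 : SmoothFun n M) x = 0 := by
  have h := diffAt_mul (1 : SmoothFun n M) 1 x
  rw [mul_one] at h
  have h1 : (1 : SmoothFun n M) x = 1 := rfl
  rw [h1, one_smul] at h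
  exact left_eq_add.1 h

theorem form_val_eq_zero {k : ℕ} (h : n < k) (x : M)
    (A : (TangentSpace (𝓡 n) x) [⋀^Fin k]→ₗ[ℝ] ℝ) : A = 0 := by
  ext v
  refine A.map_linearDependent v fun hv => ?_
  have h1 := hv.fintype_card_le_finrank
  rw [Fintype.card_fin] at h1
  have h2 : Module.finrank ℝ (TangentSpace (𝓡 n) x) = n :=
    finrank_euclideanSpace_fin (𝕜 := ℝ) (n := n)
  omega

theorem isGeometric_self : IsGeometric n M (SmoothFun n M) := by
  refine (Submodule.eq_bot_iff _).2 fun f hf => ?_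
  ext x
  have h := (Submodule.mem_iInf _).1 hf x
  rw [smul_eq_mul, Ideal.mul_top] at h
  exact h

variable {W : Type*} [AddCommGroup W] [Module (SmoothFun n M) W] [Module ℝ W]

/-- The Leibniz rule for a linear map on smooth functions. -/
def IsDer (D : SmoothFun n M →ₗ[ℝ] W) : Prop := ∀ a b, D (a * b) = a • D b + b • D a

theorem IsDer.map_one {D : SmoothFun n M →ₗ[ℝ] W} (hD : IsDer D) : D 1 = 0 := by
  have h := hD 1 1
  rw [mul_one, one_smul] at h
  exact left_eq_add.1 h

variable [IsScalarTower ℝ (SmoothFun n M) W]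

/-- Skew-symmetry moves any slot to the front, so the Leibniz rule needs checking only there. -/
theorem mem_multiDerSubmodule_iff {k : ℕ} {X : (SmoothFun n M) [⋀^Fin (k + 1)]→ₗ[ℝ] W} :
    X ∈ multiDerSubmodule n M W (k + 1) ↔ ∀ f a b, X (Fin.cons (a * b) f) =
      a • X (Fin.cons b f) + b • X (Fin.cons a f) := by
  constructor
  · intro h f a b
    have := h (Fin.cons 0 f) 0 a b
    simpa only [Fin.update_cons_zero] using this
  · intro h f i a b
    have hu (z : SmoothFun n M) : X (Function.update f i z) =
        (-1 : ℤ) ^ (i : ℕ) • X (Fin.cons z (i.removeNth f)) := by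
      rw [← Fin.insertNth_removeNth, AlternatingMap.map_insertNth]
      simp only [Int.reduceNeg, ← Int.cast_smul_eq_zsmul ℝ]
      rfl
    rw [hu, hu, hu, h, smul_add, smul_comm _ a, smul_comm _ b]

theorem curryLeft_mem_multiDerSubmodule {k : ℕ} {X : (SmoothFun n M) [⋀^Fin (k + 1)]→ₗ[ℝ] W}
    (hX : X ∈ multiDerSubmodule n M W (k + 1)) (g : SmoothFun n M) :
    X.curryLeft g ∈ multiDerSubmodule n M W k := by
  intro f i a b
  have := hX (Fin.cons g f) i.succ a b
  simp only [← Fin.cons_update] at this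
  exact this

theorem domDomCongr_mem_multiDerSubmodule {k l : ℕ} {X : (SmoothFun n M) [⋀^Fin k]→ₗ[ℝ] W}
    (hX : X ∈ multiDerSubmodule n M W k) (h : k = l) :
    X.domDomCongr (finCongr h) ∈ multiDerSubmodule n M W l := by
  subst h
  exact hX

theorem contract_mem_multiDerSubmodule {p : ℕ} {X : (SmoothFun n M) [⋀^Fin p]→ₗ[ℝ] W}
    (hX : X ∈ multiDerSubmodule n M W p) {m k : ℕ} (h : m + k = p) (g : Fin m → SmoothFun n M) :
    contract X m k h g ∈ multiDerSubmodule n M W k := by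
  induction m generalizing k with
  | zero => exact domDomCongr_mem_multiDerSubmodule hX _
  | succ m ih => exact curryLeft_mem_multiDerSubmodule (ih _ _) _

variable [IsManifold (𝓡 n) ∞ M]

/-- A vector field as a derivation. -/
def VField.applyLinear (X : VField n M) : SmoothFun n M →ₗ[ℝ] SmoothFun n M where
  toFun := X.apply
  map_add' := X.apply_add
  map_smul' := X.apply_smul

theorem VField.isDer_applyLinear (X : VField n M) : IsDer X.applyLinear := X.apply_mul

namespace CoordFrame

theorem vField_ext (Fr : CoordFrame n M) {X Y : VField n M} (h : ∀ f, X.apply f = Y.apply f) : X = Y := by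
  ext x
  rw [← Fr.sum_diffAt_smul x (X x), ← Fr.sum_diffAt_smul x (Y x)]
  refine Finset.sum_congr rfl fun i _ => ?_
  exact congrArg (· • Fr.vf i x) (congrArg (fun f => f x) (h (Fr.fn i)))

variable [T2Space M] (Fr : CoordFrame n M)

/-- For a point `p`, let `u` be `f` minus its first-order expansion at `p` in the frame. Then `u ∈
𝔪_p²`, so `D u ∈ 𝔪_p W` by the Leibniz rule. Replacing the constants `Y_i(f)(p)` by the functions
`Y_i(f)` changes the result by another element of `𝔪_p W`. So the two sides differ by an element of
`⋂ 𝔪_p W = 0`. -/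
theorem map_eq_sum (hW : IsGeometric n M W) {D : SmoothFun n M →ₗ[ℝ] W}
    (hD : IsDer D) (f : SmoothFun n M) : D f = ∑ i, (Fr.vf i).apply f • D (Fr.fn i) := by
  have hr (r : ℝ) (w : W) : r • w = (r • (1 : SmoothFun n M)) • w := by rw [smul_assoc, one_smul]
  rw [← sub_eq_zero, ← Submodule.mem_bot (SmoothFun n M), ← hW]
  refine (Submodule.mem_iInf _).2 fun p => ?_
  let u : SmoothFun n M := f - f p • 1 -
    ∑ i, ((Fr.vf i).apply f p) • (Fr.fn i - Fr.fn i p • 1)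
  have hu0 : u p = 0 := by
    have h1 : u p = f p - f p * 1 - (∑ i, ((Fr.vf i).apply f p) •
      (Fr.fn i - Fr.fn i p • 1) : SmoothFun n M) p := rfl
    rw [h1, sum_apply, mul_one, sub_self, zero_sub, neg_eq_zero]
    refine Finset.sum_eq_zero fun i _ => ?_
    change (Fr.vf i).apply f p * (Fr.fn i p - Fr.fn i p * 1) = 0
    ring
  have hu1 : diffAt u p = 0 := by
    have h1 : diffAt u p = diffAt f p -
        ∑ i, (Fr.vf i).apply f p • diffAt (Fr.fn i) p := by
      change diffAtLinear p u = _
      simp only [u, map_sub, map_sum, map_smul]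
      change diffAt f p - f p • diffAt 1 p - ∑ i, (Fr.vf i).apply f p •
        (diffAt (Fr.fn i) p - Fr.fn i p • diffAt 1 p) = _
      simp only [diffAt_one, smul_zero, sub_zero]
    rw [h1, sub_eq_zero]
    ext v
    conv_lhs => rw [← Fr.sum_diffAt_smul p v, map_sum]
    rw [LinearMap.sum_apply]
    refine Finset.sum_congr rfl fun i _ => ?_
    rw [map_smul, smul_eq_mul, mul_comm]
    rfl
  have hDu : D u ∈ vanishingIdeal n p • (⊤ : Submodule (SmoothFun n M) W) := by
    refine Submodule.mul_induction_on (mem_vanishingIdeal_mul_self hu0 hu1) ?_ ?_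
    · intro a ha b hb
      rw [hD]
      exact Submodule.add_mem _ (Submodule.smul_mem_smul ha trivial)
        (Submodule.smul_mem_smul hb trivial)
    · intro a b ha hb
      rw [map_add]
      exact Submodule.add_mem _ ha hb
  have hsplit : D f - ∑ i, (Fr.vf i).apply f • D (Fr.fn i) =
      D u + ∑ i, ((Fr.vf i).apply f p • (1 : SmoothFun n M) - (Fr.vf i).apply f) •
        D (Fr.fn i) := by
    simp only [u, map_sub, map_sum, map_smul, hD.map_one, smul_zero, sub_zero, sub_smul,
      Finset.sum_sub_distrib, ← hr]
    abel
  rw [hsplit]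
  refine Submodule.add_mem _ hDu (Submodule.sum_mem _ fun i _ =>
    Submodule.smul_mem_smul ?_ trivial)
  change (Fr.vf i).apply f p * 1 - (Fr.vf i).apply f p = 0
  ring

theorem multiDer_apply_eq_sum (hW : IsGeometric n M W) {k : ℕ}
    {X : (SmoothFun n M) [⋀^Fin k]→ₗ[ℝ] W} (hX : X ∈ multiDerSubmodule n M W k)
    (f : Fin k → SmoothFun n M) :
    X f = ∑ I : Fin k → Fr.ι, (∏ b, (Fr.vf (I b)).apply (f b)) • X (Fr.fn ∘ I) := by
  induction k with
  | zero =>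
    rw [Fintype.sum_unique, Finset.univ_eq_empty, Finset.prod_empty, one_smul]
    exact congrArg X (Subsingleton.elim _ _)
  | succ k ih =>
    rw [← (Fin.consEquiv fun _ => Fr.ι).sum_comp, Fintype.sum_prod_type]
    let D : SmoothFun n M →ₗ[ℝ] W :=
      { toFun := fun z => X.curryLeft z (Fin.tail f)
        map_add' := fun a b => by rw [map_add, AlternatingMap.add_apply]
        map_smul' := fun c a => by rw [map_smul, AlternatingMap.smul_apply, RingHom.id_apply] }
    have hD : IsDer D := fun a b => mem_multiDerSubmodule_iff.1 hX (Fin.tail f) a b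
    have h1 : X f = D (f 0) := congrArg X (Fin.cons_self_tail f).symm
    rw [h1, Fr.map_eq_sum hW hD]
    refine Finset.sum_congr rfl fun i _ => ?_
    have h2 : D (Fr.fn i) = X.curryLeft (Fr.fn i) (Fin.tail f) := rfl
    rw [h2, ih (curryLeft_mem_multiDerSubmodule hX _), Finset.smul_sum]
    refine Finset.sum_congr rfl fun I _ => ?_
    have h3 : Fr.fn ∘ (Fin.consEquiv fun _ => Fr.ι) (i, I) = Fin.cons (Fr.fn i) (Fr.fn ∘ I) :=
      Fin.comp_cons Fr.fn i I
    rw [smul_smul, Fin.prod_univ_succ, h3]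
    rfl

theorem factorial_smul_multiDer_apply (hW : IsGeometric n M W) {k : ℕ}
    {X : (SmoothFun n M) [⋀^Fin k]→ₗ[ℝ] W} (hX : X ∈ multiDerSubmodule n M W k)
    (f : Fin k → SmoothFun n M) :
    k.factorial • X f = ∑ I : Fin k → Fr.ι,
      (Matrix.of fun a b => (Fr.vf (I a)).apply (f b)).det • X (Fr.fn ∘ I) := by
  rw [sum_det_smul_map X Fr.fn fun i b => (Fr.vf i).apply (f b),
    ← Fr.multiDer_apply_eq_sum hW hX f]

end CoordFrame

theorem det_apply_eq_wedgeDiff {k : ℕ} (Y : Fin k → VField n M) (f : Fin k → SmoothFun n M)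
    (x : M) : (Matrix.of fun a b => (Y a).apply (f b)).det x =
      (wedgeDiff f).val x fun a => Y a x := by
  rw [det_apply]
  rfl

theorem Form.eq_zero {k : ℕ} (h : n < k) (η : Form n M k) : η = 0 := by
  ext x : 2
  exact form_val_eq_zero h x _

theorem det_apply_eq_zero {k : ℕ} (h : n < k) (Y : Fin k → VField n M)
    (f : Fin k → SmoothFun n M) : (Matrix.of fun a b => (Y a).apply (f b)).det = 0 := by
  ext x
  rw [det_apply_eq_wedgeDiff, Form.eq_zero h (wedgeDiff f)]
  rfl

/-- Up to the factor `k!`, the values are combinations of `k × k` determinants of differentials,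
which vanish above the dimension. -/
theorem CoordFrame.multiDer_eq_zero [T2Space M] (Fr : CoordFrame n M) (hW : IsGeometric n M W)
    {k : ℕ} (h : n < k) {X : (SmoothFun n M) [⋀^Fin k]→ₗ[ℝ] W}
    (hX : X ∈ multiDerSubmodule n M W k) : X = 0 := by
  ext f
  have h1 := Fr.factorial_smul_multiDer_apply hW hX f
  simp only [det_apply_eq_zero h, zero_smul, Finset.sum_const_zero] at h1
  rw [← Nat.cast_smul_eq_nsmul ℝ, smul_eq_zero] at h1
  exact h1.resolve_left (Nat.cast_ne_zero.2 k.factorial_ne_zero)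

end Derivations

theorem alternatingMap_sum_apply {V W ι κ : Type*} [AddCommGroup V] [Module ℝ V] [AddCommGroup W]
    [Module ℝ W] (s : Finset ι) (A : ι → V [⋀^κ]→ₗ[ℝ] W) (v : κ → V) :
    (∑ i ∈ s, A i) v = ∑ i ∈ s, A i v :=
  map_sum ({ toFun := fun A => A v, map_zero' := rfl, map_add' := fun _ _ => rfl } :
    (V [⋀^κ]→ₗ[ℝ] W) →+ W) A s

theorem removeNth_succ_cons {α : Type*} {k : ℕ} (j : Fin (k + 1)) (z : α) (a : Fin (k + 1) → α) :
    j.succ.removeNth (Fin.cons z a : Fin (k + 2) → α) = Fin.cons z (j.removeNth a) := by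
  funext i
  induction i using Fin.cases <;> simp [Fin.removeNth]

theorem alternatingMap_update {V W : Type*} [AddCommGroup V] [Module ℝ V] [AddCommGroup W]
    [Module ℝ W] {k : ℕ} (A : V [⋀^Fin (k + 1)]→ₗ[ℝ] W) (f : Fin (k + 1) → V) (j : Fin (k + 1))
    (z : V) : A (Function.update f j z) = (-1 : ℤ) ^ (j : ℕ) • A (Fin.cons z (j.removeNth f)) := by
  rw [← Fin.insertNth_removeNth, AlternatingMap.map_insertNth]
  simp only [Int.reduceNeg, ← Int.cast_smul_eq_zsmul ℝ]
  rfl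

/-! ### The multivector field dual to the volume form -/

section DualVolume

variable {n : ℕ} {M : Type*} [TopologicalSpace M] [ChartedSpace (EuclideanSpace ℝ (Fin n)) M]

/-- The reciprocal of a nowhere vanishing smooth function. -/
def invSmooth (F : SmoothFun n M) (hF : ∀ x, F x ≠ 0) : SmoothFun n M :=
  ⟨fun x => (F x)⁻¹, F.contMDiff.inv₀ hF⟩

variable [IsManifold (𝓡 n) ∞ M]

/-- The function `η(Y₁, …, Y_k)`. -/
def Form.eval {k : ℕ} (η : Form n M k) (Y : Fin k → VField n M) : SmoothFun n M :=
  ⟨fun x => η.val x fun i => Y i x, η.smooth Y⟩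

theorem CoordFrame.form_expand (Fr : CoordFrame n M) {k : ℕ} {x : M}
    (A : (TangentSpace (𝓡 n) x) [⋀^Fin k]→ₗ[ℝ] ℝ) (v : Fin k → TangentSpace (𝓡 n) x) :
    A v = ∑ I : Fin k → Fr.ι,
      (∏ b, diffAt (Fr.fn (I b)) x (v b)) * A fun b => Fr.vf (I b) x :=
  AlternatingMap.expand A (c := fun i v => diffAt (Fr.fn i) x v) (Fr.sum_diffAt_smul x) v

theorem CoordFrame.factorial_mul_form (Fr : CoordFrame n M) {k : ℕ} {x : M}
    (A : (TangentSpace (𝓡 n) x) [⋀^Fin k]→ₗ[ℝ] ℝ) (v : Fin k → TangentSpace (𝓡 n) x) :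
    k.factorial * A v = ∑ I : Fin k → Fr.ι,
      (wedgeDiff fun b => Fr.fn (I b)).val x v * A fun b => Fr.vf (I b) x := by
  have h := sum_det_smul_map A (fun i => Fr.vf i x) fun i b => diffAt (Fr.fn i) x (v b)
  rw [nsmul_eq_mul] at h
  rw [Fr.form_expand A v]
  refine h.symm.trans (Finset.sum_congr rfl fun I _ => ?_)
  rw [← Matrix.det_transpose]
  rfl

theorem wedgeDiff_cons {k : ℕ} (a : Fin (k + 1) → SmoothFun n M) (x : M)
    (v : TangentSpace (𝓡 n) x) (w : Fin k → TangentSpace (𝓡 n) x) :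
    (wedgeDiff a).val x (Fin.cons v w) =
      ∑ i : Fin (k + 1), (-1) ^ (i : ℕ) * diffAt (a i) x v *
        (wedgeDiff (i.removeNth a)).val x w :=
  Matrix.det_succ_row_zero _

/-- `J` is the multivector field of top degree dual to the volume form `μ`, that is, the one with
`⟨J, μ⟩ = 1`, regarded as a skew-symmetric multiderivation. -/
structure IsDualVolume (μ : Form n M n)
    (J : (SmoothFun n M) [⋀^Fin n]→ₗ[ℝ] SmoothFun n M) : Prop where
  mem : J ∈ multiDerSubmodule n M (SmoothFun n M) n
  apply_mul : ∀ a x v, J a x * μ.val x v = (wedgeDiff a).val x v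

/-- Each `d I = Y_{I_1} ∧ ⋯ ∧ Y_{I_n}` satisfies `d_I(f) μ(v) = (df₁ ∧ ⋯ ∧ df_n)(v) c_I` with `c_I =
μ(Y_I)`, because forms of top degree are proportional. The weights `c_I / ∑ c_I²` normalise the sum;
the denominator has no zero, as `μ` is determined by its values on the frame. -/
theorem exists_isDualVolume (Fr : CoordFrame n M) {μ : Form n M n} (hμ : IsVolumeForm μ) :
    ∃ J, IsDualVolume μ J := by
  let c (I : Fin n → Fr.ι) : SmoothFun n M := μ.eval fun a => Fr.vf (I a)
  let q : SmoothFun n M := ∑ I, c I * c I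
  have hqx (x : M) : q x = ∑ I, c I x * c I x := sum_apply _ _ x
  have hq (x : M) : q x ≠ 0 := by
    intro h0
    rw [hqx, Finset.sum_eq_zero_iff_of_nonneg fun _ _ => mul_self_nonneg _] at h0
    refine hμ x (AlternatingMap.ext fun v => ?_)
    rw [Fr.form_expand]
    refine Finset.sum_eq_zero fun I hI => ?_
    have : c I x = 0 := mul_self_eq_zero.1 (h0 I hI)
    exact mul_eq_zero_of_right _ this
  let d (I : Fin n → Fr.ι) : (SmoothFun n M) [⋀^Fin n]→ₗ[ℝ] SmoothFun n M :=
    detAlternating fun a => (Fr.vf (I a)).applyLinear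
  have hd (I : Fin n → Fr.ι) (f : Fin n → SmoothFun n M) :
      d I f = (Matrix.of fun a b => (Fr.vf (I a)).apply (f b)).det := by
    rw [← Matrix.det_transpose]
    rfl
  let J : (SmoothFun n M) [⋀^Fin n]→ₗ[ℝ] SmoothFun n M :=
    ∑ I, (invSmooth q hq * c I) • d I
  have hJ (f : Fin n → SmoothFun n M) : J f = ∑ I, (invSmooth q hq * c I) * d I f := by
    exact alternatingMap_sum_apply _ _ f
  refine ⟨J, fun f i a b => ?_, fun f x v => ?_⟩
  · have h (I : Fin n → Fr.ι) : d I (Function.update f i (a * b)) =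
        a * d I (Function.update f i b) + b * d I (Function.update f i a) := by
      have hrow (z : SmoothFun n M) : d I (Function.update f i z) =
          ((Matrix.of fun l j => (Fr.vf (I j)).apply (f l)).updateRow i
            fun j => (Fr.vf (I j)).apply z).det := by
        refine congrArg Matrix.det (Matrix.ext fun l j => ?_)
        by_cases h : l = i
        · subst h; simp [VField.applyLinear]
        · simp [h, VField.applyLinear]
      have h2 : (fun j => (Fr.vf (I j)).apply (a * b)) =
          a • (fun j => (Fr.vf (I j)).apply b) + b • (fun j => (Fr.vf (I j)).apply a) :=
        funext fun j => (Fr.vf (I j)).apply_mul a b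
      rw [hrow, hrow, hrow, h2, Matrix.det_updateRow_add, Matrix.det_updateRow_smul,
        Matrix.det_updateRow_smul]
    rw [hJ, hJ, hJ, smul_eq_mul, smul_eq_mul, Finset.mul_sum, Finset.mul_sum,
      ← Finset.sum_add_distrib]
    refine Finset.sum_congr rfl fun I _ => ?_
    rw [h]
    ring
  · have h1 (I : Fin n → Fr.ι) : d I f x * μ.val x v = (wedgeDiff f).val x v * c I x := by
      rw [hd, det_apply_eq_wedgeDiff]
      exact AlternatingMap.apply_mul_apply_comm
        (finrank_euclideanSpace_fin (𝕜 := ℝ) (n := n)) ((wedgeDiff f).val x) (μ.val x) _ v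
    have h2 : J f x = ∑ I, (q x)⁻¹ * c I x * d I f x := by
      rw [hJ, sum_apply]
      rfl
    rw [h2, Finset.sum_mul]
    have h3 (I : Fin n → Fr.ι) : (q x)⁻¹ * c I x * d I f x * μ.val x v =
        ((q x)⁻¹ * (wedgeDiff f).val x v) * (c I x * c I x) := by
      rw [mul_assoc, h1]; ring
    rw [Finset.sum_congr rfl fun I _ => h3 I, ← Finset.mul_sum, ← hqx, mul_right_comm,
      inv_mul_cancel₀ (hq x), one_mul]

variable {μ : Form n M n} {J : (SmoothFun n M) [⋀^Fin n]→ₗ[ℝ] SmoothFun n M}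

namespace IsDualVolume

theorem eval_mul (hJ : IsDualVolume μ J) (a : Fin n → SmoothFun n M) (Y : Fin n → VField n M) :
    J a * μ.eval Y = (Matrix.of fun i j => (Y i).apply (a j)).det := by
  ext x
  rw [det_apply_eq_wedgeDiff, ← hJ.apply_mul]
  rfl

theorem factorial_eq (hJ : IsDualVolume μ J) (hμ : IsVolumeForm μ) (Fr : CoordFrame n M) :
    ∑ I : Fin n → Fr.ι, J (Fr.fn ∘ I) * μ.eval (Fr.vf ∘ I) = (n.factorial : SmoothFun n M) := by
  ext x
  obtain ⟨v, hv⟩ : ∃ v, μ.val x v ≠ 0 := by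
    by_contra! h
    exact hμ x (AlternatingMap.ext h)
  refine mul_right_cancel₀ hv ?_
  have h := Fr.factorial_mul_form (μ.val x) v
  have hn : (n.factorial : SmoothFun n M) x = n.factorial :=
    map_natCast (ContMDiffMap.evalRingHom x : SmoothFun n M →+* ℝ) _
  rw [hn, h, sum_apply, Finset.sum_mul]
  refine Finset.sum_congr rfl fun I _ => ?_
  rw [← hJ.apply_mul]
  exact mul_right_comm _ _ _

/-- By `factorial_eq` the values of `J` generate the unit ideal. Identities can therefore be proved
after multiplication by an arbitrary `J a`. -/
theorem smul_cancel {W : Type*} [AddCommGroup W] [Module (SmoothFun n M) W] [Module ℝ W]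
    [IsScalarTower ℝ (SmoothFun n M) W]
    (hJ : IsDualVolume μ J) (hμ : IsVolumeForm μ) (Fr : CoordFrame n M) {w w' : W}
    (h : ∀ a, J a • w = J a • w') : w = w' := by
  have h1 : (n.factorial : SmoothFun n M) • w = (n.factorial : SmoothFun n M) • w' := by
    rw [← hJ.factorial_eq hμ Fr, Finset.sum_smul, Finset.sum_smul]
    refine Finset.sum_congr rfl fun I _ => ?_
    rw [mul_comm, mul_smul, h, mul_smul]
  rw [Nat.cast_smul_eq_nsmul, Nat.cast_smul_eq_nsmul, ← Nat.cast_smul_eq_nsmul ℝ,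
    ← Nat.cast_smul_eq_nsmul ℝ] at h1
  exact smul_right_injective W (Nat.cast_ne_zero.2 n.factorial_ne_zero) h1

variable [T2Space M] {W : Type*} [AddCommGroup W] [Module (SmoothFun n M) W] [Module ℝ W]
  [IsScalarTower ℝ (SmoothFun n M) W]

/-- The sum is, up to sign, `J ∧ D`, of degree `n + 1`. For a field of the frame it is the expansion
of an `(n + 1)`-form, which is zero; a general `D` is a combination of these. -/
theorem alternating_sum_eq_zero (hJ : IsDualVolume μ J) (hμ : IsVolumeForm μ)
    (Fr : CoordFrame n M) (hW : IsGeometric n M W) {D : SmoothFun n M →ₗ[ℝ] W} (hD : IsDer D)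
    (a : Fin (n + 1) → SmoothFun n M) :
    ∑ i : Fin (n + 1), (-1 : ℤ) ^ (i : ℕ) • J (i.removeNth a) • D (a i) = 0 := by
  have h1 (l : Fr.ι) :
      ∑ i : Fin (n + 1), (-1) ^ (i : ℕ) * J (i.removeNth a) * (Fr.vf l).apply (a i) = 0 := by
    ext x
    obtain ⟨v, hv⟩ : ∃ v, μ.val x v ≠ 0 := by
      by_contra! h
      exact hμ x (AlternatingMap.ext h)
    refine mul_right_cancel₀ hv ?_
    have h := wedgeDiff_cons a x (Fr.vf l x) v
    rw [Form.eq_zero n.lt_succ_self (wedgeDiff a)] at h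
    change _ = 0 * _
    rw [zero_mul, sum_apply, Finset.sum_mul]
    refine Eq.trans (Finset.sum_congr rfl fun i _ => ?_) h.symm
    rw [← hJ.apply_mul]
    have h2 : ((-1) ^ (i : ℕ) * J (i.removeNth a) * (Fr.vf l).apply (a i)) x =
      (-1) ^ (i : ℕ) * J (i.removeNth a) x * diffAt (a i) x (Fr.vf l x) := rfl
    rw [h2]
    ring
  have h2 (i : Fin (n + 1)) : (-1 : ℤ) ^ (i : ℕ) • J (i.removeNth a) • D (a i) =
      ∑ l, ((-1) ^ (i : ℕ) * J (i.removeNth a) * (Fr.vf l).apply (a i)) • D (Fr.fn l) := by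
    rw [Fr.map_eq_sum hW hD (a i), Finset.smul_sum, Finset.smul_sum]
    refine Finset.sum_congr rfl fun l _ => ?_
    rw [mul_smul, mul_smul, ← Int.cast_smul_eq_zsmul (SmoothFun n M)]
    push_cast
    rfl
  rw [Finset.sum_congr rfl fun i _ => h2 i, Finset.sum_comm]
  refine Finset.sum_eq_zero fun l _ => ?_
  rw [← Finset.sum_smul, h1, zero_smul]

/-- The vanishing of `J ∧ D` read as Cramer's rule. In this form it cancels the Leibniz defects met
below. -/
theorem sum_update_smul (hJ : IsDualVolume μ J) (hμ : IsVolumeForm μ)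
    (Fr : CoordFrame n M) (hW : IsGeometric n M W) {D : SmoothFun n M →ₗ[ℝ] W} (hD : IsDer D)
    (z : SmoothFun n M) (a : Fin n → SmoothFun n M) :
    ∑ j, J (Function.update a j z) • D (a j) = J a • D z := by
  have h := hJ.alternating_sum_eq_zero hμ Fr hW hD (Fin.cons z a)
  rw [Fin.sum_univ_succ, Fin.val_zero, pow_zero, one_smul, Fin.cons_zero, add_eq_zero_iff_eq_neg,
    ← Finset.sum_neg_distrib] at h
  refine Eq.symm (h.trans (Finset.sum_congr rfl fun j _ => ?_))
  obtain ⟨q, rfl⟩ : ∃ q, n = q + 1 := ⟨n - 1, by have := j.pos; omega⟩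
  rw [alternatingMap_update, Fin.cons_succ, removeNth_succ_cons, Fin.val_succ, pow_succ,
    mul_neg_one, neg_smul, neg_neg, smul_assoc]

end IsDualVolume

end DualVolume

/-! ### Sums of slotwise replacements -/

section SlotSums

/-- Both sides are the trace of `B` times the adjugate of `A`. -/
theorem sum_det_updateRow_eq {R κ : Type*} [CommRing R] [Fintype κ] [DecidableEq κ]
    (A B : Matrix κ κ R) :
    ∑ i, (A.updateRow i (B i)).det = ∑ j, (A.updateCol j fun i => B i j).det := by
  have h1 (i : κ) : (A.updateRow i (B i)).det = ∑ j, B i j * A.adjugate j i := by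
    rw [← Matrix.cramer_transpose_apply, Matrix.cramer_eq_adjugate_mulVec, ← Matrix.adjugate_transpose]
    simp only [Matrix.mulVec, dotProduct, Matrix.transpose_apply, mul_comm]
  have h2 (j : κ) : (A.updateCol j fun i => B i j).det = ∑ i, B i j * A.adjugate j i := by
    rw [← Matrix.cramer_apply, Matrix.cramer_eq_adjugate_mulVec]
    simp only [Matrix.mulVec, dotProduct, mul_comm]
  rw [Finset.sum_congr rfl fun i _ => h1 i, Finset.sum_congr rfl fun j _ => h2 j, Finset.sum_comm]

/-- Replacements in different slots commute, so only the terms with both operators in the same slot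
survive, and they form the commutator. -/
theorem sum_update_update_sub {V W κ : Type*} [AddCommGroup V] [AddCommGroup W] [Fintype κ]
    [DecidableEq κ] (F : (κ → V) → W)
    (hF : ∀ (a : κ → V) j x y, F (Function.update a j (x - y)) =
      F (Function.update a j x) - F (Function.update a j y))
    (D E : V → V) (a : κ → V) :
    (∑ l, ∑ j, F (Function.update (Function.update a l (E (a l))) j
      (D (Function.update a l (E (a l)) j)))) -
    (∑ l, ∑ j, F (Function.update (Function.update a l (D (a l))) j
      (E (Function.update a l (D (a l)) j)))) =
    ∑ j, F (Function.update a j (D (E (a j)) - E (D (a j)))) := by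
  conv_lhs => arg 2; rw [Finset.sum_comm]
  rw [← Finset.sum_sub_distrib]
  refine Finset.sum_congr rfl fun l _ => ?_
  rw [← Finset.sum_sub_distrib, Finset.sum_eq_single l]
  · simp only [Function.update_idem, Function.update_self, hF]
  · intro j _ hj
    rw [Function.update_of_ne hj, Function.update_of_ne hj.symm, Function.update_comm hj, sub_self]
  · simp

end SlotSums

/-! ### Derivations, Poisson brackets and Hamiltonian fields -/

section Brackets

variable {n : ℕ} {M : Type*} [TopologicalSpace M] [ChartedSpace (EuclideanSpace ℝ (Fin n)) M]

theorem IsDer.map_prod {D : SmoothFun n M →ₗ[ℝ] SmoothFun n M} (hD : IsDer D) {κ : Type*}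
    [DecidableEq κ] (s : Finset κ) (h : κ → SmoothFun n M) :
    D (∏ i ∈ s, h i) = ∑ j ∈ s, ∏ i ∈ s, Function.update h j (D (h j)) i := by
  induction s using Finset.induction_on with
  | empty => simpa using hD.map_one
  | insert b s hb ih =>
    rw [Finset.prod_insert hb, hD, ih, Finset.sum_insert hb, Finset.prod_insert hb,
      Function.update_self, smul_eq_mul, smul_eq_mul, Finset.mul_sum, add_comm]
    congr 1
    · rw [mul_comm]
      congr 1
      exact Finset.prod_congr rfl fun i hi =>
        (Function.update_of_ne (fun h : i = b => hb (h ▸ hi)) _ _).symm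
    · refine Finset.sum_congr rfl fun j hj => ?_
      rw [Finset.prod_insert hb, Function.update_of_ne fun h : b = j => hb (h ▸ hj)]

theorem IsDer.map_det {D : SmoothFun n M →ₗ[ℝ] SmoothFun n M} (hD : IsDer D) {κ : Type*}
    [DecidableEq κ] [Fintype κ] (A : Matrix κ κ (SmoothFun n M)) :
    D A.det = ∑ j, (A.updateCol j fun i => D (A i j)).det := by
  simp only [Matrix.det_apply, map_sum, Units.smul_def, map_zsmul, hD.map_prod]
  rw [Finset.sum_comm]
  simp only [Finset.smul_sum]
  rw [Finset.sum_comm]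
  conv_rhs => rw [Finset.sum_comm]
  refine Finset.sum_congr rfl fun j _ => Finset.sum_congr rfl fun σ _ => ?_
  congr 1
  refine Finset.prod_congr rfl fun i _ => ?_
  by_cases h : i = j
  · subst h; simp
  · simp [h]

variable (P : PoissonStructure n M)

theorem diffAt_hamiltonian (f g : SmoothFun n M) (x : M) :
    diffAt g x (P.hamiltonian f x) = P.bracket g f x := by
  rw [P.bracket_swap g f, PoissonStructure.hamiltonian, map_neg, Bivector.apply_sharp]
  rfl

/-- The derivation `{-, f}`. -/
def PoissonStructure.bracketRight (f : SmoothFun n M) : SmoothFun n M →ₗ[ℝ] SmoothFun n M where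
  toFun g := P.bracket g f
  map_add' g h := by
    ext x
    rw [← diffAt_hamiltonian, diffAt_add]
    change _ = P.bracket g f x + P.bracket h f x
    rw [← diffAt_hamiltonian, ← diffAt_hamiltonian]
    rfl
  map_smul' c g := by
    ext x
    rw [← diffAt_hamiltonian, diffAt_smul]
    change _ = c * P.bracket g f x
    rw [← diffAt_hamiltonian]
    rfl

theorem PoissonStructure.bracket_mul_left (f g h : SmoothFun n M) :
    P.bracket (f * g) h = f * P.bracket g h + g * P.bracket f h := by
  ext x
  rw [← diffAt_hamiltonian, diffAt_mul]
  change _ = f x * P.bracket g h x + g x * P.bracket f h x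
  rw [← diffAt_hamiltonian, ← diffAt_hamiltonian]
  rfl

theorem PoissonStructure.isDer_bracketRight (f : SmoothFun n M) : IsDer (P.bracketRight f) :=
  fun a b => P.bracket_mul_left a b f

theorem PoissonStructure.bracket_mul_right (f g h : SmoothFun n M) :
    P.bracket f (g * h) = h * P.bracket f g + g * P.bracket f h := by
  rw [P.bracket_swap, P.bracket_mul_left, P.bracket_swap f g, P.bracket_swap f h]
  ring

theorem PoissonStructure.bracket_add_left (f g h : SmoothFun n M) :
    P.bracket (f + g) h = P.bracket f h + P.bracket g h :=
  map_add (P.bracketRight h) f g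

theorem PoissonStructure.bracket_smul_left (c : ℝ) (f g : SmoothFun n M) :
    P.bracket (c • f) g = c • P.bracket f g :=
  map_smul (P.bracketRight g) c f

theorem PoissonStructure.bracket_add_right (f g h : SmoothFun n M) :
    P.bracket f (g + h) = P.bracket f g + P.bracket f h := by
  rw [P.bracket_swap, P.bracket_swap f g, P.bracket_swap f h, ← neg_add]
  rw [P.bracket_add_left]

theorem PoissonStructure.bracket_smul_right (c : ℝ) (f g : SmoothFun n M) :
    P.bracket f (c • g) = c • P.bracket f g := by
  rw [P.bracket_swap, P.bracket_swap f g, smul_neg]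
  rw [P.bracket_smul_left]

/-- The Poisson module `C^∞(M)`. -/
def PoissonStructure.selfModule : PoissonModule P (SmoothFun n M) where
  act := LinearMap.mk₂ ℝ (fun g f => P.bracket g f)
    P.bracket_add_left P.bracket_smul_left
    P.bracket_add_right P.bracket_smul_right
  act_bracket w f g := by
    have h := P.jacobi w f g
    have h1 : P.bracket f (P.bracket g w) = P.bracket (P.bracket w g) f := by
      rw [P.bracket_swap g w, P.bracket_swap f, P.bracket_neg_left, neg_neg]
    have h2 : P.bracket g (P.bracket w f) = - P.bracket (P.bracket w f) g := P.bracket_swap _ _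
    rw [h1, h2] at h
    simp only [LinearMap.mk₂_apply]
    linear_combination h
  act_smul w f g := by
    rw [LinearMap.mk₂_apply, LinearMap.mk₂_apply, smul_eq_mul, smul_eq_mul, smul_eq_mul, P.bracket_mul_left]
    ring
  act_mul w f g := P.bracket_mul_right w f g

theorem PoissonStructure.bracket_bracket (f g h : SmoothFun n M) :
    P.bracket f (P.bracket g h) = P.bracket (P.bracket f g) h - P.bracket (P.bracket f h) g :=
  P.selfModule.act_bracket f g h

variable [IsManifold (𝓡 n) ∞ M]

/-- `P.hamiltonian f` is defined pointwise; its smoothness is visible from its coefficients `{x_i,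
f}` in the frame. -/
theorem CoordFrame.exists_hamiltonian (Fr : CoordFrame n M) (f : SmoothFun n M) :
    ∃ X : VField n M, ∀ x, X x = P.hamiltonian f x := by
  have h (x : M) : P.hamiltonian f x = ∑ i, P.bracket (Fr.fn i) f x • Fr.vf i x := by
    rw [← Fr.sum_diffAt_smul x (P.hamiltonian f x)]
    exact Finset.sum_congr rfl fun i _ => by rw [diffAt_hamiltonian]
  refine ⟨⟨fun x => ∑ i, P.bracket (Fr.fn i) f x • Fr.vf i x, fun p => ?_⟩, fun x => (h x).symm⟩
  exact ContMDiffAt.sum_section fun i _ =>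
    ((P.bracket (Fr.fn i) f).contMDiff p).smul_section ((Fr.vf i).contMDiff p)

end Brackets

/-! ### The modular vector field -/

section ModularField

variable {n : ℕ} {M : Type*} [TopologicalSpace M] [ChartedSpace (EuclideanSpace ℝ (Fin n)) M]

/-- The failure of `J` to be invariant under the Hamiltonian flow of `f`, as a linear map in `f`. -/
def PoissonStructure.defect (P : PoissonStructure n M)
    (J : (SmoothFun n M) [⋀^Fin n]→ₗ[ℝ] SmoothFun n M) (a : Fin n → SmoothFun n M) :
    SmoothFun n M →ₗ[ℝ] SmoothFun n M :=
  ∑ j, (J.toMultilinearMap.toLinearMap a j).comp (P.selfModule.act (a j)) - P.selfModule.act (J a)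

theorem PoissonStructure.defect_apply (P : PoissonStructure n M)
    (J : (SmoothFun n M) [⋀^Fin n]→ₗ[ℝ] SmoothFun n M) (a : Fin n → SmoothFun n M)
    (f : SmoothFun n M) :
    P.defect J a f = ∑ j, J (Function.update a j (P.bracket (a j) f)) - P.bracket (J a) f := by
  rw [defect, LinearMap.sub_apply, LinearMap.sum_apply]
  rfl

/-- `θ` is the derivation of the modular vector field, in terms of the dual `J` of the volume form. -/
def PoissonStructure.IsModularFor (P : PoissonStructure n M)
    (J : (SmoothFun n M) [⋀^Fin n]→ₗ[ℝ] SmoothFun n M) (θ : SmoothFun n M → SmoothFun n M) : Prop :=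
  ∀ a f, J a * θ f = ∑ j, J (Function.update a j (P.bracket (a j) f)) - P.bracket (J a) f

variable [IsManifold (𝓡 n) ∞ M]

theorem CoordFrame.exists_eval_ne_zero (Fr : CoordFrame n M) {μ : Form n M n}
    (hμ : IsVolumeForm μ) (x : M) : ∃ I : Fin n → Fr.ι, μ.eval (Fr.vf ∘ I) x ≠ 0 := by
  by_contra! h
  refine hμ x (AlternatingMap.ext fun v => ?_)
  rw [Fr.form_expand]
  exact Finset.sum_eq_zero fun I _ => mul_eq_zero_of_right _ (h I)

variable {P : PoissonStructure n M} {μ : Form n M n}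
  {J : (SmoothFun n M) [⋀^Fin n]→ₗ[ℝ] SmoothFun n M}

namespace IsDualVolume

/-- Differentiate `J(a) μ(Y) = det (Y_i a_j)` along `X = X_f`, column by column. Since `X Y_i a_j =
[X, Y_i] a_j + Y_i {a_j, f}`, the second part gives the terms `J(…, {a_j, f}, …) μ(Y)`. The first,
regrouped by rows, gives `J(a) μ(…, [X, Y_i], …)`, which belongs to the Lie derivative. -/
theorem mul_lieDerivEval (hJ : IsDualVolume μ J) (Fr : CoordFrame n M) (f : SmoothFun n M)
    (a : Fin n → SmoothFun n M) (Y : Fin n → VField n M) (x : M) :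
    J a x * lieDerivEval (P.hamiltonian f) μ Y x = P.defect J a f x * μ.eval Y x := by
  obtain ⟨X, hX⟩ := Fr.exists_hamiltonian P f
  rw [← funext hX]
  set D := P.bracketRight f
  have hDX (g : SmoothFun n M) (y : M) : D g y = diffAt g y (X y) := by
    rw [hX, diffAt_hamiltonian]
    rfl
  have hDX' (g : SmoothFun n M) : D g = X.apply g := ContMDiffMap.ext fun y => hDX g y
  have hD : IsDer D := P.isDer_bracketRight f
  let A : Matrix (Fin n) (Fin n) (SmoothFun n M) := Matrix.of fun i j => (Y i).apply (a j)
  let B : Matrix (Fin n) (Fin n) (SmoothFun n M) :=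
    Matrix.of fun i j => D ((Y i).apply (a j)) - (Y i).apply (D (a j))
  have h1 : D (J a * μ.eval Y) = D A.det := congrArg D (hJ.eval_mul a Y)
  have h2 (j : Fin n) : (A.updateCol j fun i => D (A i j)).det =
      (A.updateCol j fun i => B i j).det +
        J (Function.update a j (P.bracket (a j) f)) * μ.eval Y := by
    have e1 : (fun i => D (A i j)) = (fun i => B i j) + fun i => (Y i).apply (D (a j)) :=
      funext fun i => (sub_add_cancel _ _).symm
    rw [e1, Matrix.det_updateCol_add, hJ.eval_mul]
    congr 2
    ext1 i l
    by_cases h : l = j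
    · subst h
      rw [Matrix.updateCol_self, Matrix.of_apply, Function.update_self]
      rfl
    · rw [Matrix.updateCol_ne h, Matrix.of_apply, Function.update_of_ne h]
      rfl
  have h3 (i : Fin n) : (A.updateRow i (B i)).det x =
      J a x * μ.val x (Function.update (fun j => Y j x) i
        (VectorField.mlieBracket (𝓡 n) X (Y i) x)) := by
    rw [hJ.apply_mul, det_apply]
    refine congrArg Matrix.det (Matrix.ext fun l j => ?_)
    change _ = diffAt (a j) x (Function.update (fun j => Y j x) i
        (VectorField.mlieBracket (𝓡 n) X (Y i) x) l)
    rw [Matrix.of_apply]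
    by_cases h : l = i
    · subst h
      rw [Matrix.updateRow_self, Function.update_self, diffAt_mlieBracket, ← hDX, ← hDX']
      rfl
    · rw [Matrix.updateRow_ne h, Function.update_of_ne h]
      rfl
  rw [hD.map_det, Finset.sum_congr rfl fun j _ => h2 j, Finset.sum_add_distrib,
    ← sum_det_updateRow_eq, hD] at h1
  have h4 := congrArg (fun F => F x) h1
  change J a x * D (μ.eval Y) x + μ.eval Y x * P.bracket (J a) f x =
    (∑ i, (A.updateRow i (B i)).det) x +
      (∑ j, J (Function.update a j (P.bracket (a j) f)) * μ.eval Y) x at h4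
  rw [sum_apply, Finset.sum_congr rfl fun i _ => h3 i, ← Finset.sum_mul, hDX, ← Finset.mul_sum] at h4
  rw [P.defect_apply]
  change J a x * (diffAt (μ.eval Y) x (X x) - _) =
    ((∑ j, J (Function.update a j (P.bracket (a j) f))) x - P.bracket (J a) f x) * μ.eval Y x
  change _ = _ + (∑ j, J (Function.update a j (P.bracket (a j) f))) x * μ.eval Y x at h4
  linear_combination h4

/-- The derivation of the modular vector field. -/
def modularMap (P : PoissonStructure n M) (μ : Form n M n)
    (J : (SmoothFun n M) [⋀^Fin n]→ₗ[ℝ] SmoothFun n M) (Fr : CoordFrame n M) :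
    SmoothFun n M →ₗ[ℝ] SmoothFun n M :=
  (n.factorial : ℝ)⁻¹ • ∑ I : Fin n → Fr.ι, μ.eval (Fr.vf ∘ I) • P.defect J (Fr.fn ∘ I)

/-- `mul_lieDerivEval` divides by `J(a)` only where it is nonzero; multiplying by `μ(Y_I)` and
summing over the frame replaces this by division by `n!`. -/
theorem lieDerivEval_eq (hJ : IsDualVolume μ J) (hμ : IsVolumeForm μ) (Fr : CoordFrame n M)
    (f : SmoothFun n M) (Y : Fin n → VField n M) (x : M) :
    lieDerivEval (P.hamiltonian f) μ Y x = modularMap P μ J Fr f x * μ.eval Y x := by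
  have h1 : modularMap P μ J Fr f x = (n.factorial : ℝ)⁻¹ *
      ∑ I : Fin n → Fr.ι, μ.eval (Fr.vf ∘ I) x * P.defect J (Fr.fn ∘ I) f x := by
    rw [modularMap, LinearMap.smul_apply, LinearMap.sum_apply]
    change _ * (∑ I : Fin n → Fr.ι, μ.eval (Fr.vf ∘ I) * P.defect J (Fr.fn ∘ I) f) x = _
    rw [sum_apply]
    rfl
  have h2 := congrArg (fun F => F x) (hJ.factorial_eq hμ Fr)
  have hn : (n.factorial : SmoothFun n M) x = n.factorial :=
    map_natCast (ContMDiffMap.evalRingHom x : SmoothFun n M →+* ℝ) _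
  rw [hn, sum_apply] at h2
  have hn0 : (n.factorial : ℝ) ≠ 0 := Nat.cast_ne_zero.2 n.factorial_ne_zero
  rw [h1, mul_assoc, eq_inv_mul_iff_mul_eq₀ hn0, ← h2, Finset.sum_mul, Finset.sum_mul]
  refine Finset.sum_congr rfl fun I _ => ?_
  rw [mul_assoc _ (P.defect J (Fr.fn ∘ I) f x), ← hJ.mul_lieDerivEval Fr]
  change J (Fr.fn ∘ I) x * μ.eval (Fr.vf ∘ I) x * _ = _
  ring

theorem isModularFor_modularMap (hJ : IsDualVolume μ J) (hμ : IsVolumeForm μ)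
    (Fr : CoordFrame n M) : P.IsModularFor J (modularMap P μ J Fr) := by
  intro a f
  rw [← P.defect_apply]
  ext x
  obtain ⟨I, hI⟩ := Fr.exists_eval_ne_zero hμ x
  refine mul_right_cancel₀ hI ?_
  rw [← hJ.mul_lieDerivEval Fr, hJ.lieDerivEval_eq hμ Fr]
  exact mul_assoc _ _ _

/-- Let `S_f` act on `J` by `{-, f}` in each slot. By the Jacobi identity, the commutator of `S_f`
and `S_g` is the action of `{f, g}`. Expressing each `S` through `θ` turns this into the derivation
property of `θ` for the bracket. -/
theorem bracket_of_isModularFor (hJ : IsDualVolume μ J) (hμ : IsVolumeForm μ)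
    (Fr : CoordFrame n M) {θ : SmoothFun n M → SmoothFun n M} (hθ : P.IsModularFor J θ)
    (f g : SmoothFun n M) : θ (P.bracket f g) = P.bracket (θ f) g + P.bracket f (θ g) := by
  refine hJ.smul_cancel hμ Fr fun a => ?_
  have hS (a) (f) : ∑ j, J (Function.update a j (P.bracket (a j) f)) =
      J a * θ f + P.bracket (J a) f := eq_add_of_sub_eq (hθ a f).symm
  have hSS (f g) : ∑ l, ∑ j, J (Function.update (Function.update a l (P.bracketRight f (a l))) j
      (P.bracketRight g (Function.update a l (P.bracketRight f (a l)) j))) =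
      (J a * θ f + P.bracket (J a) f) * θ g + P.bracket (J a * θ f + P.bracket (J a) f) g := by
    refine (Finset.sum_congr rfl fun l _ => hS _ g).trans ?_
    rw [Finset.sum_add_distrib, ← Finset.sum_mul]
    refine Eq.trans (congrArg₂ (· + ·) rfl
      (map_sum (P.bracketRight g) (fun l => J (Function.update a l (P.bracketRight f (a l)))) _).symm)
      ?_
    rw [← hS]
    rfl
  have h := sum_update_update_sub J (fun a j x y => J.map_update_sub a j x y) (P.bracketRight g)
    (P.bracketRight f) a
  have h1 (j : Fin n) : P.bracketRight g (P.bracketRight f (a j)) -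
      P.bracketRight f (P.bracketRight g (a j)) = P.bracket (a j) (P.bracket f g) :=
    (P.bracket_bracket _ _ _).symm
  simp only [h1] at h
  rw [hSS, hSS, hS, P.bracket_add_left, P.bracket_add_left, P.bracket_mul_left, P.bracket_mul_left,
    P.bracket_bracket (J a) f g] at h
  rw [P.bracket_swap f (θ g), smul_eq_mul, smul_eq_mul]
  linear_combination -h

variable [T2Space M]

/-- Expanding `{a_j, f h}` inside `J` leaves extra terms that sum to `J(a) {h, f}` and `J(a) {f, h}`
by `sum_update_smul`, and these cancel. -/
theorem isDer_of_isModularFor (hJ : IsDualVolume μ J) (hμ : IsVolumeForm μ) (Fr : CoordFrame n M)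
    {θ : SmoothFun n M →ₗ[ℝ] SmoothFun n M} (hθ : P.IsModularFor J θ) : IsDer θ := by
  intro f h
  refine hJ.smul_cancel hμ Fr fun a => ?_
  have h1 (j : Fin n) : J (Function.update a j (P.bracket (a j) (f * h))) =
      h * J (Function.update a j (P.bracket (a j) f)) +
        J (Function.update a j h) • P.bracketRight f (a j) +
      (f * J (Function.update a j (P.bracket (a j) h)) +
        J (Function.update a j f) • P.bracketRight h (a j)) := by
    rw [P.bracket_mul_right, J.map_update_add, hJ.mem, hJ.mem, smul_eq_mul, smul_eq_mul,
      smul_eq_mul, smul_eq_mul, smul_eq_mul, smul_eq_mul,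
      mul_comm (J (Function.update a j h)), mul_comm (J (Function.update a j f))]
    rfl
  simp only [smul_eq_mul]
  rw [hθ, mul_add, mul_left_comm, hθ, mul_left_comm, hθ, Finset.sum_congr rfl fun j _ => h1 j,
    Finset.sum_add_distrib, Finset.sum_add_distrib, Finset.sum_add_distrib, ← Finset.mul_sum,
    ← Finset.mul_sum, hJ.sum_update_smul hμ Fr isGeometric_self (P.isDer_bracketRight f),
    hJ.sum_update_smul hμ Fr isGeometric_self (P.isDer_bracketRight h), P.bracket_mul_right]
  have h2 : P.bracketRight h f = -P.bracketRight f h := P.bracket_swap f h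
  rw [h2, smul_neg]
  ring

end IsDualVolume

theorem exists_modularField (Fr : CoordFrame n M) [T2Space M] (P : PoissonStructure n M)
    (hμ : IsVolumeForm μ) (hJ : IsDualVolume μ J) :
    ∃ φ : VField n M, P.IsModularField μ φ ∧ (∀ ψ : VField n M, P.IsModularField μ ψ → ψ = φ) ∧
      P.IsPoissonField φ ∧ P.IsModularFor J φ.apply := by
  let θ := IsDualVolume.modularMap P μ J Fr
  have hθ : P.IsModularFor J θ := hJ.isModularFor_modularMap hμ Fr
  have hd : IsDer θ := hJ.isDer_of_isModularFor hμ Fr hθ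
  -- A derivation of functions is a vector field whose coefficients are its values on the frame
  -- functions.
  let φ : VField n M := ⟨fun x => ∑ i, θ (Fr.fn i) x • Fr.vf i x, fun p =>
    ContMDiffAt.sum_section fun i _ => ((θ (Fr.fn i)).contMDiff p).smul_section
      ((Fr.vf i).contMDiff p)⟩
  have hφ (f : SmoothFun n M) : φ.apply f = θ f := by
    rw [Fr.map_eq_sum isGeometric_self hd]
    ext x
    change diffAt f x (∑ i, θ (Fr.fn i) x • Fr.vf i x) = _
    rw [sum_apply, map_sum]
    refine Finset.sum_congr rfl fun i _ => ?_
    rw [map_smul, smul_eq_mul, mul_comm]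
    rfl
  have hφ' : φ.apply = θ := funext hφ
  refine ⟨φ, fun f Y x => ?_, fun ψ hψ => Fr.vField_ext fun f => ?_, fun f g => ?_, ?_⟩
  · rw [hφ]
    exact hJ.lieDerivEval_eq hμ Fr f Y x
  · ext x
    obtain ⟨I, hI⟩ := Fr.exists_eval_ne_zero hμ x
    refine mul_right_cancel₀ hI ?_
    have h := hψ f (Fr.vf ∘ I) x
    rw [hJ.lieDerivEval_eq hμ Fr] at h
    rw [hφ]
    exact h.symm
  · rw [hφ']
    exact hJ.bracket_of_isModularFor hμ Fr hθ f g
  · rw [hφ']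
    exact hθ

end ModularField

/-! ### Contraction of the dual volume with forms -/

section Star

variable {n : ℕ} {M : Type*} [TopologicalSpace M] [ChartedSpace (EuclideanSpace ℝ (Fin n)) M]
  [IsManifold (𝓡 n) ∞ M] {μ : Form n M n}
  {J : (SmoothFun n M) [⋀^Fin n]→ₗ[ℝ] SmoothFun n M}

theorem IsDualVolume.contract_mul_contract (hJ : IsDualVolume μ J) {m k : ℕ} (h : m + k = n)
    (g : Fin m → SmoothFun n M) (f : Fin k → SmoothFun n M) (x : M)
    (v : Fin m → TangentSpace (𝓡 n) x) (u : Fin k → TangentSpace (𝓡 n) x) :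
    contract J m k h g f x * contract (μ.val x) m k h v u =
      (Matrix.of fun a b : Fin m ⊕ Fin k => Sum.elim (fun a => diffAt (g a) x)
        (fun a => diffAt (f a) x) a (Sum.elim v u b)).det := by
  rw [contract_apply, contract_apply, hJ.apply_mul, ← Matrix.det_transpose,
    ← Matrix.det_submatrix_equiv_self (splitEquiv n m k h)]
  refine congrArg Matrix.det (Matrix.ext fun i j => ?_)
  change diffAt (Sum.elim g f (splitEquiv n m k h j)) x
    (Sum.elim v u (splitEquiv n m k h i)) = Sum.elim (fun a => diffAt (g a) x)
        (fun a => diffAt (f a) x) (splitEquiv n m k h j) (Sum.elim v u (splitEquiv n m k h i))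
  rcases splitEquiv n m k h j with a | a <;> rfl

theorem Form.sum_val {κ : Type*} {m : ℕ} (s : Finset κ) (F : κ → Form n M m) (x : M) :
    (∑ i ∈ s, F i).val x = ∑ i ∈ s, (F i).val x :=
  map_sum ({ toFun := fun η => η.val x, map_zero' := rfl, map_add' := fun _ _ => rfl } :
    Form n M m →+ _) F s

/-- The contraction of `μ` with `k` vector fields. -/
def Form.insert (μ : Form n M n) {m k : ℕ} (h : k + m = n) (Y : Fin k → VField n M) :
    Form n M m where
  val x := contract (μ.val x) k m h fun b => Y b x
  smooth Z := by
    refine (μ.smooth (Sum.elim Y Z ∘ splitEquiv n k m h)).congr fun x => ?_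
    rw [contract_apply]
    congr 1
    funext i
    change Sum.elim (fun b => Y b x) (fun b => Z b x) (splitEquiv n k m h i) =
      Sum.elim Y Z (splitEquiv n k m h i) x
    rcases splitEquiv n k m h i with a | a <;> rfl

/-- The contraction of the dual volume `J` with a form, as a map on forms. -/
def hodge (J : (SmoothFun n M) [⋀^Fin n]→ₗ[ℝ] SmoothFun n M) (Fr : CoordFrame n M)
    {m k : ℕ} (h : m + k = n) :
    Form n M m →ₗ[SmoothFun n M] (SmoothFun n M) [⋀^Fin k]→ₗ[ℝ] SmoothFun n M where
  -- `ι_η J`, with `η` expanded as `(1/m!) ∑ η(Y_L) dx_{L_1} ∧ ⋯ ∧ dx_{L_m}`.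
  toFun η := (m.factorial : ℝ)⁻¹ • ∑ L : Fin m → Fr.ι,
    η.eval (Fr.vf ∘ L) • contract J m k h (Fr.fn ∘ L)
  map_add' η η' := by
    rw [← smul_add, ← Finset.sum_add_distrib]
    exact congrArg _ (Finset.sum_congr rfl fun L _ =>
      add_smul (η.eval (Fr.vf ∘ L)) (η'.eval (Fr.vf ∘ L)) (contract J m k h (Fr.fn ∘ L)))
  map_smul' f η := by
    refine Eq.trans (congrArg _ ?_) (smul_comm _ f _)
    rw [Finset.smul_sum]
    exact Finset.sum_congr rfl fun L _ =>
      mul_smul f (η.eval (Fr.vf ∘ L)) (contract J m k h (Fr.fn ∘ L))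

theorem hodge_apply (Fr : CoordFrame n M) {m k : ℕ} (h : m + k = n) (η : Form n M m)
    (f : Fin k → SmoothFun n M) : hodge J Fr h η f = (m.factorial : ℝ)⁻¹ • ∑ L : Fin m → Fr.ι,
      η.eval (Fr.vf ∘ L) * contract J m k h (Fr.fn ∘ L) f := by
  change (m.factorial : ℝ)⁻¹ • (∑ L : Fin m → Fr.ι,
    η.eval (Fr.vf ∘ L) • contract J m k h (Fr.fn ∘ L)) f = _
  rw [alternatingMap_sum_apply]
  rfl

theorem hodge_apply_apply (Fr : CoordFrame n M) {m k : ℕ} (h : m + k = n) (η : Form n M m)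
    (f : Fin k → SmoothFun n M) (x : M) :
    hodge J Fr h η f x = (m.factorial : ℝ)⁻¹ * ∑ L : Fin m → Fr.ι,
      η.val x (fun b => Fr.vf (L b) x) * contract J m k h (Fr.fn ∘ L) f x := by
  rw [hodge_apply]
  change _ * (∑ L : Fin m → Fr.ι, η.eval (Fr.vf ∘ L) * contract J m k h (Fr.fn ∘ L) f) x = _
  rw [sum_apply]
  rfl

theorem hodge_mem (hJ : IsDualVolume μ J) (Fr : CoordFrame n M) {m k : ℕ} (h : m + k = n)
    (η : Form n M m) : hodge J Fr h η ∈ multiDerSubmodule n M (SmoothFun n M) k := by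
  refine Submodule.smul_mem _ _ (Submodule.sum_mem _ fun L _ f i a b => ?_)
  have := contract_mem_multiDerSubmodule hJ.mem h (Fr.fn ∘ L) f i a b
  simp only [AlternatingMap.smul_apply, this, smul_eq_mul]
  ring

/-- For fixed `f`, the contraction is, up to sign, a multiderivation in `a`, so its frame expansion
is exactly the sum defining `hodge`. In particular the frame disappears from the result. -/
theorem hodge_wedgeDiff [T2Space M] (hJ : IsDualVolume μ J) (Fr : CoordFrame n M) {m k : ℕ}
    (h : m + k = n) (a : Fin m → SmoothFun n M) (f : Fin k → SmoothFun n M) :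
    hodge J Fr h (wedgeDiff a) f = contract J m k h a f := by
  have hA (b : Fin m → SmoothFun n M) : contract J m k h b f =
      (splitSign n m k h • contract J k m (by omega) f) b := contract_swap J h b f
  have hmem : splitSign n m k h • contract J k m (by omega) f ∈
      multiDerSubmodule n M (SmoothFun n M) m :=
    zsmul_mem (contract_mem_multiDerSubmodule hJ.mem _ f) _
  rw [hodge_apply, hA a, inv_smul_eq_iff₀ (Nat.cast_ne_zero.2 m.factorial_ne_zero),
    Nat.cast_smul_eq_nsmul, Fr.factorial_smul_multiDer_apply isGeometric_self hmem]
  refine Finset.sum_congr rfl fun L _ => ?_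
  rw [hA]
  refine congrArg₂ (· * ·) (ContMDiffMap.ext fun x => ?_) rfl
  rw [det_apply_eq_wedgeDiff]
  rfl

/-- One half of the invertibility: contracting `μ` with the multivector field `ι_η J` returns `η`,
up to sign and factorial. The products of contractions of `J` and `μ` are determinants, and
`sum_det_sumElim` sums out `I`. -/
theorem sum_hodge_smul_insert (hJ : IsDualVolume μ J) (Fr : CoordFrame n M) {m k : ℕ}
    (h : m + k = n) (η : Form n M m) :
    ∑ I : Fin k → Fr.ι, hodge J Fr h η (Fr.fn ∘ I) • μ.insert (by omega) (Fr.vf ∘ I) =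
      (splitSign n k m (by omega) * k.factorial : SmoothFun n M) • η := by
  ext x v
  have hc : (splitSign n k m (by omega) * k.factorial : SmoothFun n M) x =
      (splitSign n k m (by omega) : ℝ) * k.factorial := by
    refine (map_mul (ContMDiffMap.evalRingHom x : SmoothFun n M →+* ℝ) _ _).trans ?_
    rw [map_intCast, map_natCast]
  have hm : (m.factorial : ℝ) ≠ 0 := Nat.cast_ne_zero.2 m.factorial_ne_zero
  rw [Form.sum_val, alternatingMap_sum_apply, Form.smul_val, AlternatingMap.smul_apply, hc]
  have h1 (I : Fin k → Fr.ι) : (hodge J Fr h η (Fr.fn ∘ I) •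
      μ.insert (by omega : k + m = n) (Fr.vf ∘ I)).val x v =
      ∑ L : Fin m → Fr.ι, (m.factorial : ℝ)⁻¹ * splitSign n k m (by omega) *
        η.val x (fun b => Fr.vf (L b) x) *
        (Matrix.of fun a b : Fin m ⊕ Fin k => Sum.elim (fun a => diffAt (Fr.fn (L a)) x)
          ((fun i => diffAt (Fr.fn i) x) ∘ I) a (Sum.elim v ((fun i => Fr.vf i x) ∘ I) b)).det := by
    rw [Form.smul_val, AlternatingMap.smul_apply, smul_eq_mul, hodge_apply_apply, mul_assoc,
      Finset.sum_mul, Finset.mul_sum]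
    refine Finset.sum_congr rfl fun L _ => ?_
    have h2 : (μ.insert (by omega : k + m = n) (Fr.vf ∘ I)).val x v =
        splitSign n k m (by omega) * contract (μ.val x) m k h v ((fun i => Fr.vf i x) ∘ I) := by
      rw [← zsmul_eq_mul, ← contract_swap]
      rfl
    have h3 := hJ.contract_mul_contract h (Fr.fn ∘ L) (Fr.fn ∘ I) x v ((fun i => Fr.vf i x) ∘ I)
    change _ = _ * (Matrix.of fun a b : Fin m ⊕ Fin k => Sum.elim
      (fun a => diffAt ((Fr.fn ∘ L) a) x) (fun a => diffAt ((Fr.fn ∘ I) a) x) a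
        (Sum.elim v ((fun i => Fr.vf i x) ∘ I) b)).det
    rw [← h3, h2]
    ring
  have hfin : m + k = Module.finrank ℝ (TangentSpace (𝓡 n) x) :=
    h.trans (finrank_euclideanSpace_fin (𝕜 := ℝ) (n := n)).symm
  rw [Finset.sum_congr rfl fun I _ => h1 I, Finset.sum_comm]
  have h4 (L : Fin m → Fr.ι) := sum_det_sumElim (g := fun i => diffAt (Fr.fn i) x)
    (Fr.sum_diffAt_smul x) hfin (fun a => diffAt (Fr.fn (L a)) x) v
  have h5 := Fr.factorial_mul_form (η.val x) v
  simp only [← Finset.mul_sum]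
  rw [Finset.sum_congr rfl fun L _ => congrArg _ (h4 L), smul_eq_mul]
  refine mul_left_cancel₀ hm ?_
  rw [mul_left_comm, h5, Finset.mul_sum, Finset.mul_sum]
  refine Finset.sum_congr rfl fun L _ => ?_
  have h6 : (wedgeDiff fun b => Fr.fn (L b)).val x v =
    (Matrix.of fun a b : Fin m => diffAt (Fr.fn (L a)) x (v b)).det := by
    rw [← Matrix.det_transpose]
    rfl
  rw [h6]
  field_simp

/-- The other half: contracting `J` with `ι_{Y_1 ⋯ Y_k} μ` returns the multivector field `Y_1 ∧ ⋯ ∧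
Y_k` up to sign. -/
theorem hodge_insert (hJ : IsDualVolume μ J) (Fr : CoordFrame n M) {m k : ℕ}
    (h : m + k = n) (Y : Fin k → VField n M) (f : Fin k → SmoothFun n M) :
    hodge J Fr h (μ.insert (by omega) Y) f =
      splitSign n k m (by omega) • (Matrix.of fun a b => (Y a).apply (f b)).det := by
  ext x
  rw [hodge_apply_apply, inv_mul_eq_iff_eq_mul₀ (Nat.cast_ne_zero.2 m.factorial_ne_zero)]
  have hfin : k + m = Module.finrank ℝ (TangentSpace (𝓡 n) x) :=
    (add_comm k m).trans (h.trans (finrank_euclideanSpace_fin (𝕜 := ℝ) (n := n)).symm)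
  have h4 := sum_det_sumElim (g := fun i => diffAt (Fr.fn i) x)
    (Fr.sum_diffAt_smul x) hfin (fun a => diffAt (f a) x) (fun a => Y a x)
  have h1 (L : Fin m → Fr.ι) : (μ.insert (by omega : k + m = n) Y).val x
      (fun b => Fr.vf (L b) x) * contract J m k h (Fr.fn ∘ L) f x =
      splitSign n k m (by omega) * (Matrix.of fun a b : Fin k ⊕ Fin m =>
        Sum.elim (fun a => diffAt (f a) x)
          ((fun i => diffAt (Fr.fn i) x) ∘ L) a (Sum.elim (fun a => Y a x)
            ((fun i => Fr.vf i x) ∘ L) b)).det := by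
    have h2 : (μ.insert (by omega : k + m = n) Y).val x (fun b => Fr.vf (L b) x) =
        splitSign n k m (by omega) *
          contract (μ.val x) m k h ((fun i => Fr.vf i x) ∘ L) (fun a => Y a x) := by
      rw [← zsmul_eq_mul, ← contract_swap]
      rfl
    have h3 := hJ.contract_mul_contract h (Fr.fn ∘ L) f x ((fun i => Fr.vf i x) ∘ L)
      (fun a => Y a x)
    rw [h2, mul_assoc, mul_comm (contract (μ.val x) m k h _ _), h3,
      ← Matrix.det_submatrix_equiv_self (Equiv.sumComm (Fin k) (Fin m))]
    congr 2
    ext a b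
    rcases a with a | a <;> rcases b with b | b <;> rfl
  have hs : (splitSign n k m (by omega) • (Matrix.of fun a b => (Y a).apply (f b)).det :
      SmoothFun n M) x = splitSign n k m (by omega) *
        (Matrix.of fun a b => diffAt (f a) x (Y b x)).det := by
    refine (map_zsmul (ContMDiffMap.evalRingHom x : SmoothFun n M →+* ℝ) _ _).trans ?_
    rw [zsmul_eq_mul, ← Matrix.det_transpose (Matrix.of _)]
    exact congrArg _ (det_apply _ x)
  rw [Finset.sum_congr rfl fun L _ => h1 L, ← Finset.mul_sum, h4, hs]
  ring

end Star

/-! ### The isomorphism between module-valued forms and multiderivations -/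

section StarIso

variable {n : ℕ} {M : Type*} [TopologicalSpace M] [ChartedSpace (EuclideanSpace ℝ (Fin n)) M]

theorem splitSign_mul_inv_smul {A : Type*} [AddCommGroup A] [Module (SmoothFun n M) A] [Module ℝ A]
    [IsScalarTower ℝ (SmoothFun n M) A] {m k : ℕ} (h : k + m = n) (x : A) :
    ((splitSign n k m h : ℝ) * (k.factorial : ℝ)⁻¹) •
      (splitSign n k m h * k.factorial : SmoothFun n M) • x = x := by
  rw [mul_smul (splitSign n k m h : SmoothFun n M), Int.cast_smul_eq_zsmul,
    Nat.cast_smul_eq_nsmul, ← Nat.cast_smul_eq_nsmul ℝ, ← Int.cast_smul_eq_zsmul ℝ, smul_smul,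
    smul_smul]
  have h1 : (splitSign n k m h : ℝ) * splitSign n k m h = 1 := by
    rw [← Int.cast_mul, splitSign_mul_self, Int.cast_one]
  have h2 : (k.factorial : ℝ) ≠ 0 := Nat.cast_ne_zero.2 k.factorial_ne_zero
  have h3 : (splitSign n k m h : ℝ) * (k.factorial : ℝ)⁻¹ * splitSign n k m h * k.factorial = 1 := by
    field_simp
    rw [pow_two, h1]
  rw [h3, one_smul]

section

variable {W : Type*} [AddCommGroup W] [Module (SmoothFun n M) W] [Module ℝ W]
  [IsScalarTower ℝ (SmoothFun n M) W]

/-- The product of an alternating map with values in functions and an element of a module. -/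
def altSmul {k : ℕ} (A : (SmoothFun n M) [⋀^Fin k]→ₗ[ℝ] SmoothFun n M) (w : W) :
    (SmoothFun n M) [⋀^Fin k]→ₗ[ℝ] W :=
  ((LinearMap.toSpanSingleton (SmoothFun n M) W w).restrictScalars ℝ).compAlternatingMap A

theorem altSmul_apply {k : ℕ} (A : (SmoothFun n M) [⋀^Fin k]→ₗ[ℝ] SmoothFun n M) (w : W)
    (f : Fin k → SmoothFun n M) : altSmul A w f = A f • w := rfl

theorem altSmul_mem {k : ℕ} {A : (SmoothFun n M) [⋀^Fin k]→ₗ[ℝ] SmoothFun n M}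
    (hA : A ∈ multiDerSubmodule n M (SmoothFun n M) k) (w : W) :
    altSmul A w ∈ multiDerSubmodule n M W k := by
  intro f i a b
  simp only [altSmul_apply, hA f i a b, add_smul, smul_eq_mul, mul_smul]

end

variable [IsManifold (𝓡 n) ∞ M] {μ : Form n M n}
  {J : (SmoothFun n M) [⋀^Fin n]→ₗ[ℝ] SmoothFun n M}
  (W : Type*) [AddCommGroup W] [Module (SmoothFun n M) W] [Module ℝ W]
  [IsScalarTower ℝ (SmoothFun n M) W]

/-- The map from `W`-valued `m`-forms to `W`-valued alternating maps of degree `n - m`. -/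
def starAlt (J : (SmoothFun n M) [⋀^Fin n]→ₗ[ℝ] SmoothFun n M) (Fr : CoordFrame n M)
    {m k : ℕ} (h : m + k = n) :
    (W ⊗[SmoothFun n M] Form n M m) →ₗ[SmoothFun n M] (SmoothFun n M) [⋀^Fin k]→ₗ[ℝ] W :=
  TensorProduct.lift <| LinearMap.mk₂ (SmoothFun n M) (fun w η => altSmul (hodge J Fr h η) w)
    (fun w w' η => by ext f; simp only [altSmul_apply, smul_add, AlternatingMap.add_apply])
    (fun c w η => by ext f; simp only [altSmul_apply, AlternatingMap.smul_apply, smul_comm c])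
    (fun w η η' => by
      ext f; simp only [altSmul_apply, map_add, AlternatingMap.add_apply, add_smul])
    (fun c w η => by
      ext f; simp only [altSmul_apply, map_smul, AlternatingMap.smul_apply, smul_assoc])

variable {W}

theorem starAlt_tmul (Fr : CoordFrame n M) {m k : ℕ} (h : m + k = n) (w : W) (η : Form n M m)
    (f : Fin k → SmoothFun n M) : starAlt W J Fr h (w ⊗ₜ η) f = hodge J Fr h η f • w := rfl

theorem starAlt_real_smul (Fr : CoordFrame n M) {m k : ℕ} (h : m + k = n) (c : ℝ)
    (t : W ⊗[SmoothFun n M] Form n M m) :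
    starAlt W J Fr h (c • t) = c • starAlt W J Fr h t := by
  have h1 : c • t = (c • (1 : SmoothFun n M)) • t := by rw [smul_assoc, one_smul]
  ext f
  rw [h1, map_smul, AlternatingMap.smul_apply, AlternatingMap.smul_apply, smul_assoc, one_smul]

theorem starAlt_mem (hJ : IsDualVolume μ J) (Fr : CoordFrame n M) {m k : ℕ} (h : m + k = n)
    (t : W ⊗[SmoothFun n M] Form n M m) :
    starAlt W J Fr h t ∈ multiDerSubmodule n M W k := by
  induction t with
  | zero => rw [map_zero]; exact zero_mem _
  | tmul w η => exact altSmul_mem (hodge_mem hJ Fr h η) w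
  | add s t hs ht => rw [map_add]; exact add_mem hs ht

theorem starAlt_tmul_smul_wedgeDiff [T2Space M] (hJ : IsDualVolume μ J) (Fr : CoordFrame n M)
    {m k : ℕ} (h : m + k = n) (w : W) (f₀ : SmoothFun n M) (a : Fin m → SmoothFun n M)
    (f : Fin k → SmoothFun n M) :
    starAlt W J Fr h (w ⊗ₜ (f₀ • wedgeDiff a)) f = contract J m k h a f • f₀ • w := by
  rw [starAlt_tmul, map_smul, AlternatingMap.smul_apply, hodge_wedgeDiff hJ Fr h, smul_assoc,
    smul_comm]

/-- The inverse of `starAlt` on multiderivations. -/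
def starInv (μ : Form n M n) (Fr : CoordFrame n M) {m k : ℕ} (h : m + k = n)
    (X : (SmoothFun n M) [⋀^Fin k]→ₗ[ℝ] W) : W ⊗[SmoothFun n M] Form n M m :=
  ((splitSign n k m (by omega) : ℝ) * (k.factorial : ℝ)⁻¹) •
    ∑ I : Fin k → Fr.ι, X (Fr.fn ∘ I) ⊗ₜ[SmoothFun n M] μ.insert (by omega) (Fr.vf ∘ I)

theorem starInv_starAlt (hJ : IsDualVolume μ J) (Fr : CoordFrame n M) {m k : ℕ} (h : m + k = n)
    (t : W ⊗[SmoothFun n M] Form n M m) : starInv μ Fr h (starAlt W J Fr h t) = t := by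
  induction t with
  | zero =>
    simp only [starInv, map_zero, AlternatingMap.zero_apply, TensorProduct.zero_tmul,
      Finset.sum_const_zero, smul_zero]
  | tmul w η =>
    simp only [starInv, starAlt_tmul, TensorProduct.smul_tmul]
    rw [← TensorProduct.tmul_sum, sum_hodge_smul_insert hJ Fr h, TensorProduct.tmul_smul,
      splitSign_mul_inv_smul]
  | add s t hs ht =>
    conv_rhs => rw [← hs, ← ht]
    simp only [starInv, map_add, AlternatingMap.add_apply, TensorProduct.add_tmul,
      Finset.sum_add_distrib, smul_add]

/-- Geometricity of `W` enters here: a multiderivation has to be recovered from its values on the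
frame. -/
theorem starAlt_starInv [T2Space M] (hJ : IsDualVolume μ J) (Fr : CoordFrame n M)
    (hW : IsGeometric n M W) {m k : ℕ} (h : m + k = n) {X : (SmoothFun n M) [⋀^Fin k]→ₗ[ℝ] W}
    (hX : X ∈ multiDerSubmodule n M W k) : starAlt W J Fr h (starInv μ Fr h X) = X := by
  ext f
  rw [starInv, starAlt_real_smul, AlternatingMap.smul_apply, map_sum, alternatingMap_sum_apply]
  simp only [starAlt_tmul, hodge_insert hJ Fr h, smul_assoc]
  rw [← Finset.smul_sum]
  have h2 := Fr.factorial_smul_multiDer_apply hW hX f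
  simp only [Function.comp_apply]
  rw [← h2]
  rw [← Int.cast_smul_eq_zsmul (SmoothFun n M), ← Nat.cast_smul_eq_nsmul (SmoothFun n M),
    ← mul_smul, splitSign_mul_inv_smul]

/-- The isomorphism between `W`-valued `m`-forms and `W`-valued multiderivations of degree
`n - m`. -/
def starEquiv [T2Space M] (hJ : IsDualVolume μ J) (Fr : CoordFrame n M)
    (hW : IsGeometric n M W) {m k : ℕ} (h : m + k = n) :
    (W ⊗[SmoothFun n M] Form n M m) ≃ₗ[ℝ] MultiDer n M W k where
  toFun t := ⟨starAlt W J Fr h t, starAlt_mem hJ Fr h t⟩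
  invFun X := starInv μ Fr h X.1
  left_inv t := starInv_starAlt hJ Fr h t
  right_inv X := Subtype.ext (starAlt_starInv hJ Fr hW h X.2)
  map_add' s t := Subtype.ext (map_add _ s t)
  map_smul' c t := Subtype.ext (starAlt_real_smul Fr h c t)

end StarIso

/-! ### Cartan formulas for the cochain differential -/

section Cartan

variable {n : ℕ} {M : Type*} [TopologicalSpace M] [ChartedSpace (EuclideanSpace ℝ (Fin n)) M]
  {P : PoissonStructure n M}

theorem pairSum_map (P : PoissonStructure n M) {A B : Type*} [AddCommGroup A] [AddCommGroup B]
    (L : A →+ B) (r : ℕ) (Φ : (Fin r → SmoothFun n M) → A) (f : Fin (r + 1) → SmoothFun n M) :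
    pairSum P r (fun g => L (Φ g)) f = L (pairSum P r Φ f) := by
  cases r with
  | zero => simp only [pairSum, map_zero]
  | succ r =>
    simp only [pairSum, map_sum]
    refine Finset.sum_congr rfl fun j _ => Finset.sum_congr rfl fun i _ => ?_
    split_ifs
    · rw [map_zsmul]
    · rw [map_zero]

section

variable {W : Type*} [AddCommGroup W] [Module ℝ W]

theorem map_cons_cons_swap {V : Type*} [AddCommGroup V] [Module ℝ V] {r : ℕ}
    (X : V [⋀^Fin (r + 2)]→ₗ[ℝ] W) (x y : V) (f : Fin r → V) :
    X (Fin.cons x (Fin.cons y f)) = -X (Fin.cons y (Fin.cons x f)) := by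
  have h := X.map_swap (Fin.cons y (Fin.cons x f)) (i := 0) (j := 1) (by simp)
  rw [← h]
  congr 1
  funext i
  refine Fin.cases ?_ (fun i => Fin.cases ?_ (fun i => ?_) i) i
  · rw [Function.comp_apply, Equiv.swap_apply_left]; rfl
  · rw [Function.comp_apply, Fin.succ_zero_eq_one, Equiv.swap_apply_right]; rfl
  · rw [Function.comp_apply, Equiv.swap_apply_of_ne_of_ne (Fin.succ_ne_zero _)]
    · rfl
    · exact fun h => Fin.succ_ne_zero i (Fin.succ_injective _ h)

/-- The pairs that contain `g` give the slotwise action of `g`. In the others both indices shift by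
one, which keeps the sign, and moving `g` in front of the bracket costs one transposition. -/
theorem pairSum_cons {r : ℕ} (X : (SmoothFun n M) [⋀^Fin (r + 1)]→ₗ[ℝ] W) (g : SmoothFun n M)
    (f : Fin (r + 1) → SmoothFun n M) :
    pairSum P (r + 1) X (Fin.cons g f : Fin (r + 2) → SmoothFun n M) =
      ∑ j, X (Function.update f j (P.bracket (f j) g)) - pairSum P r (X.curryLeft g) f := by
  have h1 (j : Fin (r + 1)) : X (Function.update f j (P.bracket (f j) g)) =
      (-1 : ℤ) ^ (0 + ((j : ℕ) + 1)) • X (Fin.cons (P.bracket g (f j)) (j.removeNth f)) := by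
    rw [P.bracket_swap (f j) g, X.map_update_neg, alternatingMap_update, zero_add, pow_succ,
      mul_neg_one, neg_smul]
  rw [Finset.sum_congr rfl fun j _ => h1 j, pairSum, Fin.sum_univ_succ]
  have h0 : ∑ i : Fin (r + 1), (if i.castSucc < (0 : Fin (r + 2)) then
      (-1 : ℤ) ^ ((i : ℕ) + ((0 : Fin (r + 2)) : ℕ)) •
      X (Fin.cons (P.bracket ((Fin.cons g f : Fin (r + 2) → SmoothFun n M) i.castSucc)
        ((Fin.cons g f : Fin (r + 2) → SmoothFun n M) 0))
        (Fin.removeNth i (Fin.removeNth 0 (Fin.cons g f : Fin (r + 2) → SmoothFun n M))))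
        else 0) = 0 :=
    Finset.sum_eq_zero fun i _ => if_neg (Fin.not_lt_zero _)
  rw [h0, zero_add]
  have hfirst (j : Fin (r + 1)) : (if (0 : Fin (r + 1)).castSucc < j.succ then
      (-1 : ℤ) ^ (((0 : Fin (r + 1)) : ℕ) + ((j.succ : Fin (r + 2)) : ℕ)) •
      X (Fin.cons (P.bracket ((Fin.cons g f : Fin (r + 2) → SmoothFun n M)
        (0 : Fin (r + 1)).castSucc) ((Fin.cons g f : Fin (r + 2) → SmoothFun n M) j.succ))
        (Fin.removeNth 0 (Fin.removeNth j.succ (Fin.cons g f : Fin (r + 2) → SmoothFun n M))))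
        else 0) =
      (-1 : ℤ) ^ (0 + ((j : ℕ) + 1)) • X (Fin.cons (P.bracket g (f j)) (j.removeNth f)) := by
    rw [if_pos (show (0 : Fin (r + 1)).castSucc < j.succ from Fin.succ_pos j), removeNth_succ_cons]
    rfl
  cases r with
  | zero =>
    rw [pairSum, sub_zero]
    refine Finset.sum_congr rfl fun j _ => ?_
    rw [← hfirst j]
    exact Fin.sum_univ_one _
  | succ r =>
    rw [pairSum, ← Finset.sum_sub_distrib]
    refine Finset.sum_congr rfl fun j _ => ?_
    rw [Fin.sum_univ_succ, hfirst, sub_eq_add_neg, ← Finset.sum_neg_distrib]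
    congr 1
    refine Finset.sum_congr rfl fun i _ => ?_
    have hlt : i.succ.castSucc < j.succ ↔ i.castSucc < j := by
      rw [← Fin.succ_castSucc, Fin.succ_lt_succ_iff]
    rw [removeNth_succ_cons, removeNth_succ_cons, map_cons_cons_swap, ← Fin.succ_castSucc,
      Fin.cons_succ, Fin.cons_succ]
    simp only [Fin.succ_lt_succ_iff]
    split_ifs
    · rw [smul_neg]
      refine congrArg Neg.neg (congrArg₂ (· • ·) ?_ rfl)
      rw [Fin.val_succ, Fin.val_succ]
      ring
    · rw [neg_zero]

end

section

variable {W : Type*} [AddCommGroup W] [Module (SmoothFun n M) W] [Module ℝ W]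

/-- The Poisson cochain differential on alternating maps. -/
def PoissonModule.cob (V : PoissonModule P W) {r : ℕ} (X : (SmoothFun n M) [⋀^Fin r]→ₗ[ℝ] W)
    (f : Fin (r + 1) → SmoothFun n M) : W :=
  (∑ i : Fin (r + 1), (-1 : ℤ) ^ ((i : ℕ) + 1) • V.act (X (Fin.removeNth i f)) (f i)) +
      pairSum P r X f

/-- Cartan's formula: `δ ι_g + ι_g δ` is, up to sign, the Lie derivative along `g`. -/
theorem PoissonModule.cob_curryLeft (V : PoissonModule P W) {r : ℕ}
    (X : (SmoothFun n M) [⋀^Fin (r + 1)]→ₗ[ℝ] W) (g : SmoothFun n M)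
    (f : Fin (r + 1) → SmoothFun n M) :
    V.cob (X.curryLeft g) f = -V.cob X (Fin.cons g f : Fin (r + 2) → SmoothFun n M) -
      V.act (X f) g + ∑ j, X (Function.update f j (P.bracket (f j) g)) := by
  rw [cob, cob, pairSum_cons, Fin.sum_univ_succ (n := r + 1)]
  have h1 (i : Fin (r + 1)) : (-1 : ℤ) ^ ((i.succ : ℕ) + 1) • V.act
      (X (i.succ.removeNth (Fin.cons g f : Fin (r + 2) → SmoothFun n M)))
        ((Fin.cons g f : Fin (r + 2) → SmoothFun n M) i.succ) =
      -((-1 : ℤ) ^ ((i : ℕ) + 1) • V.act (X.curryLeft g (i.removeNth f)) (f i)) := by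
    rw [removeNth_succ_cons, Fin.cons_succ, Fin.val_succ, pow_succ, mul_neg_one, neg_smul]
    rfl
  have h0 : (-1 : ℤ) ^ (((0 : Fin (r + 2)) : ℕ) + 1) • V.act
      (X (Fin.removeNth 0 (Fin.cons g f : Fin (r + 2) → SmoothFun n M)))
        ((Fin.cons g f : Fin (r + 2) → SmoothFun n M) 0) = -V.act (X f) g := by
    rw [Fin.val_zero, zero_add, pow_one, neg_one_smul]
    rfl
  rw [Finset.sum_congr rfl fun i _ => h1 i, h0, Finset.sum_neg_distrib]
  abel

theorem PoissonModule.isDer_act (V : PoissonModule P W) (w : W) : IsDer (V.act w) := fun a b => by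
  rw [V.act_mul, add_comm]

end

variable {J : (SmoothFun n M) [⋀^Fin n]→ₗ[ℝ] SmoothFun n M}

/-- The modular identity for `J`, with its sum over `n` slots split into the two blocks of the
contraction. -/
theorem PoissonStructure.IsModularFor.contract {θ : SmoothFun n M → SmoothFun n M}
    (hθ : P.IsModularFor J θ) {m k : ℕ} (h : m + k = n) (g : Fin m → SmoothFun n M)
    (f : Fin k → SmoothFun n M) (x : SmoothFun n M) :
    P.bracket (contract J m k h g f) x + θ x * contract J m k h g f =
      ∑ l, PoissonDuality.contract J m k h (Function.update g l (P.bracket (g l) x)) f +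
        ∑ j, PoissonDuality.contract J m k h g (Function.update f j (P.bracket (f j) x)) := by
  have h1 := hθ (Sum.elim g f ∘ splitEquiv n m k h) x
  rw [← (splitEquiv n m k h).symm.sum_comp, Fintype.sum_sum_type] at h1
  have h2 (s : Fin m ⊕ Fin k) (z : SmoothFun n M) :
      Function.update (Sum.elim g f ∘ splitEquiv n m k h) ((splitEquiv n m k h).symm s) z =
        Function.update (Sum.elim g f) s z ∘ splitEquiv n m k h :=
    (Function.update_comp_equiv _ _ _ _).symm
  simp only [h2, Sum.update_elim_inl, Sum.update_elim_inr, Function.comp_apply,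
    Equiv.apply_symm_apply, Sum.elim_inl, Sum.elim_inr, ← contract_apply] at h1
  linear_combination h1

/-- `pairSum_cons` for the inserted functions, which `contract_swap` turns into the arguments of an
alternating map. On the right, `x` has moved to the other block. -/
theorem pairSum_contract_cons {m k : ℕ} (h : m + 1 + (k + 1) = n) (x : SmoothFun n M)
    (g : Fin (m + 1) → SmoothFun n M) (f : Fin (k + 1) → SmoothFun n M) :
    pairSum P (m + 1) (fun g' => contract J (m + 1) (k + 1) h g' f)
      (Fin.cons x g : Fin (m + 2) → SmoothFun n M) =
      ∑ l, contract J (m + 1) (k + 1) h (Function.update g l (P.bracket (g l) x)) f -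
        pairSum P m (fun g' => contract J m (k + 2) (by omega) g'
          (Fin.cons x f : Fin (k + 2) → SmoothFun n M)) g := by
  let A : (SmoothFun n M) [⋀^Fin (m + 1)]→ₗ[ℝ] SmoothFun n M :=
    splitSign n (m + 1) (k + 1) h • contract J (k + 1) (m + 1) (by omega) f
  have hA : ⇑A = fun g' => contract J (m + 1) (k + 1) h g' f :=
    funext fun g' => (contract_swap J h g' f).symm
  have h1 := pairSum_cons (P := P) A x g
  have h2 : ⇑(A.curryLeft x) = fun g' => contract J m (k + 2) (by omega) g'
      (Fin.cons x f : Fin (k + 2) → SmoothFun n M) :=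
    funext fun g' => congrFun hA (Fin.cons x g')
  rw [h2, hA] at h1
  exact h1

end Cartan

/-! ### The star map intertwines the two differentials -/

section Intertwining

variable {n : ℕ} {M : Type*} [TopologicalSpace M] [ChartedSpace (EuclideanSpace ℝ (Fin n)) M]
  {P : PoissonStructure n M} {J : (SmoothFun n M) [⋀^Fin n]→ₗ[ℝ] SmoothFun n M}

/-- The alternating sum `∑ (-1)^i {J(…, f̂_i, …), f_i}` as an alternating map. -/
def PoissonStructure.altBracket (P : PoissonStructure n M)
    (J : (SmoothFun n M) [⋀^Fin n]→ₗ[ℝ] SmoothFun n M) :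
    (SmoothFun n M) [⋀^Fin (n + 1)]→ₗ[ℝ] SmoothFun n M :=
  AlternatingMap.alternatizeUncurryFin
    { toFun := fun z => (P.bracketRight z).compAlternatingMap J
      map_add' := fun a b => AlternatingMap.ext fun f => P.bracket_add_right (J f) a b
      map_smul' := fun c a => AlternatingMap.ext fun f => P.bracket_smul_right c (J f) a }

theorem PoissonStructure.altBracket_apply (f : Fin (n + 1) → SmoothFun n M) :
    P.altBracket J f =
      ∑ i : Fin (n + 1), (-1 : ℤ) ^ (i : ℕ) • P.bracket (J (i.removeNth f)) (f i) :=
  AlternatingMap.alternatizeUncurryFin_apply _ _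

theorem PoissonStructure.altBracket_cons (z : SmoothFun n M) (f : Fin n → SmoothFun n M) :
    P.altBracket J (Fin.cons z f) =
      P.bracket (J f) z - ∑ i, P.bracket (J (Function.update f i z)) (f i) := by
  rw [altBracket_apply, Fin.sum_univ_succ, Fin.val_zero, pow_zero, one_smul, Fin.cons_zero,
    sub_eq_add_neg, ← Finset.sum_neg_distrib]
  congr 1
  refine Finset.sum_congr rfl fun j _ => ?_
  obtain ⟨q, rfl⟩ : ∃ q, n = q + 1 := ⟨n - 1, by have := j.pos; omega⟩
  rw [alternatingMap_update, Fin.cons_succ, removeNth_succ_cons, Fin.val_succ, pow_succ,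
    mul_neg_one, neg_smul]
  exact congrArg Neg.neg (map_zsmul (P.bracketRight (f j)) _ _).symm

section

variable {W : Type*} [AddCommGroup W] [Module (SmoothFun n M) W] [Module ℝ W]
  [IsScalarTower ℝ (SmoothFun n M) W]

theorem pairSum_altSmul {k : ℕ} (A : (SmoothFun n M) [⋀^Fin k]→ₗ[ℝ] SmoothFun n M) (w : W)
    (f : Fin (k + 1) → SmoothFun n M) : pairSum P k (altSmul A w) f = pairSum P k A f • w :=
  pairSum_map P (LinearMap.toSpanSingleton (SmoothFun n M) W w).toAddMonoidHom k A f

variable [IsManifold (𝓡 n) ∞ M]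

theorem PoissonModule.twist_act (V : PoissonModule P W) {φ : VField n M}
    (hφ : P.IsPoissonField φ) (w : W) (f : SmoothFun n M) :
    (V.twist φ hφ).act w f = V.act w f + φ.apply f • w := rfl

theorem PoissonModule.twist_act_smul (V : PoissonModule P W) {φ : VField n M}
    (hφ : P.IsPoissonField φ) (c : SmoothFun n M) (w : W) (f : SmoothFun n M) :
    (V.twist φ hφ).act (c • w) f =
      c • V.act w f + (P.bracket c f + φ.apply f * c) • w := by
  rw [twist_act, V.act_smul, add_smul, mul_smul, add_assoc]

/-- The point where the twist is needed: the term `φ(x)` in the bracket of `W_φ` completes `{c, x}`,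
with `c` the contraction, to the modular identity. Its half over the slots of `f` cancels the slot
sum in Cartan's formula, leaving the half over the slots of `g`. -/
theorem cob_contract_cons {φ : VField n M} (hφ : P.IsModularFor J φ.apply)
    (hφP : P.IsPoissonField φ) (V : PoissonModule P W) {m k : ℕ} (h : m + (k + 1) = n) (w : W)
    (x : SmoothFun n M) (g : Fin m → SmoothFun n M) (f : Fin (k + 1) → SmoothFun n M) :
    (V.twist φ hφP).cob (altSmul (contract J (m + 1) k (by omega)
      (Fin.cons x g : Fin (m + 1) → SmoothFun n M)) w) f =
      -(V.twist φ hφP).cob (altSmul (contract J m (k + 1) h g) w)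
        (Fin.cons x f : Fin (k + 2) → SmoothFun n M) -
      contract J m (k + 1) h g f • V.act w x -
      (∑ l, contract J m (k + 1) h (Function.update g l (P.bracket (g l) x)) f) • w := by
  refine ((V.twist φ hφP).cob_curryLeft (altSmul (contract J m (k + 1) h g) w) x f).trans ?_
  have h1 := hφ.contract h g f x
  simp only [altSmul_apply, V.twist_act_smul]
  rw [h1, ← Finset.sum_smul, add_smul]
  abel

end

variable [IsManifold (𝓡 n) ∞ M] [T2Space M] {μ : Form n M n}

/-- It is skew in `n + 1` arguments, so it vanishes once it is a multiderivation. The defects in the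
Leibniz rule sum to `J(f) ({a, b} + {b, a}) = 0`. -/
theorem altBracket_eq_zero (hJ : IsDualVolume μ J) (hμ : IsVolumeForm μ) (Fr : CoordFrame n M) :
    P.altBracket J = 0 := by
  refine Fr.multiDer_eq_zero isGeometric_self n.lt_succ_self (mem_multiDerSubmodule_iff.2 ?_)
  intro f a b
  have h1 (i : Fin n) : P.bracket (J (Function.update f i (a * b))) (f i) =
      a * P.bracket (J (Function.update f i b)) (f i) +
        J (Function.update f i b) • P.selfModule.act a (f i) +
      (b * P.bracket (J (Function.update f i a)) (f i) +
        J (Function.update f i a) • P.selfModule.act b (f i)) := by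
    rw [hJ.mem, smul_eq_mul, smul_eq_mul, P.bracket_add_left, P.bracket_mul_left,
      P.bracket_mul_left]
    rfl
  rw [P.altBracket_cons, P.altBracket_cons, P.altBracket_cons, Finset.sum_congr rfl fun i _ => h1 i,
    Finset.sum_add_distrib, Finset.sum_add_distrib, Finset.sum_add_distrib, ← Finset.mul_sum,
    ← Finset.mul_sum, hJ.sum_update_smul hμ Fr isGeometric_self (P.selfModule.isDer_act a),
    hJ.sum_update_smul hμ Fr isGeometric_self (P.selfModule.isDer_act b), P.bracket_mul_right]
  have h2 : P.selfModule.act b a = -P.selfModule.act a b := P.bracket_swap b a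
  rw [h2]
  simp only [smul_eq_mul]
  ring

/-- The alternating sum over `i` of the modular identity at `f_i` has right-hand side `J ∧ φ` plus
`altBracket`, both zero. On the left each pair `{f_i, f_j}` occurs twice, so twice the sum in
question vanishes. -/
theorem pairSum_dualVolume (hJ : IsDualVolume μ J) (hμ : IsVolumeForm μ) (Fr : CoordFrame n M)
    {φ : VField n M} (hφ : P.IsModularFor J φ.apply) (f : Fin (n + 1) → SmoothFun n M) :
    pairSum P n J f = 0 := by
  have h1 (i : Fin (n + 1)) : ∑ j, J (Function.update (i.removeNth f) j
      (P.bracket (i.removeNth f j) (f i))) =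
        J (i.removeNth f) • φ.applyLinear (f i) + P.bracket (J (i.removeNth f)) (f i) :=
    eq_add_of_sub_eq (hφ _ _).symm
  have h2 : ∑ i : Fin (n + 1), (-1 : ℤ) ^ (i : ℕ) • ∑ j, J (Function.update (i.removeNth f) j
      (P.bracket (i.removeNth f j) (f i))) = 0 := by
    simp only [h1, smul_add, Finset.sum_add_distrib]
    rw [hJ.alternating_sum_eq_zero hμ Fr isGeometric_self φ.isDer_applyLinear,
      ← P.altBracket_apply, altBracket_eq_zero hJ hμ Fr, zero_add, AlternatingMap.zero_apply]
  obtain _ | q := n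
  · rfl
  -- Alternating `F` in both variables produces the left-hand side. The general formula for a double
  -- alternation involves `F(x, y) - F(y, x)`, which is `2 F(x, y)` by skew-symmetry of the bracket.
  let F : SmoothFun (q + 1) M →ₗ[ℝ] SmoothFun (q + 1) M →ₗ[ℝ]
      (SmoothFun (q + 1) M) [⋀^Fin q]→ₗ[ℝ] SmoothFun (q + 1) M :=
    LinearMap.mk₂ ℝ (fun x y => J.curryLeft (P.bracket y x))
      (fun x x' y => by rw [P.bracket_add_right, map_add])
      (fun c x y => by rw [P.bracket_smul_right, map_smul])
      (fun x y y' => by rw [P.bracket_add_left, map_add])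
      (fun c x y => by rw [P.bracket_smul_left, map_smul])
  have h3 := AlternatingMap.alternatizeUncurryFin_alternatizeUncurryFinLM_comp_apply F f
  have h4 : AlternatingMap.alternatizeUncurryFin
      (AlternatingMap.alternatizeUncurryFinLM ∘ₗ F) f = 0 := by
    rw [AlternatingMap.alternatizeUncurryFin_apply, ← h2]
    refine Finset.sum_congr rfl fun i _ => congrArg _ ?_
    refine (AlternatingMap.alternatizeUncurryFin_apply (F (f i)) _).trans
      (Finset.sum_congr rfl fun j _ => ?_)
    rw [alternatingMap_update]
    rfl
  have h5 : (∑ i : Fin (q + 1), ∑ j ≥ i, (-1 : ℤ) ^ ((i : ℕ) + j) •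
      (F (f i.castSucc) (f j.succ) (j.removeNth <| i.castSucc.removeNth f) -
        F (f j.succ) (f i.castSucc) (j.removeNth <| i.castSucc.removeNth f))) =
      (2 : ℝ) • pairSum P (q + 1) J f := by
    rw [pairSum, Fin.sum_univ_succ (n := q + 1), Finset.sum_eq_zero fun i _ => if_neg (Fin.not_lt_zero _),
      zero_add, Finset.sum_comm, Finset.smul_sum]
    refine Finset.sum_congr rfl fun i _ => ?_
    rw [Finset.smul_sum, ← Finset.sum_filter_add_sum_filter_not Finset.univ (fun j => i ≤ j)]
    have e0 : ∑ j with ¬ i ≤ j, (2 : ℝ) • (if i.castSucc < j.succ then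
        (-1 : ℤ) ^ ((i : ℕ) + ((j.succ : Fin (q + 2)) : ℕ)) •
          J (Fin.cons (P.bracket (f i.castSucc) (f j.succ))
            (Fin.removeNth i (Fin.removeNth j.succ f))) else 0) = 0 := by
      refine Finset.sum_eq_zero fun j hj => ?_
      rw [if_neg, smul_zero]
      rw [Finset.mem_filter] at hj
      rw [Fin.castSucc_lt_succ_iff]
      exact hj.2
    rw [e0, add_zero]
    refine Finset.sum_congr (by ext; simp) fun j hj => ?_
    have hij : i ≤ j := by simpa using hj
    have e1 : Fin.removeNth i (Fin.removeNth j.succ f) = j.removeNth (i.castSucc.removeNth f) := by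
      rw [Fin.removeNth_removeNth_eq_swap f i j.succ, Fin.predAbove_of_castSucc_lt _ _
        (Fin.castSucc_lt_succ_iff.2 hij), Fin.pred_succ, Fin.succAbove_of_castSucc_lt _ _
        (Fin.castSucc_lt_succ_iff.2 hij)]
    rw [if_pos (Fin.castSucc_lt_succ_iff.2 hij), e1]
    have e2 (x y : SmoothFun (q + 1) M) (r) : F x y r = J (Fin.cons (P.bracket y x) r) := rfl
    have e3 (x y : SmoothFun (q + 1) M) (r : Fin q → SmoothFun (q + 1) M) :
        J (Fin.cons (P.bracket y x) r) = -J (Fin.cons (P.bracket x y) r) := by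
      rw [P.bracket_swap y x]
      exact congrArg (fun A => A r) (map_neg J.curryLeft (P.bracket x y))
    rw [e2, e2, e3 (f i.castSucc), Fin.val_succ, ← add_assoc, pow_succ, mul_neg_one, neg_smul,
      two_smul, smul_sub, smul_neg]
    abel
  rw [← h3, h4] at h5
  exact (smul_eq_zero.1 h5.symm).resolve_left two_ne_zero

variable {W : Type*} [AddCommGroup W] [Module (SmoothFun n M) W] [Module ℝ W]
  [IsScalarTower ℝ (SmoothFun n M) W]

/-- The start of the induction. The expression splits into `J ∧ {w, -}`, `J ∧ φ`, `altBracket` and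
the sum over pairs, each of which vanishes for reasons of degree. -/
theorem cob_altSmul_dualVolume (hJ : IsDualVolume μ J) (hμ : IsVolumeForm μ)
    (Fr : CoordFrame n M) {φ : VField n M} (hφ : P.IsModularFor J φ.apply)
    (hφP : P.IsPoissonField φ) (hW : IsGeometric n M W) (V : PoissonModule P W) (w : W) (f : Fin (n + 1) → SmoothFun n M) :
    (V.twist φ hφP).cob (altSmul J w) f = 0 := by
  rw [PoissonModule.cob, pairSum_altSmul, pairSum_dualVolume hJ hμ Fr hφ, zero_smul, add_zero]
  have h1 := hJ.alternating_sum_eq_zero hμ Fr hW (V.isDer_act w) f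
  have h2 := hJ.alternating_sum_eq_zero hμ Fr isGeometric_self φ.isDer_applyLinear f
  have h3 : P.altBracket J f = 0 := by rw [altBracket_eq_zero hJ hμ Fr, AlternatingMap.zero_apply]
  rw [P.altBracket_apply] at h3
  have h4 (i : Fin (n + 1)) : (-1 : ℤ) ^ ((i : ℕ) + 1) •
      (V.twist φ hφP).act (altSmul J w (i.removeNth f)) (f i) =
      -((-1 : ℤ) ^ (i : ℕ) • J (i.removeNth f) • V.act w (f i) +
        ((-1 : ℤ) ^ (i : ℕ) • P.bracket (J (i.removeNth f)) (f i) +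
          (-1 : ℤ) ^ (i : ℕ) • J (i.removeNth f) • φ.applyLinear (f i)) • w) := by
    rw [altSmul_apply, V.twist_act_smul, pow_succ, mul_neg_one, neg_smul, smul_add,
      ← smul_add (_ : ℤ) (_ : SmoothFun n M), smul_assoc, smul_eq_mul (J _),
      mul_comm (φ.apply (f i))]
    rfl
  rw [Finset.sum_congr rfl fun i _ => h4 i, Finset.sum_neg_distrib, Finset.sum_add_distrib,
    ← Finset.sum_smul, Finset.sum_add_distrib, h1, h2, h3, zero_add, add_zero, zero_smul, neg_zero]

/-- The right-hand side is minus the star of `∂(w ⊗ dg_0 ∧ ⋯ ∧ dg_m)`. Each inductive step moves the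
first of the `g` to the front of `f`, by Cartan's formula on the left and `pairSum_contract_cons` on
the right. -/
theorem cob_altSmul_contract (hJ : IsDualVolume μ J) (hμ : IsVolumeForm μ)
    (Fr : CoordFrame n M) {φ : VField n M} (hφ : P.IsModularFor J φ.apply)
    (hφP : P.IsPoissonField φ) (hW : IsGeometric n M W) (V : PoissonModule P W) {m k : ℕ}
    (h : m + 1 + k = n) (w : W) (g : Fin (m + 1) → SmoothFun n M)
    (f : Fin (k + 1) → SmoothFun n M) :
    (V.twist φ hφP).cob (altSmul (contract J (m + 1) k h g) w) f =
      -((∑ l : Fin (m + 1), (-1 : ℤ) ^ (l : ℕ) •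
          contract J m (k + 1) (by omega) (l.removeNth g) f • V.act w (g l)) +
        pairSum P m (fun g' => contract J m (k + 1) (by omega) g' f) g • w) := by
  induction m generalizing k with
  | zero =>
    rw [← Fin.cons_self_tail g, cob_contract_cons hφ hφP V (by omega)]
    have h0 : (V.twist φ hφP).cob (altSmul (contract J 0 (k + 1) (by omega) (Fin.tail g)) w)
        (Fin.cons (g 0) f : Fin (k + 2) → SmoothFun n M) = 0 := by
      -- With nothing left to insert, the contraction is `J` itself.
      obtain rfl : n = k + 1 := by omega
      exact cob_altSmul_dualVolume hJ hμ Fr hφ hφP hW V w _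
    rw [h0, Fin.sum_univ_one, Fin.val_zero, pow_zero, one_smul, Finset.univ_eq_empty,
      Finset.sum_empty, zero_smul, sub_zero, neg_zero, zero_sub, pairSum, zero_smul, add_zero]
    rfl
  | succ m ih =>
    rw [← Fin.cons_self_tail g, cob_contract_cons hφ hφP V (by omega), ih,
      pairSum_contract_cons, Fin.sum_univ_succ (n := m + 1)]
    have h1 (l : Fin (m + 1)) : (-1 : ℤ) ^ ((l.succ : Fin (m + 2)) : ℕ) •
        contract J (m + 1) (k + 1) (by omega) (l.succ.removeNth
          (Fin.cons (g 0) (Fin.tail g) : Fin (m + 2) → SmoothFun n M)) f •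
          V.act w ((Fin.cons (g 0) (Fin.tail g) : Fin (m + 2) → SmoothFun n M) l.succ) =
        -((-1 : ℤ) ^ (l : ℕ) • contract J m (k + 2) (by omega) (l.removeNth (Fin.tail g))
          (Fin.cons (g 0) f : Fin (k + 2) → SmoothFun n M) • V.act w (Fin.tail g l)) := by
      rw [removeNth_succ_cons, Fin.val_succ, pow_succ, mul_neg_one, neg_smul]
      rfl
    rw [Finset.sum_congr rfl fun l _ => h1 l, Finset.sum_neg_distrib, sub_smul, Fin.val_zero,
      pow_zero, one_smul]
    have h2 : Fin.removeNth 0 (Fin.cons (g 0) (Fin.tail g) : Fin (m + 2) → SmoothFun n M) =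
      Fin.tail g := rfl
    rw [h2, Fin.cons_zero]
    abel

end Intertwining

/-! ### Existence of the chain differential, and passage to homology -/

section Duality

theorem nonempty_quotient_equiv {A B : Type*} [AddCommGroup A] [Module ℝ A] [AddCommGroup B]
    [Module ℝ B] (e : A ≃ₗ[ℝ] B) {Z N : Submodule ℝ A} {Z' N' : Submodule ℝ B}
    (hZ : ∀ t, t ∈ Z ↔ e t ∈ Z') (hN : ∀ t, t ∈ N ↔ e t ∈ N') :
    Nonempty ((Z ⧸ N.submoduleOf Z) ≃ₗ[ℝ] (Z' ⧸ N'.submoduleOf Z')) := by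
  have h1 : Z.map (e : A →ₗ[ℝ] B) = Z' := by
    ext y
    rw [Submodule.mem_map_equiv, hZ, e.apply_symm_apply]
  refine ⟨Submodule.Quotient.equiv _ _ (e.ofSubmodules Z Z' h1) ?_⟩
  ext y
  rw [Submodule.mem_map_equiv]
  simp only [Submodule.submoduleOf, Submodule.mem_comap, Submodule.subtype_apply]
  rw [hN]
  have h2 : e ((e.ofSubmodules Z Z' h1).symm y : A) = y := by
    rw [LinearEquiv.ofSubmodules_symm_apply, e.apply_symm_apply]
  rw [h2]

theorem multiDer_toFun_injective {n : ℕ} {M : Type*} [TopologicalSpace M]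
    [ChartedSpace (EuclideanSpace ℝ (Fin n)) M] {W : Type*} [AddCommGroup W]
    [Module (SmoothFun n M) W] [Module ℝ W] [IsScalarTower ℝ (SmoothFun n M) W] (k : ℕ) : Function.Injective (MultiDer.toFun n M W k) :=
  fun _ _ h => Subtype.ext (AlternatingMap.ext fun z => congrFun h z)

variable {n : ℕ} {M : Type*} [TopologicalSpace M] [ChartedSpace (EuclideanSpace ℝ (Fin n)) M]
  [IsManifold (𝓡 n) ∞ M]

theorem CoordFrame.form_eq_sum (Fr : CoordFrame n M) {m : ℕ} (η : Form n M m) :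
    η = ∑ I : Fin m → Fr.ι, ((m.factorial : ℝ)⁻¹ • η.eval (Fr.vf ∘ I)) •
      wedgeDiff (Fr.fn ∘ I) := by
  ext x v
  have h1 := Fr.factorial_mul_form (η.val x) v
  have hm : (m.factorial : ℝ) ≠ 0 := Nat.cast_ne_zero.2 m.factorial_ne_zero
  rw [Form.sum_val, alternatingMap_sum_apply]
  refine mul_left_cancel₀ hm ?_
  rw [h1, Finset.mul_sum]
  refine Finset.sum_congr rfl fun I _ => ?_
  change _ = (m.factorial : ℝ) * ((m.factorial : ℝ)⁻¹ * η.val x (fun b => Fr.vf (I b) x) *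
    (wedgeDiff (Fr.fn ∘ I)).val x v)
  rw [← mul_assoc, mul_inv_cancel_left₀ hm, mul_comm]
  rfl

theorem subsingleton_tensor {W : Type*} [AddCommGroup W] [Module (SmoothFun n M) W]
    {m : ℕ} (h : n < m) :
    Subsingleton (W ⊗[SmoothFun n M] Form n M m) := by
  refine subsingleton_of_forall_eq 0 fun t => ?_
  induction t with
  | zero => rfl
  | add s t hs ht => rw [hs, ht, add_zero]
  | tmul w η => rw [Form.eq_zero h η, TensorProduct.tmul_zero]

variable {P : PoissonStructure n M} {W : Type*} [AddCommGroup W] [Module (SmoothFun n M) W]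
  [Module ℝ W] [IsScalarTower ℝ (SmoothFun n M) W]

/-- The span is over `ℝ` because the chain differential is only `ℝ`-linear; the factor `f₀` absorbs
the smooth coefficients. -/
theorem CoordFrame.span_tmul_wedgeDiff (Fr : CoordFrame n M) (m : ℕ) :
    Submodule.span ℝ {t : W ⊗[SmoothFun n M] Form n M m | ∃ (w : W) (f₀ : SmoothFun n M)
      (f : Fin m → SmoothFun n M),
      t = w ⊗ₜ (f₀ • wedgeDiff f)} = ⊤ := by
  rw [eq_top_iff]
  intro t _
  induction t with
  | zero => exact zero_mem _
  | add s t hs ht => exact add_mem (hs trivial) (ht trivial)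
  | tmul w η =>
    rw [Fr.form_eq_sum η, TensorProduct.tmul_sum]
    exact sum_mem fun I _ => Submodule.subset_span ⟨_, _, _, rfl⟩

theorem CoordFrame.linearMap_ext (Fr : CoordFrame n M) {m : ℕ} {A : Type*} [AddCommGroup A]
    [Module ℝ A] {D D' : (W ⊗[SmoothFun n M] Form n M m) →ₗ[ℝ] A}
    (h : ∀ (w : W) (f₀ : SmoothFun n M) (f : Fin m → SmoothFun n M),
      D (w ⊗ₜ (f₀ • wedgeDiff f)) = D' (w ⊗ₜ (f₀ • wedgeDiff f))) : D = D' := by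
  refine LinearMap.ext_on (Fr.span_tmul_wedgeDiff m) ?_
  rintro _ ⟨w, f₀, f, rfl⟩
  exact h w f₀ f

/-- The Poisson chain differential on the generators `u ⊗ df₁ ∧ ⋯ ∧ df_{r+1}`. -/
def PoissonModule.chain (V : PoissonModule P W) (r : ℕ) (u : W)
    (f : Fin (r + 1) → SmoothFun n M) : W ⊗[SmoothFun n M] Form n M r :=
  (∑ i : Fin (r + 1), (-1 : ℤ) ^ (i : ℕ) •
    (V.act u (f i) ⊗ₜ[SmoothFun n M] wedgeDiff (Fin.removeNth i f))) +
      pairSum P r (fun g => u ⊗ₜ[SmoothFun n M] wedgeDiff g) f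

theorem PoissonModule.isBoundary_iff (V : PoissonModule P W) (r : ℕ)
    (D : (W ⊗[SmoothFun n M] Form n M (r + 1)) →ₗ[ℝ] (W ⊗[SmoothFun n M] Form n M r)) :
    V.IsBoundary r D ↔ ∀ (w : W) (f₀ : SmoothFun n M) (f : Fin (r + 1) → SmoothFun n M),
      D (w ⊗ₜ (f₀ • wedgeDiff f)) = V.chain r (f₀ • w) f := by
  simp only [IsBoundary, chain, ← TensorProduct.smul_tmul]

theorem PoissonModule.twist_neg_twist (V : PoissonModule P W) {φ : VField n M}
    (hφ : P.IsPoissonField φ) : (V.twist (-φ) hφ.neg).twist φ hφ = V := by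
  have hext : ∀ V V' : PoissonModule P W, V.act = V'.act → V = V' := by
    rintro ⟨_, _, _, _⟩ ⟨_, _, _, _⟩ h
    cases h
    rfl
  refine hext _ _ (LinearMap.ext fun w => LinearMap.ext fun f => ?_)
  rw [twist_act, twist_act, VField.neg_apply, neg_smul, neg_add_cancel_right]

variable [T2Space M] {μ : Form n M n} {J : (SmoothFun n M) [⋀^Fin n]→ₗ[ℝ] SmoothFun n M}

theorem starAlt_chain (hJ : IsDualVolume μ J) (Fr : CoordFrame n M) (V : PoissonModule P W)
    {m k : ℕ} (h : m + k = n) (u : W) (f : Fin (m + 1) → SmoothFun n M)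
    (z : Fin k → SmoothFun n M) :
    starAlt W J Fr h (V.chain m u f) z =
      (∑ l : Fin (m + 1), (-1 : ℤ) ^ (l : ℕ) •
        contract J m k h (l.removeNth f) z • V.act u (f l)) +
      pairSum P m (fun g' => contract J m k h g' z) f • u := by
  let L : (W ⊗[SmoothFun n M] Form n M m) →+ W :=
    { toFun := fun t => starAlt W J Fr h t z
      map_zero' := by rw [map_zero]; rfl
      map_add' := fun s t => by rw [map_add]; rfl }
  have hL (w : W) (g : Fin m → SmoothFun n M) : L (w ⊗ₜ wedgeDiff g) =
      contract J m k h g z • w := by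
    change starAlt W J Fr h (w ⊗ₜ wedgeDiff g) z = _
    rw [starAlt_tmul, hodge_wedgeDiff hJ Fr h]
  change L (V.chain m u f) = _
  rw [PoissonModule.chain, map_add, map_sum, ← pairSum_map]
  simp only [map_zsmul, hL]
  congr 1
  exact pairSum_map P (LinearMap.toSpanSingleton (SmoothFun n M) W u).toAddMonoidHom m _ f

theorem coboundary_starEquiv_tmul (hJ : IsDualVolume μ J) (hμ : IsVolumeForm μ)
    (Fr : CoordFrame n M) {φ : VField n M} (hφ : P.IsModularFor J φ.apply)
    (hφP : P.IsPoissonField φ) (hW : IsGeometric n M W) (V : PoissonModule P W)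
    {m k : ℕ} (h : m + 1 + k = n) (w : W) (f₀ : SmoothFun n M) (f : Fin (m + 1) → SmoothFun n M) :
    (V.twist φ hφP).coboundary k (starEquiv hJ Fr hW h (w ⊗ₜ (f₀ • wedgeDiff f))) =
      -MultiDer.toFun n M W (k + 1) (starEquiv hJ Fr hW (by omega : m + (k + 1) = n)
        (V.chain m (f₀ • w) f)) := by
  have h1 : starAlt W J Fr h (w ⊗ₜ (f₀ • wedgeDiff f)) =
      altSmul (contract J (m + 1) k h f) (f₀ • w) :=
    AlternatingMap.ext fun z => starAlt_tmul_smul_wedgeDiff hJ Fr h w f₀ f z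
  funext z
  have h2 := cob_altSmul_contract hJ hμ Fr hφ hφP hW V h (f₀ • w) f z
  rw [← starAlt_chain hJ Fr V (by omega : m + (k + 1) = n), ← h1] at h2
  exact h2

/-- Above the top degree the source of `∂` is zero, so its formula must give zero for `∂` to exist.
The only case with a possibly nonzero target is `m = n`, where the star map identifies it with
degree-zero multiderivations. -/
theorem chain_eq_zero (hJ : IsDualVolume μ J) (hμ : IsVolumeForm μ)
    (Fr : CoordFrame n M) {φ : VField n M} (hφ : P.IsModularFor J φ.apply)
    (hW : IsGeometric n M W) (V : PoissonModule P W) {m : ℕ} (h : n < m + 1) (u : W)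
    (f : Fin (m + 1) → SmoothFun n M) : V.chain m u f = 0 := by
  obtain hm | rfl := (Nat.lt_succ_iff.1 h).lt_or_eq
  · have := subsingleton_tensor (M := M) (W := W) hm
    exact Subsingleton.elim _ _
  · refine (starEquiv hJ Fr hW (add_zero n)).injective
      (Subtype.ext (AlternatingMap.ext fun z => ?_))
    rw [map_zero]
    refine (starAlt_chain hJ Fr V (add_zero n) u f z).trans ?_
    have h1 (g : Fin n → SmoothFun n M) : contract J n 0 (add_zero n) g z =
        (splitSign n n 0 (add_zero n) : SmoothFun n M) * J g := by
      rw [contract_swap, zsmul_eq_mul]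
      rfl
    have h2 := hJ.alternating_sum_eq_zero hμ Fr hW (V.isDer_act u) f
    have h3 := pairSum_map P (AddMonoidHom.mulLeft
      (splitSign n n 0 (add_zero n) : SmoothFun n M)) n J f
    simp only [AddMonoidHom.coe_mulLeft, pairSum_dualVolume hJ hμ Fr hφ, mul_zero] at h3
    simp only [h1, mul_smul, smul_comm _ (splitSign n n 0 (add_zero n) : SmoothFun n M),
      ← Finset.smul_sum]
    rw [h2, h3, smul_zero, zero_smul, zero_add]
    rfl

/-- No relation among generators has to be checked: `F = -δ ∘ ⋆` is already well defined, agrees on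
generators with `G` applied to the desired value, and `G` is injective, so `∂ = G⁻¹ ∘ F`. Uniqueness
holds because the generators span. -/
theorem existsUnique_isBoundary (hJ : IsDualVolume μ J) (hμ : IsVolumeForm μ)
    (Fr : CoordFrame n M) {φ : VField n M} (hφ : P.IsModularFor J φ.apply)
    (hφP : P.IsPoissonField φ) (hW : IsGeometric n M W) (V : PoissonModule P W) (r : ℕ) :
    ∃! D : (W ⊗[SmoothFun n M] Form n M (r + 1)) →ₗ[ℝ] (W ⊗[SmoothFun n M] Form n M r),
      V.IsBoundary r D := by
  simp only [V.isBoundary_iff]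
  refine existsUnique_of_exists_of_unique ?_ fun D D' hD hD' =>
    Fr.linearMap_ext fun w f₀ f => (hD w f₀ f).trans (hD' w f₀ f).symm
  obtain hr | hr := Nat.lt_or_ge n (r + 1)
  · exact ⟨0, fun w f₀ f => (chain_eq_zero hJ hμ Fr hφ hW V hr (f₀ • w) f).symm⟩
  · obtain ⟨k, hk⟩ := Nat.exists_eq_add_of_le hr
    let F := -((V.twist φ hφP).coboundary k ∘ₗ
      (starEquiv hJ Fr hW hk.symm).toLinearMap)
    let G := MultiDer.toFun n M W (k + 1) ∘ₗ
      (starEquiv hJ Fr hW (by omega : r + (k + 1) = n)).toLinearMap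
    have hG : Function.Injective G := by
      exact (multiDer_toFun_injective _).comp (LinearEquiv.injective _)
    have hFG (w : W) (f₀ : SmoothFun n M) (f : Fin (r + 1) → SmoothFun n M) :
        F (w ⊗ₜ (f₀ • wedgeDiff f)) = G (V.chain r (f₀ • w) f) :=
      neg_eq_iff_eq_neg.2 (coboundary_starEquiv_tmul hJ hμ Fr hφ hφP hW V hk.symm w f₀ f)
    have hF (t) : F t ∈ LinearMap.range G := by
      have ht : t ∈ Submodule.span ℝ {t : W ⊗[SmoothFun n M] Form n M (r + 1) |
        ∃ (w : W) (f₀ : SmoothFun n M) (f : Fin (r + 1) → SmoothFun n M),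
          t = w ⊗ₜ (f₀ • wedgeDiff f)} := by
        rw [Fr.span_tmul_wedgeDiff]
        trivial
      induction ht using Submodule.span_induction with
      | mem t ht =>
        obtain ⟨w, f₀, f, rfl⟩ := ht
        exact ⟨_, (hFG w f₀ f).symm⟩
      | zero => rw [map_zero]; exact zero_mem _
      | add s t _ _ hs ht => rw [map_add]; exact add_mem hs ht
      | smul c t _ ht => rw [map_smul]; exact Submodule.smul_mem _ c ht
    refine ⟨(LinearEquiv.ofInjective G hG).symm ∘ₗ F.codRestrict _ hF, fun w f₀ f => ?_⟩
    refine (LinearEquiv.symm_apply_eq _).2 (Subtype.ext ?_)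
    exact hFG w f₀ f

theorem coboundary_starEquiv (hJ : IsDualVolume μ J) (hμ : IsVolumeForm μ)
    (Fr : CoordFrame n M) {φ : VField n M} (hφ : P.IsModularFor J φ.apply)
    (hφP : P.IsPoissonField φ) (hW : IsGeometric n M W) (V : PoissonModule P W)
    {m k : ℕ} (h : m + 1 + k = n) (t : W ⊗[SmoothFun n M] Form n M (m + 1)) :
    (V.twist φ hφP).coboundary k (starEquiv hJ Fr hW h t) =
      -MultiDer.toFun n M W (k + 1) (starEquiv hJ Fr hW (by omega : m + (k + 1) = n)
        (V.boundary m t)) := by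
  have hex := (existsUnique_isBoundary hJ hμ Fr hφ hφP hW V m).exists
  have hD : V.IsBoundary m (V.boundary m) := by
    rw [PoissonModule.boundary, dif_pos hex]
    exact hex.choose_spec
  rw [V.isBoundary_iff] at hD
  have h1 : (V.twist φ hφP).coboundary k ∘ₗ
      (starEquiv hJ Fr hW h).toLinearMap =
      -(MultiDer.toFun n M W (k + 1) ∘ₗ
        (starEquiv hJ Fr hW (by omega : m + (k + 1) = n)).toLinearMap ∘ₗ V.boundary m) := by
    refine Fr.linearMap_ext fun w f₀ f => ?_
    refine (coboundary_starEquiv_tmul hJ hμ Fr hφ hφP hW V h w f₀ f).trans ?_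
    rw [← hD]
    rfl
  exact congrArg (fun L => L t) h1

theorem mem_cycles_iff (hJ : IsDualVolume μ J) (hμ : IsVolumeForm μ)
    (Fr : CoordFrame n M) {φ : VField n M} (hφ : P.IsModularFor J φ.apply)
    (hφP : P.IsPoissonField φ) (hW : IsGeometric n M W) (V : PoissonModule P W)
    {m k : ℕ} (h : m + k = n) (t : W ⊗[SmoothFun n M] Form n M m) :
    t ∈ V.cycles m ↔ starEquiv hJ Fr hW h t ∈ (V.twist φ hφP).cocycles k := by
  cases m with
  | zero =>
    -- Degree `0` chains are all cycles, and they correspond to cochains of degree `n`, all of which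
    -- are cocycles by `cob_altSmul_dualVolume`.
    refine iff_of_true trivial ?_
    obtain rfl : n = k := by omega
    have h1 : (V.twist φ hφP).coboundary n ∘ₗ
        (starEquiv hJ Fr hW h).toLinearMap = 0 := by
      refine Fr.linearMap_ext fun w f₀ f => ?_
      have h1 : starAlt W J Fr h (w ⊗ₜ (f₀ • wedgeDiff f)) = altSmul J (f₀ • w) :=
        AlternatingMap.ext fun z => starAlt_tmul_smul_wedgeDiff hJ Fr h w f₀ f z
      funext z
      have h2 := cob_altSmul_dualVolume hJ hμ Fr hφ hφP hW V (f₀ • w) z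
      rw [← h1] at h2
      exact h2
    exact congrArg (fun L => L t) h1
  | succ m =>
    rw [PoissonModule.cycles, PoissonModule.cocycles, LinearMap.mem_ker, LinearMap.mem_ker,
      coboundary_starEquiv hJ hμ Fr hφ hφP hW V h, neg_eq_zero,
      map_eq_zero_iff _ (multiDer_toFun_injective _), LinearEquiv.map_eq_zero_iff]

theorem mem_range_boundary_iff (hJ : IsDualVolume μ J) (hμ : IsVolumeForm μ)
    (Fr : CoordFrame n M) {φ : VField n M} (hφ : P.IsModularFor J φ.apply)
    (hφP : P.IsPoissonField φ) (hW : IsGeometric n M W) (V : PoissonModule P W)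
    {m k : ℕ} (h : m + k = n) (t : W ⊗[SmoothFun n M] Form n M m) :
    t ∈ LinearMap.range (V.boundary m) ↔
      starEquiv hJ Fr hW h t ∈ (V.twist φ hφP).coboundaries k := by
  cases k with
  | zero =>
    -- Here `m = n`: there are no forms of degree `n + 1`, which matches the absence of coboundaries
    -- in degree `0`.
    have := subsingleton_tensor (W := W) (n := n) (M := M) (m := m + 1) (by omega)
    rw [PoissonModule.coboundaries, Submodule.mem_bot, LinearEquiv.map_eq_zero_iff]
    constructor
    · rintro ⟨s, rfl⟩
      rw [Subsingleton.elim s 0, map_zero]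
    · rintro rfl
      exact zero_mem _
  | succ k =>
    have h' : m + 1 + k = n := by omega
    rw [PoissonModule.coboundaries, Submodule.mem_comap]
    constructor
    · rintro ⟨s, rfl⟩
      rw [← Submodule.neg_mem_iff, ← coboundary_starEquiv hJ hμ Fr hφ hφP hW V h']
      exact ⟨_, rfl⟩
    · rintro ⟨X, hX⟩
      obtain ⟨s, rfl⟩ := (starEquiv hJ Fr hW h').surjective X
      rw [coboundary_starEquiv hJ hμ Fr hφ hφP hW V h', ← map_neg, ← map_neg] at hX
      have h1 := (starEquiv hJ Fr hW h).injective (multiDer_toFun_injective _ hX)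
      exact ⟨-s, by rw [map_neg, h1]⟩

theorem nonempty_homology_equiv (hJ : IsDualVolume μ J) (hμ : IsVolumeForm μ)
    (Fr : CoordFrame n M) {φ : VField n M} (hφ : P.IsModularFor J φ.apply)
    (hφP : P.IsPoissonField φ) (hW : IsGeometric n M W) (V : PoissonModule P W)
    {m k : ℕ} (h : m + k = n) :
    Nonempty (V.Homology m ≃ₗ[ℝ] (V.twist φ hφP).Cohomology k) :=
  nonempty_quotient_equiv (starEquiv hJ Fr hW h) (mem_cycles_iff hJ hμ Fr hφ hφP hW V h)
    (mem_range_boundary_iff hJ hμ Fr hφ hφP hW V h)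

end Duality

end PoissonDuality

end

theorem mainTheorem2 (n : ℕ) (M : Type*) [TopologicalSpace M]
    [ChartedSpace (EuclideanSpace ℝ (Fin n)) M] [IsManifold (𝓡 n) ∞ M] [T2Space M]
    [SecondCountableTopology M] (P : PoissonStructure n M) (μ : Form n M n)
    (hμ : IsVolumeForm μ) :
    ∃ φ : VField n M, P.IsModularField μ φ ∧ (∀ ψ : VField n M, P.IsModularField μ ψ → ψ = φ) ∧
      ∃ hφ : P.IsPoissonField φ,
        ∀ (W : Type*) [AddCommGroup W] [Module (SmoothFun n M) W] [Module ℝ W]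
          [IsScalarTower ℝ (SmoothFun n M) W] (V : PoissonModule P W), IsGeometric n M W →
          (∀ r : ℕ, ∃! D : (W ⊗[SmoothFun n M] Form n M (r + 1)) →ₗ[ℝ]
            (W ⊗[SmoothFun n M] Form n M r), V.IsBoundary r D) ∧
          ∀ k : ℕ, k ≤ n →
            Nonempty ((V.twist (-φ) hφ.neg).Homology (n - k) ≃ₗ[ℝ] V.Cohomology k) ∧
            Nonempty (V.Homology (n - k) ≃ₗ[ℝ] (V.twist φ hφ).Cohomology k) := by
  obtain ⟨Fr⟩ := nonempty_coordFrame n M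
  obtain ⟨J, hJ⟩ := exists_isDualVolume Fr hμ
  obtain ⟨φ, h1, h2, hφP, hφ⟩ := exists_modularField Fr P hμ hJ
  refine ⟨φ, h1, h2, hφP, fun W _ _ _ _ V hW => ⟨fun r =>
    existsUnique_isBoundary hJ hμ Fr hφ hφP hW V r, fun k hk => ⟨?_, ?_⟩⟩⟩
  -- The second isomorphism applied to `W_{-φ}`, whose twist by `φ` is `W`.
  · have h := nonempty_homology_equiv hJ hμ Fr hφ hφP hW (V.twist (-φ) hφP.neg)
      (Nat.sub_add_cancel hk)
    rwa [V.twist_neg_twist hφP] at h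
  · exact nonempty_homology_equiv hJ hμ Fr hφ hφP hW V (Nat.sub_add_cancel hk)
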